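/- Let $\mathcal A=(L_1,\dots,L_{10})$ be an arrangement of $10$ distinct lines in $\mathbb{CP}^2$. The multiplicity of a point is the number of lines of $\mathcal A$ through it, $n_r$ is the number of points of multiplicity $r$, and a multiple point is a point of multiplicity at least $3$. For ordered arrangements of $n$ lines write $L(\mathcal A)=L(\mathcal B)$ if $\dim\bigcap_{i\in S}A_i=\dim\bigcap_{i\in S}B_i$ for every nonempty $S\subseteq\{1,\dots,n\}$, and call $\mathcal A,\mathcal B$ lattice isomorphic if this holds after a permutation of the lines of $\mathcal B$. Let $$\mathcal M_{\mathcal A}=\{\mathcal B\in((\mathbb{CP}^2)^*)^{n}\mid L(\mathcal B)=L(\mathcal A)\}/PGL(3,\mathbb C)$$ with the quotient of the Zariski topology, and let $\mathcal M^c_{\mathcal A}$ be its quotient by complex conjugation. Suppose that every line of $\mathcal A$ passes through at least $3$ multiple points ($\mathcal A$ is non-reductive), that $n_4=2$ and $n_r=0$ for all $r\ge5$, and that the two quadruple points lie on a common line of $\mathcal A$. Then either $\mathcal M^c_{\mathcal A}$ is irreducible, or $\mathcal A$ is lattice isomorphic to one of the arrangements defined by the following equations: 1. $xyz(x-z)(y-z)(x-tz)(y-(1-t)z)(y-x-(1-t)z)(y-x+tz)(y-(2-t)x)=0$,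 where $t=\frac{1\pm\sqrt5}{2}$; 2. $xyz(x-z)(y-z)(x-t_1z)(y-t_2z)(y-x)(y-(t_2-1)x-z)(y-(t_2-1)x-(1-t_1)z)=0$, where $t_1=(t_2-1)^2$ and $(t_2-1)^3-(t_2-1)^2+1=0$; 3. $xyz(x-z)(y-z)(x-t^2z)(y-tz)(y-x)(y+\frac1t x-tz)(y+\frac1t(x-z))=0$, where $t=\frac{-1\pm\sqrt5}{2}$; 4. $xyz(x-z)(y-z)(x-(1+\frac s2)z)(y-(2+s)z)(y-x)(y-sx+sz)(y-sx-z)=0$, where $s=\pm\sqrt2$. In each of the four families, with the lines ordered as the factors are written, the ordered arrangements with the same lattice as a given member are, up to $PGL(3,\mathbb C)$, exactly the members of the family. In families 1, 3 and 4 the moduli space consists of exactly two points, both real (represented by arrangements with real coefficients). In family 2 it consists of exactly three points, of which exactly one is real. In all four families the quotient of the moduli space by complex conjugation consists of exactly two points. -/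

import Mathlib

open scoped LinearAlgebra.Projectivization

noncomputable section

namespace LineArrangement

/-- The coordinate space `ℂ³`. Points of `ℂℙ²` are the elements `[x : y : z]` of `ℙ ℂ V`. A line
`a x + b y + c z = 0` of `ℂℙ²` is recorded by its coefficients `[a : b : c]`, so that
`ℙ ℂ V` also serves as the dual projective plane. -/
abbrev V : Type := Fin 3 → ℂ

/-- An ordered `n`-tuple of lines in `ℂℙ²`, i.e. an element of `((ℂℙ²)^*)ⁿ`. It is an arrangement
of `n` lines when it is injective. -/
abbrev Lines (n : ℕ) : Type := Fin n → ℙ ℂ V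

/-- The linear plane in `ℂ³` lying over the line with coefficients `l`. -/
def plane (l : ℙ ℂ V) : Submodule ℂ V where
  carrier := {v | l.rep ⬝ᵥ v = 0}
  add_mem' := by
    intro a b ha hb
    simp only [Set.mem_ofPred_eq] at *
    rw [dotProduct_add, ha, hb, add_zero]
  zero_mem' := by simp
  smul_mem' := by
    intro c v hv
    simp only [Set.mem_ofPred_eq] at *
    rw [dotProduct_smul, hv, smul_zero]

/-- The point `P` lies on the line `l`. -/
def OnLine (P l : ℙ ℂ V) : Prop := P.submodule ≤ plane l

/-- The multiplicity of the point `P`: the number of lines of the arrangement through `P`. -/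
def mult {n : ℕ} (A : Lines n) (P : ℙ ℂ V) : ℕ∞ := {i | OnLine P (A i)}.encard

/-- `n_r`: the number of points of multiplicity `r`. -/
def numPoints {n : ℕ} (A : Lines n) (r : ℕ) : ℕ∞ := {P | mult A P = r}.encard

/-- Every line of the arrangement passes through at least three multiple points
(points of multiplicity at least `3`). -/
def NonReductive {n : ℕ} (A : Lines n) : Prop :=
  ∀ i, 3 ≤ {P | OnLine P (A i) ∧ 3 ≤ mult A P}.encard

/-- One more than the (projective) dimension of `⋂_{i ∈ S} A i`, the empty set having
dimension `-1`. -/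
def interDim {n : ℕ} (A : Lines n) (S : Finset (Fin n)) : ℕ :=
  Module.finrank ℂ (⨅ i ∈ S, plane (A i) : Submodule ℂ V)

/-- `L(A) = L(B)`: the intersection lattices agree, with the given orderings of the lines. -/
def SameLattice {n : ℕ} (A B : Lines n) : Prop :=
  ∀ S : Finset (Fin n), S.Nonempty → interDim A S = interDim B S

/-- `A ∼ B`: lattice isomorphism, i.e. the lattices agree after a permutation of the lines. -/
def LatticeIso {n : ℕ} (A B : Lines n) : Prop :=
  ∃ φ : Equiv.Perm (Fin n), ∀ S : Finset (Fin n), S.Nonempty →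
    interDim A S = interDim B (S.map φ.toEmbedding)

/-- Projective equivalence of ordered arrangements: being in the same orbit of `PGL(3, ℂ)`.
The group acts on coefficients of lines through invertible linear maps. -/
def projSetoid (n : ℕ) : Setoid (Lines n) := MulAction.orbitRel (V ≃ₗ[ℂ] V) (Lines n)

/-- The Zariski topology on `((ℂℙ²)^*)ⁿ`: a basis of open sets is given by the non-vanishing loci
of polynomials which are homogeneous in each of the `n` triples of coordinates. -/
@[reducible] def zariski (n : ℕ) : TopologicalSpace (Lines n) :=
  TopologicalSpace.generateFrom
    {U | ∃ (F : MvPolynomial (Fin n × Fin 3) ℂ) (d : Fin n → ℕ),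
      F.IsWeightedHomogeneous (fun p : Fin n × Fin 3 => (Pi.single p.1 1 : Fin n → ℕ)) d ∧
      U = {B : Lines n | MvPolynomial.eval (fun p => (B p.1).rep p.2) F ≠ 0}}

/-- The space `{B ∈ ((ℂℙ²)^*)ⁿ | L(B) = L(A)}` of realizations of the lattice of `A`. -/
def Realization {n : ℕ} (A : Lines n) : Type := {B : Lines n // SameLattice A B}

instance {n : ℕ} (A : Lines n) : TopologicalSpace (Realization A) :=
  TopologicalSpace.induced Subtype.val (zariski n)

/-- Projective equivalence of realizations. -/
instance realizationSetoid {n : ℕ} (A : Lines n) : Setoid (Realization A) :=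
  Setoid.comap Subtype.val (projSetoid n)

/-- The moduli space `M_A = {B | L(B) = L(A)} / PGL(3, ℂ)`. -/
def Moduli {n : ℕ} (A : Lines n) : Type := Quotient (realizationSetoid A)

/-- The moduli space carries the quotient of the Zariski topology. -/
instance {n : ℕ} (A : Lines n) : TopologicalSpace (Moduli A) :=
  inferInstanceAs (TopologicalSpace (Quotient (realizationSetoid A)))

/-- The class in the moduli space of a realization. -/
def Moduli.mk {n : ℕ} {A : Lines n} (B : Realization A) : Moduli A :=
  Quotient.mk (realizationSetoid A) B

/-- Complex conjugation of coordinates, as a semilinear map. -/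
def conjV : V →ₛₗ[starRingEnd ℂ] V where
  toFun v := star v
  map_add' := star_add
  map_smul' := by
    intro c v
    ext j
    simp

theorem conjV_injective : Function.Injective conjV := star_injective

/-- The complex conjugate arrangement. -/
def conj {n : ℕ} (A : Lines n) : Lines n := fun i =>
  Projectivization.map conjV conjV_injective (A i)

/-- The quotient `M^c_A` of the moduli space by complex conjugation `[B] ↦ [conj B]`. -/
def ModuliConj {n : ℕ} (A : Lines n) : Type :=
  Quot fun m m' : Moduli A =>
    ∃ B B' : Realization A, Moduli.mk B = m ∧ Moduli.mk B' = m' ∧ B'.val = conj B.val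

/-- `M^c_A` carries the quotient topology. -/
instance {n : ℕ} (A : Lines n) : TopologicalSpace (ModuliConj A) :=
  inferInstanceAs (TopologicalSpace (Quot _))

/-- A point of the moduli space is real if it is the class of an arrangement of lines which are
all given by equations with real coefficients. -/
def IsRealPoint {n : ℕ} {A : Lines n} (m : Moduli A) : Prop :=
  ∃ B : Realization A, Moduli.mk B = m ∧
    ∀ i, ∃ (v : Fin 3 → ℝ) (h : (fun j => (v j : ℂ)) ≠ 0),
      B.val i = Projectivization.mk ℂ (fun j => (v j : ℂ)) h

/-- The lines with the given (nonzero) coefficient vectors. -/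
def ofCoeffs {n : ℕ} (c : Fin n → V) (h : ∀ i, c i ≠ 0) : Lines n :=
  fun i => Projectivization.mk ℂ (c i) (h i)

/-- Coefficients `[a, b, c]` of the factors `a x + b y + c z` of
`xyz(x-z)(y-z)(x-tz)(y-(1-t)z)(y-x-(1-t)z)(y-x+tz)(y-(2-t)x)`. -/
def coeffs₁ (t : ℂ) : Fin 10 → V :=
  ![![1, 0, 0], ![0, 1, 0], ![0, 0, 1], ![1, 0, -1], ![0, 1, -1], ![1, 0, -t],
    ![0, 1, -(1 - t)], ![-1, 1, -(1 - t)], ![-1, 1, t], ![-(2 - t), 1, 0]]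

/-- Coefficients of the factors of
`xyz(x-z)(y-z)(x-t₁z)(y-t₂z)(y-x)(y-(t₂-1)x-z)(y-(t₂-1)x-(1-t₁)z)`. -/
def coeffs₂ (t : ℂ × ℂ) : Fin 10 → V :=
  ![![1, 0, 0], ![0, 1, 0], ![0, 0, 1], ![1, 0, -1], ![0, 1, -1], ![1, 0, -t.1],
    ![0, 1, -t.2], ![-1, 1, 0], ![-(t.2 - 1), 1, -1], ![-(t.2 - 1), 1, -(1 - t.1)]]

/-- Coefficients of the factors of
`xyz(x-z)(y-z)(x-t²z)(y-tz)(y-x)(y+(1/t)x-tz)(y+(1/t)(x-z))`. -/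
def coeffs₃ (t : ℂ) : Fin 10 → V :=
  ![![1, 0, 0], ![0, 1, 0], ![0, 0, 1], ![1, 0, -1], ![0, 1, -1], ![1, 0, -t ^ 2],
    ![0, 1, -t], ![-1, 1, 0], ![1 / t, 1, -t], ![1 / t, 1, -(1 / t)]]

/-- Coefficients of the factors of
`xyz(x-z)(y-z)(x-(1+s/2)z)(y-(2+s)z)(y-x)(y-sx+sz)(y-sx-z)`. -/
def coeffs₄ (s : ℂ) : Fin 10 → V :=
  ![![1, 0, 0], ![0, 1, 0], ![0, 0, 1], ![1, 0, -1], ![0, 1, -1], ![1, 0, -(1 + s / 2)],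
    ![0, 1, -(2 + s)], ![-1, 1, 0], ![-s, 1, s], ![-s, 1, -1]]

theorem ne_zero_of_coord {v : V} (h : v 0 = 1 ∨ v 1 = 1 ∨ v 2 = 1) : v ≠ 0 := by
  rintro rfl
  simp at h

theorem coeffs₁_ne_zero (t : ℂ) (i : Fin 10) : coeffs₁ t i ≠ 0 := by
  apply ne_zero_of_coord
  fin_cases i <;> simp [coeffs₁]

theorem coeffs₂_ne_zero (t : ℂ × ℂ) (i : Fin 10) : coeffs₂ t i ≠ 0 := by
  apply ne_zero_of_coord
  fin_cases i <;> simp [coeffs₂]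

theorem coeffs₃_ne_zero (t : ℂ) (i : Fin 10) : coeffs₃ t i ≠ 0 := by
  apply ne_zero_of_coord
  fin_cases i <;> simp [coeffs₃]

theorem coeffs₄_ne_zero (s : ℂ) (i : Fin 10) : coeffs₄ s i ≠ 0 := by
  apply ne_zero_of_coord
  fin_cases i <;> simp [coeffs₄]

/-- The four families of arrangements. -/
def fam₁ (t : ℂ) : Lines 10 := ofCoeffs (coeffs₁ t) (coeffs₁_ne_zero t)
def fam₂ (t : ℂ × ℂ) : Lines 10 := ofCoeffs (coeffs₂ t) (coeffs₂_ne_zero t)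
def fam₃ (t : ℂ) : Lines 10 := ofCoeffs (coeffs₃ t) (coeffs₃_ne_zero t)
def fam₄ (s : ℂ) : Lines 10 := ofCoeffs (coeffs₄ s) (coeffs₄_ne_zero s)

/-- The admissible parameters of the four families. -/
def par₁ : Set ℂ := {t | t = (1 + (√5 : ℝ)) / 2 ∨ t = (1 - (√5 : ℝ)) / 2}
def par₂ : Set (ℂ × ℂ) :=
  {t | t.1 = (t.2 - 1) ^ 2 ∧ (t.2 - 1) ^ 3 - (t.2 - 1) ^ 2 + 1 = 0}
def par₃ : Set ℂ := {t | t = (-1 + (√5 : ℝ)) / 2 ∨ t = (-1 - (√5 : ℝ)) / 2}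
def par₄ : Set ℂ := {s | s = (√2 : ℝ) ∨ s = -(√2 : ℝ)}

/-- The realizations of the lattice of any member of the family are, up to projective equivalence,
exactly the members of the family; the moduli space has `k` points, of which `r` are real, and its
quotient by complex conjugation has `c` points. -/
def HasModuli {ι : Type} (fam : ι → Lines 10) (par : Set ι) (k r c : ℕ) : Prop :=
  ∀ t ∈ par,
    (∀ B : Lines 10, SameLattice (fam t) B ↔ ∃ s ∈ par, projSetoid 10 (fam s) B) ∧
    Nat.card (Moduli (fam t)) = k ∧
    Nat.card {m : Moduli (fam t) // IsRealPoint m} = r ∧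
    Nat.card (ModuliConj (fam t)) = c

end LineArrangement

end

open LineArrangement

namespace LineArrangement

open Projectivization

/-! ### Incidence of points and lines -/

/-! Let `inf` be the line through the two quadruple points P and Q. Three more lines `col` pass
through P, three more lines `row` through Q, and three lines `obl` remain. Since `inf` contains a
third multiple point, two of the lines `obl` meet on it, and the third avoids that point because
there is no third quadruple point. With `inf` at infinity the lines `col` are vertical, the lines
`row` are horizontal, and `obl 0` and `obl 1` are parallel. Moving two columns and two rows to the
positions 0 and 1 uses up the projective group: seven parameters describe the arrangement
(`Base.exists_param`), and they are invariants of its projective class (`Param.eq_of_smul`).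

The lattice of distinct lines is determined by its concurrent triples (`sameLattice_of_conc_iff`).
Those not fixed by this picture consist of a column, a row and some `obl k`, or of `obl 2`, one of
`obl 0` and `obl 1`, and a column or row. An eleven-entry `Code` records them and so determines the
lattice (`Param.conc_congr`). Non-reductivity turns into counting conditions on the code
(`Frame.exists_code`), and a finite search leaves fourteen codes up to permuting columns, permuting
rows, exchanging `obl 0` with `obl 1`, and exchanging rows with columns (`Code.enum_points`,
`Code.enum_standard`).

Each code is a system of polynomial equations in the seven parameters. Six systems have no
nondegenerate solution. One has a single solution and two determine the solution up to complex
conjugation, so the conjugation quotient is a point. One is solved by a line minus four points,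
whose image is irreducible. The other four are the families of the theorem. There `IsSolution`
identifies the moduli space with the set of admissible parameters, conjugation of arrangements
becoming conjugation of parameters, so all counts are counts of roots of a quadratic or cubic
polynomial. -/

theorem mem_plane_mk {u : V} (hu : u ≠ 0) (v : V) : v ∈ plane (mk ℂ u hu) ↔ u ⬝ᵥ v = 0 := by
  obtain ⟨a, ha⟩ := exists_smul_eq_mk_rep ℂ u hu
  change (mk ℂ u hu).rep ⬝ᵥ v = 0 ↔ _
  rw [← ha, smul_dotProduct, smul_eq_zero_iff_eq]

theorem onLine_mk_iff {u v : V} (hu : u ≠ 0) (hv : v ≠ 0) :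
    OnLine (mk ℂ v hv) (mk ℂ u hu) ↔ u ⬝ᵥ v = 0 := by
  rw [OnLine, submodule_mk, Submodule.span_singleton_le_iff_mem, mem_plane_mk]

theorem onLine_mk_left {v : V} (hv : v ≠ 0) (l : ℙ ℂ V) :
    OnLine (mk ℂ v hv) l ↔ v ∈ plane l := by
  rw [OnLine, submodule_mk, Submodule.span_singleton_le_iff_mem]

/-- Two distinct lines have at most one common point. -/
theorem eq_of_onLine {l m P Q : ℙ ℂ V} (h : l ≠ m) (hPl : OnLine P l) (hPm : OnLine P m)
    (hQl : OnLine Q l) (hQm : OnLine Q m) : P = Q := by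
  induction P with | h v hv =>
  induction Q with | h w hw =>
  induction l with | h a ha =>
  induction m with | h b hb =>
  rw [onLine_mk_iff] at *
  by_contra hne
  apply h
  -- If the two points differed, both coefficient vectors would be orthogonal to v and w, hence
  -- multiples of v × w, and the lines would agree.
  have hc : crossProduct v w ≠ 0 := by
    rw [crossProduct_ne_zero_iff_linearIndependent]
    rw [LinearIndependent.pair_iff' hv]
    intro c hc
    apply hne
    rw [eq_comm, mk_eq_mk_iff']
    exact ⟨c, hc⟩
  have key : ∀ u : V, u ⬝ᵥ v = 0 → u ⬝ᵥ w = 0 → crossProduct u (crossProduct v w) = 0 := by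
    intro u h1 h2
    rw [cross_cross_eq_smul_sub_smul', dotProduct_comm v u, h1, h2]
    simp
  have par : ∀ (u : V), u ≠ 0 → crossProduct u (crossProduct v w) = 0 →
      ∃ c : ℂ, c • crossProduct v w = u := by
    intro u hu h0
    by_contra hno
    push Not at hno
    apply (crossProduct_ne_zero_iff_linearIndependent (F := ℂ)
      (v := crossProduct v w) (w := u)).2
    · rw [LinearIndependent.pair_iff' hc]
      exact hno
    · rw [← cross_anticomm, h0, neg_zero]
  have e : ∀ (u : V) (hu : u ≠ 0), u ⬝ᵥ v = 0 → u ⬝ᵥ w = 0 →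
      mk ℂ u hu = mk ℂ (crossProduct v w) hc := fun u hu h1 h2 => by
    rw [mk_eq_mk_iff']
    exact par u hu (key u h1 h2)
  rw [e a ha hPl hQl, e b hb hPm hQm]

/-- Three lines are concurrent if they have a common point. -/
def Conc (l m n : ℙ ℂ V) : Prop := ∃ P, OnLine P l ∧ OnLine P m ∧ OnLine P n

/-- The determinant of three coefficient vectors. -/
def det₃ (u v w : V) : ℂ :=
  u 0 * (v 1 * w 2 - v 2 * w 1) - u 1 * (v 0 * w 2 - v 2 * w 0) + u 2 * (v 0 * w 1 - v 1 * w 0)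

theorem conc_mk_iff {u v w : V} (hu : u ≠ 0) (hv : v ≠ 0) (hw : w ≠ 0) :
    Conc (mk ℂ u hu) (mk ℂ v hv) (mk ℂ w hw) ↔ det₃ u v w = 0 := by
  have hdet : det₃ u v w = (Matrix.of ![u, v, w]).det := by
    simp [det₃, Matrix.det_fin_three]
    ring
  rw [hdet, ← Matrix.exists_mulVec_eq_zero_iff]
  constructor
  · rintro ⟨P, h1, h2, h3⟩
    induction P with | h x hx =>
    rw [onLine_mk_iff] at h1 h2 h3
    refine ⟨x, hx, ?_⟩
    ext i
    fin_cases i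
    · exact h1
    · exact h2
    · exact h3
  · rintro ⟨x, hx, h⟩
    refine ⟨mk ℂ x hx, ?_, ?_, ?_⟩ <;> rw [onLine_mk_iff]
    · exact congrFun h 0
    · exact congrFun h 1
    · exact congrFun h 2

theorem Conc.rotate {l m n : ℙ ℂ V} (h : Conc l m n) : Conc m n l :=
  let ⟨P, a, b, c⟩ := h; ⟨P, b, c, a⟩

theorem Conc.swap {l m n : ℙ ℂ V} (h : Conc l m n) : Conc m l n :=
  let ⟨P, a, b, c⟩ := h; ⟨P, b, a, c⟩

theorem conc_rotate {l m n : ℙ ℂ V} : Conc l m n ↔ Conc m n l :=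
  ⟨Conc.rotate, fun h => h.rotate.rotate⟩

theorem conc_swap {l m n : ℙ ℂ V} : Conc l m n ↔ Conc m l n := ⟨Conc.swap, Conc.swap⟩

/-- A determinant with two equal rows vanishes. This yields the common point of any two lines. -/
theorem conc_self (l m : ℙ ℂ V) : Conc l l m := by
  induction l with | h a ha =>
  induction m with | h b hb =>
  rw [conc_mk_iff, det₃]
  ring

theorem exists_onLine (l m : ℙ ℂ V) : ∃ P, OnLine P l ∧ OnLine P m :=
  let ⟨P, a, _, b⟩ := conc_self l m; ⟨P, a, b⟩

/-! ### The intersection lattice in terms of concurrent triples -/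

theorem finrank_plane (l : ℙ ℂ V) : Module.finrank ℂ (plane l) = 2 := by
  induction l with | h u hu =>
  have h : plane (mk ℂ u hu) = LinearMap.ker (dotProductBilin ℂ ℂ u) := by
    ext v
    rw [mem_plane_mk]
    simp
  have hne : dotProductBilin ℂ ℂ u ≠ 0 := by
    intro h0
    apply hu
    ext i
    have := LinearMap.congr_fun h0 (Pi.single i 1)
    simpa using this
  have := Module.Dual.finrank_ker_add_one_of_ne_zero (f := dotProductBilin ℂ ℂ u) hne
  rw [h]
  simp at this
  omega

theorem mem_iInf_plane {n : ℕ} {A : Lines n} {S : Finset (Fin n)} {v : V} :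
    v ∈ (⨅ i ∈ S, plane (A i) : Submodule ℂ V) ↔ ∀ i ∈ S, v ∈ plane (A i) := by
  simp [Submodule.mem_iInf]

theorem interDim_eq_zero_iff {n : ℕ} (A : Lines n) (S : Finset (Fin n)) :
    interDim A S = 0 ↔ ¬ ∃ P, ∀ i ∈ S, OnLine P (A i) := by
  rw [interDim, Submodule.finrank_eq_zero, Submodule.eq_bot_iff]
  constructor
  · rintro h ⟨P, hP⟩
    induction P with | h v hv =>
    exact hv (h v (mem_iInf_plane.2 fun i hi => (onLine_mk_left hv _).1 (hP i hi)))
  · intro h v hv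
    by_contra h0
    exact h ⟨mk ℂ v h0, fun i hi => (onLine_mk_left h0 _).2 (mem_iInf_plane.1 hv i hi)⟩

theorem interDim_le_one {n : ℕ} {A : Lines n} {S : Finset (Fin n)} {i j : Fin n}
    (hi : i ∈ S) (hj : j ∈ S) (hij : A i ≠ A j) : interDim A S ≤ 1 := by
  by_cases h0 : interDim A S = 0
  · omega
  rw [interDim_eq_zero_iff, not_not] at h0
  obtain ⟨P, hP⟩ := h0
  refine finrank_le_one (⟨P.rep, mem_iInf_plane.2 fun k hk => hP k hk ?_⟩ : (⨅ i ∈ S, plane (A i) :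
    Submodule ℂ V)) ?_
  · rw [submodule_eq]
    exact Submodule.mem_span_singleton_self _
  · rintro ⟨w, hw⟩
    by_cases h0 : w = 0
    · exact ⟨0, Subtype.ext (by simp [h0])⟩
    have hw' := mem_iInf_plane.1 hw
    have := eq_of_onLine hij ((onLine_mk_left h0 _).2 (hw' i hi)) ((onLine_mk_left h0 _).2 (hw' j hj))
      (hP i hi) (hP j hj)
    rw [← P.mk_rep, mk_eq_mk_iff'] at this
    obtain ⟨c, hc⟩ := this
    exact ⟨c, Subtype.ext hc⟩

theorem interDim_singleton {n : ℕ} (A : Lines n) (i : Fin n) : interDim A {i} = 2 := by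
  rw [interDim, ← finrank_plane (A i)]
  congr 2
  · simp
  all_goals simp

theorem exists_onLine_iff {n : ℕ} {A : Lines n} {S : Finset (Fin n)} {i j : Fin n}
    (hi : i ∈ S) (hj : j ∈ S) (hij : A i ≠ A j) :
    (∃ P, ∀ k ∈ S, OnLine P (A k)) ↔ ∀ k ∈ S, Conc (A i) (A j) (A k) := by
  constructor
  · rintro ⟨P, hP⟩ k hk
    exact ⟨P, hP i hi, hP j hj, hP k hk⟩
  · intro h
    obtain ⟨P, h1, h2⟩ := exists_onLine (A i) (A j)
    refine ⟨P, fun k hk => ?_⟩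
    obtain ⟨Q, q1, q2, q3⟩ := h k hk
    rwa [eq_of_onLine hij h1 h2 q1 q2]

/-- Coinciding lines intersect in a plane of dimension 2, while distinct ones give dimension at most
1. -/
theorem SameLattice.injective {n : ℕ} {A B : Lines n} (h : SameLattice A B)
    (hA : Function.Injective A) : Function.Injective B := by
  intro i j hB
  by_contra hij
  have h1 := interDim_le_one (A := A) (S := {i, j}) (i := i) (j := j) (by simp) (by simp)
    (hA.ne hij)
  rw [h _ (by simp)] at h1
  have h2 : interDim B {i, j} = interDim B {i} := by
    have : (⨅ k ∈ ({i, j} : Finset (Fin n)), plane (B k)) =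
        ⨅ k ∈ ({i} : Finset (Fin n)), plane (B k) := by
      simp [iInf_or, iInf_inf_eq, hB]
    rw [interDim, interDim, this]
  rw [h2, interDim_singleton] at h1
  omega

theorem SameLattice.conc_iff {n : ℕ} {A B : Lines n} (h : SameLattice A B) (i j k : Fin n) :
    Conc (A i) (A j) (A k) ↔ Conc (B i) (B j) (B k) := by
  have key : ∀ C : Lines n, Conc (C i) (C j) (C k) ↔ interDim C {i, j, k} ≠ 0 := by
    intro C
    rw [ne_eq, interDim_eq_zero_iff, not_not]
    simp [Conc]
  rw [key, key, h _ (by simp)]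

/-- A single line always has dimension 2. Two or more distinct lines have dimension 0 or 1, and it
is 1 exactly when every line of the set is concurrent with two fixed distinct ones. -/
theorem sameLattice_of_conc_iff {n : ℕ} {A B : Lines n} (hA : Function.Injective A)
    (hB : Function.Injective B)
    (h : ∀ i j k, Conc (A i) (A j) (A k) ↔ Conc (B i) (B j) (B k)) : SameLattice A B := by
  intro S hS
  obtain ⟨i, rfl⟩ | hS2 := hS.exists_eq_singleton_or_nontrivial
  · rw [interDim_singleton, interDim_singleton]
  obtain ⟨i, hi, j, hj, hij⟩ := hS2
  have h1 := interDim_le_one hi hj (hA.ne hij)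
  have h2 := interDim_le_one hi hj (hB.ne hij)
  have h3 : interDim A S = 0 ↔ interDim B S = 0 := by
    rw [interDim_eq_zero_iff, interDim_eq_zero_iff, exists_onLine_iff hi hj (hA.ne hij),
      exists_onLine_iff hi hj (hB.ne hij)]
    simp only [h]
  omega

theorem SameLattice.trans {n : ℕ} {A B C : Lines n} (h : SameLattice A B) (h' : SameLattice B C) :
    SameLattice A C := fun S hS => (h S hS).trans (h' S hS)

theorem interDim_comp {n : ℕ} (A : Lines n) (e : Equiv.Perm (Fin n)) (S : Finset (Fin n)) :
    interDim (A ∘ e) S = interDim A (S.map e.toEmbedding) := by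
  have : (⨅ i ∈ S, plane ((A ∘ e) i)) = ⨅ i ∈ S.map e.toEmbedding, plane (A i) := by
    ext v
    simp only [Submodule.mem_iInf, Finset.forall_mem_map]
    rfl
  rw [interDim, interDim, this]

/-! ### Projective equivalence and complex conjugation -/

/-- The determinant of the three coefficient vectors is multiplied by the nonzero determinant of g.
-/
theorem conc_smul_iff (g : V ≃ₗ[ℂ] V) (l m n : ℙ ℂ V) :
    Conc (g • l) (g • m) (g • n) ↔ Conc l m n := by
  induction l with | h a ha =>
  induction m with | h b hb =>
  induction n with | h c hc =>
  rw [smul_mk, smul_mk, smul_mk, conc_mk_iff, conc_mk_iff]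
  have hdet : ∀ u v w : V, det₃ u v w = (Matrix.of ![u, v, w]).det := by
    intro u v w
    simp [det₃, Matrix.det_fin_three]
    ring
  have hlin : Matrix.of ![g • a, g • b, g • c] = Matrix.of ![a, b, c] *
      (LinearMap.toMatrix' (g : V →ₗ[ℂ] V)).transpose := by
    ext i j
    rw [Matrix.mul_apply_eq_vecMul, Matrix.vecMul_transpose, LinearMap.toMatrix'_mulVec]
    fin_cases i <;> rfl
  rw [hdet, hdet, hlin, Matrix.det_mul, Matrix.det_transpose, LinearMap.det_toMatrix', mul_eq_zero,
    or_iff_left]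
  exact (LinearEquiv.isUnit_det' g).ne_zero

theorem projSetoid_iff {n : ℕ} {A B : Lines n} :
    projSetoid n A B ↔ ∃ g : V ≃ₗ[ℂ] V, ∀ i, g • B i = A i := by
  change A ∈ MulAction.orbit _ B ↔ _
  rw [MulAction.mem_orbit_iff]
  simp [funext_iff]

theorem sameLattice_of_proj {n : ℕ} {A B : Lines n} (hA : Function.Injective A)
    (h : projSetoid n A B) : SameLattice A B := by
  obtain ⟨g, hg⟩ := projSetoid_iff.1 h
  refine sameLattice_of_conc_iff hA (fun i j hij => hA ?_) fun i j k => ?_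
  · rw [← hg, ← hg, hij]
  · rw [← hg, ← hg, ← hg, conc_smul_iff]

theorem conj_conj {n : ℕ} (A : Lines n) : conj (conj A) = A := by
  funext i
  simp only [conj]
  induction A i with | h v hv =>
  rw [map_mk, map_mk]
  congr 1
  exact star_star v

/-- The complex conjugate of a linear automorphism. -/
def conjEquiv (g : V ≃ₗ[ℂ] V) : V ≃ₗ[ℂ] V where
  toFun v := star (g (star v))
  map_add' u v := by simp
  map_smul' c v := by simp
  invFun v := star (g.symm (star v))
  left_inv v := by simp
  right_inv v := by simp

theorem projSetoid_conj {n : ℕ} {A B : Lines n} (h : projSetoid n A B) :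
    projSetoid n (conj A) (conj B) := by
  rw [projSetoid_iff] at *
  obtain ⟨g, hg⟩ := h
  refine ⟨conjEquiv g, fun i => ?_⟩
  simp only [conj, ← hg]
  induction B i with | h v hv =>
  rw [map_mk, smul_mk, smul_mk, map_mk]
  congr 1
  change star (g (star (star v))) = star (g v)
  rw [star_star]

end LineArrangement

namespace LineArrangement

open Projectivization

/-! ### Normal form -/

/-- The roles of the lines: `col` and `row` are the lines through the first, respectively second,
quadruple point, `inf` is the line through both, and `obl` are the remaining three lines, of which
`obl 0` and `obl 1` meet on `inf`. -/
inductive Label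
  | col (i : Fin 3)
  | row (j : Fin 3)
  | inf
  | obl (k : Fin 3)

open Label

/-- The incidences which make it possible to choose affine coordinates such that the lines `col` are
vertical, the lines `row` are horizontal and `inf` is the line at infinity. -/
structure Base (X : Label → ℙ ℂ V) : Prop where
  inj : Function.Injective X
  cols : ∀ i i', Conc (X (col i)) (X (col i')) (X inf)
  rows : ∀ j j', Conc (X (row j)) (X (row j')) (X inf)
  par : Conc (X inf) (X (obl 0)) (X (obl 1))
  col_row : ¬ Conc (X (col 0)) (X (row 0)) (X inf)
  col_obl : ∀ k, ¬ Conc (X (col 0)) (X inf) (X (obl k))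
  row_obl : ∀ k, ¬ Conc (X (row 0)) (X inf) (X (obl k))
  obl_obl : ¬ Conc (X inf) (X (obl 0)) (X (obl 2))

/-- Apart from distinctness, `Base` speaks only of concurrent triples, so it passes to every
arrangement with the same lattice. -/
theorem Base.congr {X Y : Label → ℙ ℂ V} (hX : Base X) (hY : Function.Injective Y)
    (h : ∀ x y z, Conc (X x) (X y) (X z) ↔ Conc (Y x) (Y y) (Y z)) : Base Y := by
  obtain ⟨_, h1, h2, h3, h4, h5, h6, h7⟩ := hX
  simp only [h] at h1 h2 h3 h4 h5 h6 h7
  exact ⟨hY, h1, h2, h3, h4, h5, h6, h7⟩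

theorem Base.smul {X : Label → ℙ ℂ V} (hX : Base X) (g : V ≃ₗ[ℂ] V) :
    Base (fun l => g • X l) :=
  hX.congr (fun _ _ h => hX.inj (MulAction.injective g h)) fun _ _ _ => (conc_smul_iff g _ _ _).symm

/-- The parameters of an arrangement in normal form: the lines are `x = 0`, `x = z`, `x = s z`,
`y = 0`, `y = z`, `y = t z`, `z = 0`, `y = κ x + γ₀ z`, `y = κ x + γ₁ z` and `y = μ x + ν z`. -/
structure Param where
  (s t κ γ₀ γ₁ μ ν : ℂ)

namespace Param

variable (q : Param)

/-- The positions of the vertical lines. -/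
def a : Fin 3 → ℂ := ![0, 1, q.s]
/-- The positions of the horizontal lines. -/
def b : Fin 3 → ℂ := ![0, 1, q.t]
/-- The slopes of the oblique lines. -/
def slope : Fin 3 → ℂ := ![q.κ, q.κ, q.μ]
/-- The intercepts of the oblique lines. -/
def icept : Fin 3 → ℂ := ![q.γ₀, q.γ₁, q.ν]

/-- The coefficients of the lines of an arrangement in normal form. -/
def coef : Label → V
  | col i => ![1, 0, -q.a i]
  | row j => ![0, 1, -q.b j]
  | inf => ![0, 0, 1]
  | obl k => ![-q.slope k, 1, -q.icept k]

theorem coef_ne_zero (l : Label) : q.coef l ≠ 0 := by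
  apply ne_zero_of_coord
  cases l <;> simp [coef]

/-- The arrangement in normal form. -/
noncomputable def lines (l : Label) : ℙ ℂ V := Projectivization.mk ℂ (q.coef l) (q.coef_ne_zero l)

/-- Nondegeneracy of the parameters. -/
structure Good : Prop where
  s0 : q.s ≠ 0
  s1 : q.s ≠ 1
  t0 : q.t ≠ 0
  t1 : q.t ≠ 1
  κ0 : q.κ ≠ 0
  μ0 : q.μ ≠ 0
  γ : q.γ₀ ≠ q.γ₁
  κμ : q.κ ≠ q.μ

theorem conc_iff (x y z : Label) :
    Conc (q.lines x) (q.lines y) (q.lines z) ↔ det₃ (q.coef x) (q.coef y) (q.coef z) = 0 :=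
  conc_mk_iff _ _ _

end Param

theorem mk_eq_of_smul {v w : V} {hv : v ≠ 0} {hw : w ≠ 0} (c : ℂ) (h : ∀ i, c * w i = v i) :
    Projectivization.mk ℂ v hv = Projectivization.mk ℂ w hw := by
  rw [mk_eq_mk_iff']
  exact ⟨c, funext h⟩

theorem mk_ext {v w : V} {hv : v ≠ 0} {hw : w ≠ 0} (h : v = w) : Projectivization.mk ℂ v hv = Projectivization.mk ℂ w hw := by
  subst h
  rfl

/-- Concurrency with `col 0` and `inf` kills the y-coefficient of `col 2`, and being different from
`inf` makes its x-coefficient invertible; rows are symmetric. For `obl k`, the two non-concurrencies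
with `inf` make the y- and x-coefficients nonzero, which gives a slope and its nonvanishing. -/
theorem exists_param_of_frame {X : Label → ℙ ℂ V} (hX : Base X)
    (h0 : X (col 0) = Projectivization.mk ℂ ![1, 0, 0] (ne_zero_of_coord (by simp)))
    (h1 : X (row 0) = Projectivization.mk ℂ ![0, 1, 0] (ne_zero_of_coord (by simp)))
    (h2 : X inf = Projectivization.mk ℂ ![0, 0, 1] (ne_zero_of_coord (by simp)))
    (h3 : X (col 1) = Projectivization.mk ℂ ![1, 0, -1] (ne_zero_of_coord (by simp)))
    (h4 : X (row 1) = Projectivization.mk ℂ ![0, 1, -1] (ne_zero_of_coord (by simp))) :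
    ∃ q : Param, q.Good ∧ X = q.lines := by
  have hc : ∃ s, X (col 2) = Projectivization.mk ℂ ![1, 0, -s] (ne_zero_of_coord (by simp)) := by
    have e1 := hX.cols 0 2
    have e2 := hX.inj.ne (a₁ := col 2) (a₂ := inf) (by simp)
    rw [h0, h2] at e1
    rw [h2] at e2
    generalize X (col 2) = l at e1 e2 ⊢
    induction l with | h w hw =>
    rw [conc_mk_iff] at e1
    simp [det₃] at e1
    have hw0 : w 0 ≠ 0 := by
      intro h
      refine e2 (mk_eq_of_smul (w 2) fun i => ?_)
      fin_cases i <;> simp [h, e1]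
    refine ⟨-(w 2 / w 0), mk_eq_of_smul (w 0) fun i => ?_⟩
    fin_cases i <;> simp [e1]
    field_simp
  have hr : ∃ t, X (row 2) = Projectivization.mk ℂ ![0, 1, -t] (ne_zero_of_coord (by simp)) := by
    have e1 := hX.rows 0 2
    have e2 := hX.inj.ne (a₁ := row 2) (a₂ := inf) (by simp)
    rw [h1, h2] at e1
    rw [h2] at e2
    generalize X (row 2) = l at e1 e2 ⊢
    induction l with | h w hw =>
    rw [conc_mk_iff] at e1
    simp [det₃] at e1
    have hw0 : w 1 ≠ 0 := by
      intro h
      refine e2 (mk_eq_of_smul (w 2) fun i => ?_)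
      fin_cases i <;> simp [h, e1]
    refine ⟨-(w 2 / w 1), mk_eq_of_smul (w 1) fun i => ?_⟩
    fin_cases i <;> simp [e1]
    field_simp
  have ho : ∀ k, ∃ κ γ, κ ≠ 0 ∧ X (obl k) = Projectivization.mk ℂ ![-κ, 1, -γ] (ne_zero_of_coord (by simp)) := by
    intro k
    have e1 := hX.col_obl k
    have e2 := hX.row_obl k
    rw [h0, h2] at e1
    rw [h1, h2] at e2
    generalize X (obl k) = l at e1 e2 ⊢
    induction l with | h w hw =>
    rw [conc_mk_iff] at e1 e2
    simp [det₃] at e1 e2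
    refine ⟨-(w 0 / w 1), -(w 2 / w 1), by simp [e1, e2], mk_eq_of_smul (w 1) fun i => ?_⟩
    fin_cases i <;> simp <;> field_simp
  obtain ⟨s, hs⟩ := hc
  obtain ⟨t, ht⟩ := hr
  obtain ⟨κ, γ₀, hκ, hk0⟩ := ho 0
  obtain ⟨κ', γ₁, -, hk1⟩ := ho 1
  obtain ⟨μ, ν, hμ, hk2⟩ := ho 2
  have hκκ : κ' = κ := by
    have := hX.par
    rw [h2, hk0, hk1, conc_mk_iff] at this
    simp [det₃] at this
    linear_combination this
  subst hκκ
  refine ⟨⟨s, t, κ', γ₀, γ₁, μ, ν⟩, ⟨?_, ?_, ?_, ?_, hκ, hμ, ?_, ?_⟩, ?_⟩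
  · rintro rfl
    exact absurd (hX.inj (a₁ := col 2) (a₂ := col 0) (by rw [hs, h0]; exact mk_ext (by simp)))
      (by simp)
  · rintro rfl
    exact absurd (hX.inj (a₁ := col 2) (a₂ := col 1) (by rw [hs, h3])) (by simp)
  · rintro rfl
    exact absurd (hX.inj (a₁ := row 2) (a₂ := row 0) (by rw [ht, h1]; exact mk_ext (by simp)))
      (by simp)
  · rintro rfl
    exact absurd (hX.inj (a₁ := row 2) (a₂ := row 1) (by rw [ht, h4])) (by simp)
  · rintro h
    have h : γ₀ = γ₁ := h
    subst h
    exact absurd (hX.inj (a₁ := obl 0) (a₂ := obl 1) (by rw [hk0, hk1])) (by simp)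
  · intro h
    have h : κ' = μ := h
    apply hX.obl_obl
    rw [h2, hk0, hk2, conc_mk_iff]
    simp [det₃, h]
  · funext l
    rcases l with i | j | _ | k
    · fin_cases i
      · exact h0.trans (mk_ext (by simp [Param.coef, Param.a]))
      · exact h3.trans (mk_ext (by simp [Param.coef, Param.a]))
      · exact hs.trans (mk_ext (by simp [Param.coef, Param.a]))
    · fin_cases j
      · exact h1.trans (mk_ext (by simp [Param.coef, Param.b]))
      · exact h4.trans (mk_ext (by simp [Param.coef, Param.b]))
      · exact ht.trans (mk_ext (by simp [Param.coef, Param.b]))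
    · exact h2
    · fin_cases k
      · exact hk0
      · exact hk1
      · exact hk2

/-- Non-concurrent lines have linearly independent coefficient vectors, and g is the coordinate map
of the basis they form. -/
theorem exists_smul_eq_basis {l m n : ℙ ℂ V} (h : ¬ Conc l m n) : ∃ g : V ≃ₗ[ℂ] V,
    g • l = Projectivization.mk ℂ ![1, 0, 0] (ne_zero_of_coord (by simp)) ∧
    g • m = Projectivization.mk ℂ ![0, 1, 0] (ne_zero_of_coord (by simp)) ∧
    g • n = Projectivization.mk ℂ ![0, 0, 1] (ne_zero_of_coord (by simp)) := by
  induction l with | h u hu =>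
  induction m with | h v hv =>
  induction n with | h w hw =>
  rw [conc_mk_iff] at h
  have hdet : det₃ u v w = (Matrix.of ![u, v, w]).det := by
    simp [det₃, Matrix.det_fin_three]
    ring
  have hli : LinearIndependent ℂ ![u, v, w] :=
    Matrix.linearIndependent_rows_of_det_ne_zero (A := Matrix.of ![u, v, w]) (hdet ▸ h)
  let b := basisOfLinearIndependentOfCardEqFinrank hli (by simp)
  have hb : ∀ i, b.equivFun (![u, v, w] i) = Pi.single i 1 := by
    intro i
    rw [← congrFun (coe_basisOfLinearIndependentOfCardEqFinrank hli (by simp)) i]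
    ext j
    rw [b.equivFun_self i j, Pi.single_apply]
    simp [eq_comm]
  refine ⟨b.equivFun, ?_, ?_, ?_⟩ <;> rw [smul_mk] <;> apply mk_ext
  · refine (hb 0).trans ?_
    ext i; fin_cases i <;> simp
  · refine (hb 1).trans ?_
    ext i; fin_cases i <;> simp
  · refine (hb 2).trans ?_
    ext i; fin_cases i <;> simp

/-- Every arrangement with the basic incidences has a normal form. -/
theorem Base.exists_param {X : Label → ℙ ℂ V} (hX : Base X) :
    ∃ (g : V ≃ₗ[ℂ] V) (q : Param), q.Good ∧ ∀ l, g • X l = q.lines l := by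
  obtain ⟨g, g0, g1, g2⟩ := exists_smul_eq_basis hX.col_row
  have hY := hX.smul g
  set Y := fun l => g • X l with hYdef
  change Y (col 0) = _ at g0
  change Y (row 0) = _ at g1
  change Y inf = _ at g2
  have hc : ∃ p, p ≠ 0 ∧ Y (col 1) = Projectivization.mk ℂ ![p, 0, -1] (fun h => by simpa using congrFun h 2) := by
    have e1 := hY.cols 0 1
    have e2 := hY.inj.ne (a₁ := col 1) (a₂ := inf) (by simp)
    have e3 := hY.inj.ne (a₁ := col 1) (a₂ := col 0) (by simp)
    rw [g0, g2] at e1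
    rw [g2] at e2
    rw [g0] at e3
    generalize Y (col 1) = l at e1 e2 e3 ⊢
    induction l with | h w hw =>
    rw [conc_mk_iff] at e1
    simp [det₃] at e1
    have hw0 : w 0 ≠ 0 := by
      intro h
      refine e2 (mk_eq_of_smul (w 2) fun i => ?_)
      fin_cases i <;> simp [h, e1]
    have hw2 : w 2 ≠ 0 := by
      intro h
      refine e3 (mk_eq_of_smul (w 0) fun i => ?_)
      fin_cases i <;> simp [h, e1]
    refine ⟨-(w 0 / w 2), by simp [hw0, hw2], mk_eq_of_smul (-w 2) fun i => ?_⟩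
    fin_cases i <;> simp [e1]
    field_simp
  have hr : ∃ p, p ≠ 0 ∧ Y (row 1) = Projectivization.mk ℂ ![0, p, -1] (fun h => by simpa using congrFun h 2) := by
    have e1 := hY.rows 0 1
    have e2 := hY.inj.ne (a₁ := row 1) (a₂ := inf) (by simp)
    have e3 := hY.inj.ne (a₁ := row 1) (a₂ := row 0) (by simp)
    rw [g1, g2] at e1
    rw [g2] at e2
    rw [g1] at e3
    generalize Y (row 1) = l at e1 e2 e3 ⊢
    induction l with | h w hw =>
    rw [conc_mk_iff] at e1
    simp [det₃] at e1
    have hw0 : w 1 ≠ 0 := by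
      intro h
      refine e2 (mk_eq_of_smul (w 2) fun i => ?_)
      fin_cases i <;> simp [h, e1]
    have hw2 : w 2 ≠ 0 := by
      intro h
      refine e3 (mk_eq_of_smul (w 1) fun i => ?_)
      fin_cases i <;> simp [h, e1]
    refine ⟨-(w 1 / w 2), by simp [hw0, hw2], mk_eq_of_smul (-w 2) fun i => ?_⟩
    fin_cases i <;> simp [e1]
    field_simp
  obtain ⟨p, hp, hp1⟩ := hc
  obtain ⟨r, hr, hr1⟩ := hr
  -- A diagonal map preserves the three coordinate lines; these two scalings move `col 1` and `row
  -- 1` to position 1.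
  have hd : ∀ i, (![p⁻¹, r⁻¹, 1] : V) i ≠ 0 := by
    intro i
    fin_cases i <;> simp [hp, hr]
  let d : V ≃ₗ[ℂ] V := LinearEquiv.piCongrRight fun i => LinearEquiv.smulOfNeZero ℂ ℂ _ (hd i)
  have hdv : ∀ v : V, d • v = ![p⁻¹ * v 0, r⁻¹ * v 1, v 2] := by
    intro v
    ext i
    change d v i = _
    fin_cases i <;> simp [d]
  obtain ⟨q, hq, hq'⟩ := exists_param_of_frame (hY.smul d)
    (by
      simp only [g0, smul_mk, hdv]
      exact mk_eq_of_smul p⁻¹ (fun i => by fin_cases i <;> simp))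
    (by
      simp only [g1, smul_mk, hdv]
      exact mk_eq_of_smul r⁻¹ (fun i => by fin_cases i <;> simp))
    (by
      simp only [g2, smul_mk, hdv]
      exact mk_ext (by simp))
    (by
      simp only [hp1, smul_mk, hdv]
      exact mk_ext (by simp [hp]))
    (by
      simp only [hr1, smul_mk, hdv]
      exact mk_ext (by simp [hr]))
  exact ⟨d * g, q, hq, fun l => by rw [mul_smul, ← hq']⟩

end LineArrangement

namespace LineArrangement

open Projectivization Label

/-! ### The combinatorial code of an arrangement -/

/-- A code is a list of eleven numbers. The entry at `3 k + i` is the `j` such that `obl k` passes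
through the intersection of `col i` and `row j`, or `3` if there is none. The entry at `9 + b` is
`i` if `obl b` and `obl 2` meet on `col i`, it is `3 + j` if they meet on `row j`,
and `6` otherwise. -/
abbrev Code := List ℕ

/-- The row which `obl k` meets on column `i`. -/
def Code.v (c : Code) (k i : Fin 3) : ℕ := c.getD (3 * k + i) 3

/-- The line on which `obl b` meets `obl 2`. -/
def Code.o (c : Code) (b : Fin 2) : ℕ := c.getD (9 + b) 6

/-- The variable incidences of the arrangement `X` are described by the code `c`. -/
structure HasCode (X : Label → ℙ ℂ V) (c : Code) : Prop where
  cell : ∀ k i j, Conc (X (col i)) (X (row j)) (X (obl k)) ↔ c.v k i = j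
  ocol : ∀ b i, Conc (X (col i)) (X (obl b.castSucc)) (X (obl 2)) ↔ c.o b = i
  orow : ∀ b j, Conc (X (row j)) (X (obl b.castSucc)) (X (obl 2)) ↔ c.o b = 3 + j

theorem HasCode.congr {X Y : Label → ℙ ℂ V} {c : Code} (hX : HasCode X c)
    (h : ∀ x y z, Conc (X x) (X y) (X z) ↔ Conc (Y x) (Y y) (Y z)) : HasCode Y c := by
  obtain ⟨h1, h2, h3⟩ := hX
  simp only [h] at h1 h2 h3
  exact ⟨h1, h2, h3⟩

namespace Param

variable (q : Param)

theorem conc_cell_iff (i j k : Fin 3) :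
    Conc (q.lines (col i)) (q.lines (row j)) (q.lines (obl k)) ↔
      q.b j = q.slope k * q.a i + q.icept k := by
  rw [conc_iff]
  simp only [det₃, coef]
  simp
  grind

theorem conc_col_iff (i k l : Fin 3) :
    Conc (q.lines (col i)) (q.lines (obl k)) (q.lines (obl l)) ↔
      q.slope k * q.a i + q.icept k = q.slope l * q.a i + q.icept l := by
  rw [conc_iff]
  simp only [det₃, coef]
  simp
  grind

theorem conc_row_iff (j k l : Fin 3) :
    Conc (q.lines (row j)) (q.lines (obl k)) (q.lines (obl l)) ↔
      q.slope l * (q.b j - q.icept k) = q.slope k * (q.b j - q.icept l) := by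
  rw [conc_iff]
  simp only [det₃, coef]
  simp
  grind

/-- The variable incidences of an arrangement in normal form, as equations. -/
structure HasCode (c : Code) : Prop where
  cell : ∀ k i j : Fin 3, q.b j = q.slope k * q.a i + q.icept k ↔ c.v k i = j
  ocol : ∀ (b : Fin 2) (i : Fin 3), q.slope b.castSucc * q.a i + q.icept b.castSucc =
    q.μ * q.a i + q.ν ↔ c.o b = i
  orow : ∀ (b : Fin 2) (j : Fin 3), q.μ * (q.b j - q.icept b.castSucc) =
    q.slope b.castSucc * (q.b j - q.ν) ↔ c.o b = 3 + j

variable {q}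

theorem hasCode_iff {c : Code} : LineArrangement.HasCode q.lines c ↔ q.HasCode c := by
  constructor
  · rintro ⟨h1, h2, h3⟩
    simp only [conc_cell_iff, conc_col_iff, conc_row_iff] at h1 h2 h3
    exact ⟨h1, h2, h3⟩
  · rintro ⟨h1, h2, h3⟩
    constructor <;> simp only [conc_cell_iff, conc_col_iff, conc_row_iff]
    exacts [h1, h2, h3]

theorem Good.a_inj (h : q.Good) {i i' : Fin 3} : q.a i = q.a i' ↔ i = i' := by
  have := h.s0
  have := h.s1
  refine ⟨fun e => ?_, fun e => by rw [e]⟩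
  fin_cases i <;> fin_cases i' <;> simp [a] at e ⊢ <;> grind

theorem Good.b_inj (h : q.Good) {i i' : Fin 3} : q.b i = q.b i' ↔ i = i' := by
  have := h.t0
  have := h.t1
  refine ⟨fun e => ?_, fun e => by rw [e]⟩
  fin_cases i <;> fin_cases i' <;> simp [b] at e ⊢ <;> grind

theorem Good.slope_ne_zero (h : q.Good) (k : Fin 3) : q.slope k ≠ 0 := by
  fin_cases k
  · exact h.κ0
  · exact h.κ0
  · exact h.μ0

/-- The line on which `obl k` and `obl l` meet is determined by the code. -/
theorem Good.conc_obl_obl_iff (h : q.Good) {c : Code} (hc : LineArrangement.HasCode q.lines c)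
    (k l : Fin 3) :
    (∀ i, Conc (q.lines (col i)) (q.lines (obl k)) (q.lines (obl l)) ↔
      k = l ∨ (k ≠ 2 ∧ l = 2 ∧ c.getD (9 + k) 6 = i) ∨ (l ≠ 2 ∧ k = 2 ∧ c.getD (9 + l) 6 = i)) ∧
    (∀ j, Conc (q.lines (row j)) (q.lines (obl k)) (q.lines (obl l)) ↔
      k = l ∨ (k ≠ 2 ∧ l = 2 ∧ c.getD (9 + k) 6 = 3 + j) ∨
        (l ≠ 2 ∧ k = 2 ∧ c.getD (9 + l) 6 = 3 + j)) := by
  have hγ := h.γ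
  have hκ := h.κ0
  by_cases hkl : k = l
  · subst hkl
    refine ⟨fun i => ?_, fun j => ?_⟩
    · simp [conc_col_iff]
    · simp [conc_row_iff]
  have e1 := fun i => hc.ocol 0 i
  have e2 := fun i => hc.ocol 1 i
  have e3 := fun i => hc.orow 0 i
  have e4 := fun i => hc.orow 1 i
  have sw : ∀ i, Conc (q.lines i) (q.lines (obl k)) (q.lines (obl l)) ↔
      Conc (q.lines i) (q.lines (obl l)) (q.lines (obl k)) := fun i =>
    ⟨fun h => h.rotate.swap.rotate.rotate, fun h => h.rotate.swap.rotate.rotate⟩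
  fin_cases k <;> fin_cases l <;> first | exact absurd rfl hkl | skip
  · simp [conc_col_iff, conc_row_iff, slope, icept, hγ, hκ]
  · exact ⟨fun i => by simpa [Code.o] using e1 i, fun i => by simpa [Code.o] using e3 i⟩
  · simp [conc_col_iff, conc_row_iff, slope, icept, hκ, Ne.symm hγ]
  · exact ⟨fun i => by simpa [Code.o] using e2 i, fun i => by simpa [Code.o] using e4 i⟩
  · exact ⟨fun i => by rw [sw]; simpa [Code.o] using e1 i,
      fun i => by rw [sw]; simpa [Code.o] using e3 i⟩
  · exact ⟨fun i => by rw [sw]; simpa [Code.o] using e2 i,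
      fun i => by rw [sw]; simpa [Code.o] using e4 i⟩

end Param

/-- A number for the four kinds of lines. -/
def Label.kind : Label → ℕ
  | col _ => 0
  | row _ => 1
  | inf => 2
  | obl _ => 3

/-- To prove a symmetric statement about triples of labels one may order them by kind. -/
theorem Label.triple_induction {P : Label → Label → Label → Prop}
    (swap : ∀ {x y z}, P x y z → P y x z) (rotate : ∀ {x y z}, P x y z → P y z x)
    (sorted : ∀ x y z, x.kind ≤ y.kind → y.kind ≤ z.kind → P x y z) (x y z : Label) :
    P x y z := by
  have main : ∀ x y z : Label, x.kind ≤ y.kind → P x y z := by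
    intro x y z h
    obtain h1 | h1 := le_total y.kind z.kind
    · exact sorted x y z h h1
    obtain h2 | h2 := le_total x.kind z.kind
    · exact rotate (swap (sorted x z y h2 h1))
    · exact rotate (sorted z x y h2 h)
  obtain h | h := le_total x.kind y.kind
  · exact main x y z h
  · exact swap (main y x z h)

/-- Nondegenerate arrangements in normal form with the same code have the same concurrent
triples. -/
theorem Param.conc_congr {q q' : Param} (hq : q.Good) (hq' : q'.Good) {c : Code}
    (hc : LineArrangement.HasCode q.lines c) (hc' : LineArrangement.HasCode q'.lines c)
    (x y z : Label) : Conc (q.lines x) (q.lines y) (q.lines z) ↔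
      Conc (q'.lines x) (q'.lines y) (q'.lines z) := by
  -- These triples are decided by nondegeneracy alone. Three distinct lines `obl` are never
  -- concurrent, since the first two are parallel and the third has another slope.
  have key : ∀ (q : Param), q.Good →
      (∀ i j k, (Conc (q.lines (col i)) (q.lines (col j)) (q.lines (row k)) ↔ i = j) ∧
        (Conc (q.lines (col i)) (q.lines (col j)) (q.lines (obl k)) ↔ i = j) ∧
        (Conc (q.lines (col k)) (q.lines (row i)) (q.lines (row j)) ↔ i = j) ∧
        (Conc (q.lines (row i)) (q.lines (row j)) (q.lines (obl k)) ↔ i = j)) ∧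
      (∀ i j, (Conc (q.lines inf) (q.lines (obl i)) (q.lines (obl j)) ↔ (i = 2 ↔ j = 2)) ∧
        ¬ Conc (q.lines (row i)) (q.lines inf) (q.lines (obl j))) ∧
      (∀ i j k, Conc (q.lines (obl i)) (q.lines (obl j)) (q.lines (obl k)) ↔
        i = j ∨ j = k ∨ k = i) := by
    intro q hq
    have hs := hq.slope_ne_zero
    refine ⟨fun i j k => ⟨?_, ?_, ?_, ?_⟩, fun i j => ⟨?_, ?_⟩, fun i j k => ?_⟩
    · rw [← hq.a_inj, conc_iff]
      simp [det₃, coef]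
      grind
    · rw [← hq.a_inj, conc_iff]
      simp [det₃, coef]
      grind
    · rw [← hq.b_inj, conc_iff]
      simp [det₃, coef]
      grind
    · rw [← hq.b_inj, conc_iff]
      have := hs k
      simp [det₃, coef]
      grind
    · have := hq.κμ
      rw [conc_iff]
      fin_cases i <;> fin_cases j <;> simp [det₃, coef, slope] <;> grind
    · have := hs j
      rw [conc_iff]
      simp [det₃, coef]
      grind
    · have := hq.κμ
      have := hq.γ
      rw [conc_iff]
      simp only [det₃, coef]
      fin_cases i <;> fin_cases j <;> fin_cases k <;> simp [slope, icept] <;> grind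
  obtain ⟨h1, h2, h3⟩ := key q hq
  obtain ⟨h1', h2', h3'⟩ := key q' hq'
  have ho := hq.conc_obl_obl_iff hc
  have ho' := hq'.conc_obl_obl_iff hc'
  refine Label.triple_induction (P := fun x y z => Conc (q.lines x) (q.lines y) (q.lines z) ↔
    Conc (q'.lines x) (q'.lines y) (q'.lines z)) ?_ ?_ ?_ x y z
  · intro x y z h
    rwa [conc_swap, conc_swap (l := q'.lines y)]
  · intro x y z h
    rwa [← conc_rotate, ← conc_rotate (l := q'.lines x)]
  -- Ordering by kind leaves twenty of the 64 cases; only the types col-row-obl, col-obl-obl and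
  -- row-obl-obl consult the code.
  rintro (i | i | _ | i) (j | j | _ | j) (k | k | _ | k) h h' <;>
    first | (simp [kind] at h; done) | (simp [kind] at h'; done) | clear h h'
  · simp [conc_iff, det₃, coef]
  · rw [(h1 i j k).1, (h1' i j k).1]
  · simp [conc_iff, det₃, coef]
  · rw [(h1 i j k).2.1, (h1' i j k).2.1]
  · rw [(h1 j k i).2.2.1, (h1' j k i).2.2.1]
  · simp [conc_iff, det₃, coef]
  · rw [hc.cell, hc'.cell]
  · simp [conc_iff, det₃, coef]
  · simp [conc_iff, det₃, coef]
  · rw [(ho j k).1, (ho' j k).1]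
  · simp [conc_iff, det₃, coef]
  · simp [conc_iff, det₃, coef]
  · rw [(h1 i j k).2.2.2, (h1' i j k).2.2.2]
  · simp [conc_iff, det₃, coef]
  · simp only [(h2 i k).2, (h2' i k).2]
  · rw [(ho j k).2, (ho' j k).2]
  · simp [conc_iff, det₃, coef]
  · simp [conc_iff, det₃, coef]
  · rw [(h2 j k).1, (h2' j k).1]
  · rw [h3, h3']

theorem Param.lines_injective {q : Param} (hq : q.Good) : Function.Injective q.lines := by
  have hγ := hq.γ
  have hκμ := hq.κμ
  have hs := hq.slope_ne_zero
  intro x y h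
  rw [lines, lines, mk_eq_mk_iff'] at h
  obtain ⟨c, hc⟩ := h
  have e0 := congrFun hc 0
  have e1 := congrFun hc 1
  have e2 := congrFun hc 2
  rcases x with i | i | _ | i <;> rcases y with j | j | _ | j <;> simp [coef] at e0 e1 e2 ⊢
  · rw [e0] at e2
    rw [← hq.a_inj]
    linear_combination -e2
  · simp [e1] at e0
  · rw [e1] at e2
    rw [← hq.b_inj]
    linear_combination -e2
  · have := hs j
    grind
  · have := hs j
    grind
  · simp [e1] at e2
  · simp [e1] at e2
  · exact hs i e0
  · fin_cases i <;> fin_cases j <;> simp [slope, icept] at e0 e1 e2 ⊢ <;> grind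

theorem Param.base {q : Param} (hq : q.Good) : Base q.lines := by
  have hs := hq.slope_ne_zero
  have := hq.κμ
  refine ⟨Param.lines_injective hq, ?_, ?_, ?_, ?_, ?_, ?_, ?_⟩ <;>
    simp [conc_iff, det₃, coef, hs] <;> simp [slope]
  grind

end LineArrangement

namespace LineArrangement

open Projectivization Label

/-! ### Solving the equations given by a code -/

/-- The parameters of the first family. -/
noncomputable def param₁ (t : ℂ) : Param := ⟨t, 1 - t, 1, 1 - t, -t, 2 - t, 0⟩
/-- The parameters of the second family. -/
noncomputable def param₂ (t : ℂ × ℂ) : Param := ⟨t.1, t.2, t.2 - 1, 1, 1 - t.1, 1, 0⟩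
/-- The parameters of the third family. -/
noncomputable def param₃ (t : ℂ) : Param := ⟨t ^ 2, t, -(1 / t), t, 1 / t, 1, 0⟩
/-- The parameters of the fourth family. -/
noncomputable def param₄ (s : ℂ) : Param := ⟨1 + s / 2, 2 + s, s, -s, 1, 1, 0⟩
/-- The parameters of a one-parameter family of arrangements. -/
noncomputable def paramCurve (s : ℂ) : Param := ⟨s, 1 - s, 1, 0, 1 - s, -1, 1⟩

/-- The codes of the four families and of the one-parameter family. -/
def code₁ : Code := [2, 3, 1, 3, 2, 0, 0, 3, 3, 1, 4]
def code₂ : Code := [1, 2, 3, 3, 3, 0, 0, 1, 3, 2, 5]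
def code₃ : Code := [2, 3, 0, 3, 0, 1, 0, 1, 3, 6, 5]
def code₄ : Code := [3, 0, 1, 1, 3, 2, 0, 1, 3, 5, 6]
def codeCurve : Code := [0, 1, 3, 2, 3, 1, 1, 0, 2, 6, 6]

/-- The code of an arrangement which is unique up to projective equivalence. -/
def codePoint : Code := [0, 1, 2, 1, 3, 3, 3, 2, 1, 6, 3]
/-- The codes of two arrangements each of which is unique up to projective equivalence and complex
conjugation. -/
def codePair₁ : Code := [0, 1, 2, 1, 3, 3, 3, 0, 1, 6, 5]
def codePair₂ : Code := [0, 1, 3, 1, 3, 2, 3, 3, 0, 5, 1]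
/-- The codes which do not belong to an arrangement. -/
def codeEmpty₁ : Code := [0, 1, 3, 3, 2, 0, 3, 0, 1, 5, 0]
def codeEmpty₂ : Code := [0, 1, 3, 3, 2, 0, 2, 0, 1, 6, 6]
def codeEmpty₃ : Code := [0, 1, 3, 3, 0, 2, 1, 2, 0, 6, 6]
def codeEmpty₄ : Code := [0, 1, 2, 3, 0, 1, 3, 2, 0, 6, 0]
def codeEmpty₅ : Code := [0, 1, 2, 3, 0, 1, 1, 2, 0, 6, 6]
def codeEmpty₆ : Code := [0, 1, 2, 1, 2, 0, 2, 0, 1, 6, 6]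

/-- The parameters of the arrangements with the preceding codes. -/
def paramPoint : Param := ⟨-2, -2, 1, 0, 1, -1, -1⟩
noncomputable def paramPair₁ (s : ℂ) : Param := ⟨s + 1, s + 1, 1, 0, 1, -s, s⟩
noncomputable def paramPair₂ (s : ℂ) : Param := ⟨s, s + 1, 1, 0, 1, s + 1, 1 - s⟩

/-- Replacing the radicals by their quadratic equation makes later verifications polynomial
identities modulo that equation. -/
theorem mem_par₁_iff {t : ℂ} : t ∈ par₁ ↔ t ^ 2 = t + 1 := by
  have h5 : ((√5 : ℝ) : ℂ) ^ 2 = 5 := by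
    rw [← Complex.ofReal_pow, Real.sq_sqrt (by norm_num)]
    norm_num
  have : t ^ 2 = t + 1 ↔ (t - (1 + (√5 : ℝ)) / 2) * (t - (1 - (√5 : ℝ)) / 2) = 0 := by
    constructor <;> intro h
    · linear_combination h - h5 / 4
    · linear_combination h + h5 / 4
  rw [this, mul_eq_zero, sub_eq_zero, sub_eq_zero]
  rfl

theorem mem_par₃_iff {t : ℂ} : t ∈ par₃ ↔ t ^ 2 + t = 1 := by
  have h5 : ((√5 : ℝ) : ℂ) ^ 2 = 5 := by
    rw [← Complex.ofReal_pow, Real.sq_sqrt (by norm_num)]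
    norm_num
  have : t ^ 2 + t = 1 ↔ (t - (-1 + (√5 : ℝ)) / 2) * (t - (-1 - (√5 : ℝ)) / 2) = 0 := by
    constructor <;> intro h
    · linear_combination h - h5 / 4
    · linear_combination h + h5 / 4
  rw [this, mul_eq_zero, sub_eq_zero, sub_eq_zero]
  rfl

theorem mem_par₄_iff {t : ℂ} : t ∈ par₄ ↔ t ^ 2 = 2 := by
  have h5 : ((√2 : ℝ) : ℂ) ^ 2 = 2 := by
    rw [← Complex.ofReal_pow, Real.sq_sqrt (by norm_num)]
    norm_num
  have : t ^ 2 = 2 ↔ (t - (√2 : ℝ)) * (t - -(√2 : ℝ)) = 0 := by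
    constructor <;> intro h
    · linear_combination h - h5
    · linear_combination h + h5
  rw [this, mul_eq_zero, sub_eq_zero, sub_eq_zero]
  rfl

theorem mem_par₂_iff {t : ℂ × ℂ} :
    t ∈ par₂ ↔ t.1 = (t.2 - 1) ^ 2 ∧ (t.2 - 1) ^ 3 - (t.2 - 1) ^ 2 + 1 = 0 := Iff.rfl

namespace Param

variable {q : Param}

/-- The code lists seven incidences, that is, seven equations for seven parameters. All but one
serve to express the parameters through one of them, and the last becomes its defining quadratic.
The other three families work alike, the second ending with a cubic. -/
theorem HasCode.eq_param₁ (hq : q.Good) (h : q.HasCode code₁) :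
    ∃ t ∈ par₁, q = param₁ t := by
  have e1 := (h.cell 0 0 2).2 rfl
  have e2 := (h.cell 0 2 1).2 rfl
  have e3 := (h.cell 1 1 2).2 rfl
  have e4 := (h.cell 1 2 0).2 rfl
  have e5 := (h.cell 2 0 0).2 rfl
  have e6 := (h.ocol 0 1).2 rfl
  have e7 := (h.orow 1 1).2 rfl
  obtain ⟨s, t, κ, γ₀, γ₁, μ, ν⟩ := q
  simp [a, b, slope, icept] at e1 e2 e3 e4 e5 e6 e7
  -- `e2` and `e4` give γ₀ - γ₁ = 1, while `e1` and `e3` give κ = γ₀ - γ₁.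
  obtain rfl : κ = 1 := by grind
  refine ⟨s, ?_, ?_⟩
  · rw [mem_par₁_iff]
    grind
  · simp only [param₁, mk.injEq]
    refine ⟨trivial, ?_, trivial, ?_, ?_, ?_, ?_⟩ <;> grind

theorem HasCode.eq_param₂ (hq : q.Good) (h : q.HasCode code₂) :
    ∃ t ∈ par₂, q = param₂ t := by
  have e1 := (h.cell 0 0 1).2 rfl
  have e2 := (h.cell 0 1 2).2 rfl
  have e3 := (h.cell 1 2 0).2 rfl
  have e4 := (h.cell 2 0 0).2 rfl
  have e5 := (h.cell 2 1 1).2 rfl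
  have e6 := (h.ocol 0 2).2 rfl
  have e7 := (h.orow 1 2).2 rfl
  obtain ⟨s, t, κ, γ₀, γ₁, μ, ν⟩ := q
  have := hq.s0
  have := hq.t0
  have := hq.κ0
  simp [a, b, slope, icept] at e1 e2 e3 e4 e5 e6 e7
  refine ⟨(s, t), ?_, ?_⟩
  · rw [mem_par₂_iff]
    grind
  · simp only [param₂, mk.injEq]
    refine ⟨trivial, trivial, ?_, ?_, ?_, ?_, ?_⟩ <;> grind

theorem HasCode.eq_param₃ (hq : q.Good) (h : q.HasCode code₃) :
    ∃ t ∈ par₃, q = param₃ t := by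
  have e1 := (h.cell 0 0 2).2 rfl
  have e2 := (h.cell 0 2 0).2 rfl
  have e3 := (h.cell 1 1 0).2 rfl
  have e4 := (h.cell 1 2 1).2 rfl
  have e5 := (h.cell 2 0 0).2 rfl
  have e6 := (h.cell 2 1 1).2 rfl
  have e7 := (h.orow 1 2).2 rfl
  obtain ⟨s, t, κ, γ₀, γ₁, μ, ν⟩ := q
  have := hq.s0
  have := hq.t0
  have := hq.t1
  have := hq.κ0
  simp [a, b, slope, icept] at e1 e2 e3 e4 e5 e6 e7
  refine ⟨t, ?_, ?_⟩
  · rw [mem_par₃_iff]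
    grind
  · simp only [param₃, mk.injEq]
    refine ⟨?_, trivial, ?_, ?_, ?_, ?_, ?_⟩ <;> grind

theorem HasCode.eq_param₄ (hq : q.Good) (h : q.HasCode code₄) :
    ∃ t ∈ par₄, q = param₄ t := by
  have e1 := (h.cell 0 1 0).2 rfl
  have e2 := (h.cell 0 2 1).2 rfl
  have e3 := (h.cell 1 0 1).2 rfl
  have e4 := (h.cell 1 2 2).2 rfl
  have e5 := (h.cell 2 0 0).2 rfl
  have e6 := (h.cell 2 1 1).2 rfl
  have e7 := (h.orow 0 2).2 rfl
  obtain ⟨s, t, κ, γ₀, γ₁, μ, ν⟩ := q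
  have := hq.s0
  have := hq.t0
  have := hq.t1
  have := hq.κ0
  simp [a, b, slope, icept] at e1 e2 e3 e4 e5 e6 e7
  refine ⟨κ, ?_, ?_⟩
  · rw [mem_par₄_iff]
    grind
  · simp only [param₄, mk.injEq]
    refine ⟨?_, ?_, trivial, ?_, ?_, ?_, ?_⟩ <;> grind

/-- Of the seven incidences of this code, the one of `obl 2` with `col 2` and `row 2` follows from
the other six, so a parameter stays free. The non-incidences `e7` and `e8` exclude 2s = 1 and s = 2,
where an extra triple point would appear. -/
theorem HasCode.eq_paramCurve (hq : q.Good) (h : q.HasCode codeCurve) :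
    ∃ s, (s ≠ 0 ∧ s ≠ 1 ∧ s ≠ 2 ∧ 2 * s ≠ 1) ∧ q = paramCurve s := by
  have e1 := (h.cell 0 0 0).2 rfl
  have e2 := (h.cell 0 1 1).2 rfl
  have e3 := (h.cell 1 0 2).2 rfl
  have e4 := (h.cell 1 2 1).2 rfl
  have e5 := (h.cell 2 0 1).2 rfl
  have e6 := (h.cell 2 1 0).2 rfl
  have e7 := (h.cell 0 2 2).not.2 (by simp [Code.v, codeCurve])
  have e8 := (h.cell 1 1 0).not.2 (by simp [Code.v, codeCurve])
  obtain ⟨s, t, κ, γ₀, γ₁, μ, ν⟩ := q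
  have h0 := hq.s0
  have h1 := hq.s1
  simp [a, b, slope, icept] at e1 e2 e3 e4 e5 e6 e7 e8 h0 h1
  refine ⟨s, ⟨h0, h1, ?_, ?_⟩, ?_⟩
  · grind
  · grind
  · simp only [paramCurve, mk.injEq]
    refine ⟨trivial, ?_, ?_, ?_, ?_, ?_, ?_⟩ <;> grind

/-- Elimination leaves (s - 1)(s + 2) = 0, and s = 1 is degenerate. -/
theorem HasCode.eq_paramPoint (hq : q.Good) (h : q.HasCode codePoint) : q = paramPoint := by
  have e1 := (h.cell 0 0 0).2 rfl
  have e2 := (h.cell 0 1 1).2 rfl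
  have e3 := (h.cell 0 2 2).2 rfl
  have e4 := (h.cell 1 0 1).2 rfl
  have e5 := (h.cell 2 1 2).2 rfl
  have e6 := (h.cell 2 2 1).2 rfl
  have e7 := (h.orow 1 0).2 rfl
  obtain ⟨s, t, κ, γ₀, γ₁, μ, ν⟩ := q
  have h_s0 := hq.s0
  have h_s1 := hq.s1
  have h_t0 := hq.t0
  have h_t1 := hq.t1
  have h_κ0 := hq.κ0
  have h_μ0 := hq.μ0
  have h_γ := hq.γ
  have h_κμ := hq.κμ
  simp [a, b, slope, icept] at e1 e2 e3 e4 e5 e6 e7 h_s0 h_s1 h_t0 h_t1 h_κ0 h_μ0 h_γ h_κμ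
  simp only [paramPoint, mk.injEq]
  refine ⟨?_, ?_, ?_, ?_, ?_, ?_, ?_⟩ <;> grind

theorem HasCode.eq_paramPair₁ (hq : q.Good) (h : q.HasCode codePair₁) :
    ∃ s, s ^ 2 = -1 ∧ q = paramPair₁ s := by
  have e1 := (h.cell 0 0 0).2 rfl
  have e2 := (h.cell 0 1 1).2 rfl
  have e3 := (h.cell 0 2 2).2 rfl
  have e4 := (h.cell 1 0 1).2 rfl
  have e5 := (h.cell 2 1 0).2 rfl
  have e6 := (h.cell 2 2 1).2 rfl
  have e7 := (h.orow 1 2).2 rfl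
  obtain ⟨s, t, κ, γ₀, γ₁, μ, ν⟩ := q
  have h_s0 := hq.s0
  have h_s1 := hq.s1
  have h_t0 := hq.t0
  have h_t1 := hq.t1
  have h_κ0 := hq.κ0
  have h_μ0 := hq.μ0
  have h_γ := hq.γ
  have h_κμ := hq.κμ
  simp [a, b, slope, icept] at e1 e2 e3 e4 e5 e6 e7 h_s0 h_s1 h_t0 h_t1 h_κ0 h_μ0 h_γ h_κμ
  -- The equations give μ = 1 - s and μ (s - 1) = 1, so s - 1 squares to -1.
  refine ⟨s - 1, by grind, ?_⟩
  simp only [paramPair₁, mk.injEq]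
  refine ⟨?_, ?_, ?_, ?_, ?_, ?_, ?_⟩ <;> grind

theorem HasCode.eq_paramPair₂ (hq : q.Good) (h : q.HasCode codePair₂) :
    ∃ s, s ^ 2 = -1 ∧ q = paramPair₂ s := by
  have e1 := (h.cell 0 0 0).2 rfl
  have e2 := (h.cell 0 1 1).2 rfl
  have e3 := (h.cell 1 0 1).2 rfl
  have e4 := (h.cell 1 2 2).2 rfl
  have e5 := (h.cell 2 2 0).2 rfl
  have e6 := (h.orow 0 2).2 rfl
  have e7 := (h.ocol 1 1).2 rfl
  obtain ⟨s, t, κ, γ₀, γ₁, μ, ν⟩ := q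
  have h_s0 := hq.s0
  have h_s1 := hq.s1
  have h_t0 := hq.t0
  have h_t1 := hq.t1
  have h_κ0 := hq.κ0
  have h_μ0 := hq.μ0
  have h_γ := hq.γ
  have h_κμ := hq.κμ
  simp [a, b, slope, icept] at e1 e2 e3 e4 e5 e6 e7 h_s0 h_s1 h_t0 h_t1 h_κ0 h_μ0 h_γ h_κμ
  -- The equations give μ = s + 1 and μ (1 - s) = 2, so s squares to -1.
  refine ⟨s, by grind, ?_⟩
  simp only [paramPair₂, mk.injEq]
  refine ⟨?_, ?_, ?_, ?_, ?_, ?_, ?_⟩ <;> grind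

theorem Good.not_hasCode_empty₁ (hq : q.Good) : ¬ q.HasCode codeEmpty₁ := by
  intro h
  have e1 := (h.cell 0 0 0).2 rfl
  have e2 := (h.cell 0 1 1).2 rfl
  have e3 := (h.cell 1 1 2).2 rfl
  have e4 := (h.cell 1 2 0).2 rfl
  have e5 := (h.cell 2 1 0).2 rfl
  have e6 := (h.cell 2 2 1).2 rfl
  have e7 := (h.orow 0 2).2 rfl
  have e8 := (h.ocol 1 0).2 rfl
  obtain ⟨s, t, κ, γ₀, γ₁, μ, ν⟩ := q
  have h_s0 := hq.s0
  have h_s1 := hq.s1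
  have h_t0 := hq.t0
  have h_t1 := hq.t1
  have h_κ0 := hq.κ0
  have h_μ0 := hq.μ0
  have h_γ := hq.γ
  have h_κμ := hq.κμ
  simp [a, b, slope, icept] at e1 e2 e3 e4 e5 e6 e7 e8 h_s0 h_s1 h_t0 h_t1 h_κ0 h_μ0 h_γ h_κμ
  -- With ν = γ₁ = t - 1 and μ = s = 1 - t, `e7` says t² - t = -1 while `e6` says t² - t = 1.
  grind

theorem Good.not_hasCode_empty₂ (hq : q.Good) : ¬ q.HasCode codeEmpty₂ := by
  intro h
  have e1 := (h.cell 0 0 0).2 rfl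
  have e2 := (h.cell 0 1 1).2 rfl
  have e3 := (h.cell 1 1 2).2 rfl
  have e4 := (h.cell 1 2 0).2 rfl
  have e5 := (h.cell 2 0 2).2 rfl
  have e6 := (h.cell 2 1 0).2 rfl
  have e7 := (h.cell 2 2 1).2 rfl
  obtain ⟨s, t, κ, γ₀, γ₁, μ, ν⟩ := q
  have h_s0 := hq.s0
  have h_s1 := hq.s1
  have h_t0 := hq.t0
  have h_t1 := hq.t1
  have h_κ0 := hq.κ0
  have h_μ0 := hq.μ0
  have h_γ := hq.γ
  have h_κμ := hq.κμ
  simp [a, b, slope, icept] at e1 e2 e3 e4 e5 e6 e7 h_s0 h_s1 h_t0 h_t1 h_κ0 h_μ0 h_γ h_κμ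
  -- Here ν = t, μ = -t and s = 1 - t, so `e7` gives t² = 1. As t ≠ 1, t = -1 and then μ = 1 = κ.
  grind

theorem Good.not_hasCode_empty₃ (hq : q.Good) : ¬ q.HasCode codeEmpty₃ := by
  intro h
  have e1 := (h.cell 0 0 0).2 rfl
  have e2 := (h.cell 0 1 1).2 rfl
  have e3 := (h.cell 1 1 0).2 rfl
  have e4 := (h.cell 1 2 2).2 rfl
  have e5 := (h.cell 2 0 1).2 rfl
  have e6 := (h.cell 2 1 2).2 rfl
  have e7 := (h.cell 2 2 0).2 rfl
  obtain ⟨s, t, κ, γ₀, γ₁, μ, ν⟩ := q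
  have h_s0 := hq.s0
  have h_s1 := hq.s1
  have h_t0 := hq.t0
  have h_t1 := hq.t1
  have h_κ0 := hq.κ0
  have h_μ0 := hq.μ0
  have h_γ := hq.γ
  have h_κμ := hq.κμ
  simp [a, b, slope, icept] at e1 e2 e3 e4 e5 e6 e7 h_s0 h_s1 h_t0 h_t1 h_κ0 h_μ0 h_γ h_κμ
  -- With t = s - 1, ν = 1 and μ = s - 2, `e7` becomes (s - 1)² = 0.
  grind

theorem Good.not_hasCode_empty₄ (hq : q.Good) : ¬ q.HasCode codeEmpty₄ := by
  intro h
  have e1 := (h.cell 0 0 0).2 rfl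
  have e2 := (h.cell 0 1 1).2 rfl
  have e3 := (h.cell 0 2 2).2 rfl
  have e4 := (h.cell 1 1 0).2 rfl
  have e5 := (h.cell 1 2 1).2 rfl
  have e6 := (h.cell 2 1 2).2 rfl
  have e7 := (h.cell 2 2 0).2 rfl
  have e8 := (h.ocol 1 0).2 rfl
  obtain ⟨s, t, κ, γ₀, γ₁, μ, ν⟩ := q
  have h_s0 := hq.s0
  have h_s1 := hq.s1
  have h_t0 := hq.t0
  have h_t1 := hq.t1
  have h_κ0 := hq.κ0
  have h_μ0 := hq.μ0
  have h_γ := hq.γ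
  have h_κμ := hq.κμ
  simp [a, b, slope, icept] at e1 e2 e3 e4 e5 e6 e7 e8 h_s0 h_s1 h_t0 h_t1 h_κ0 h_μ0 h_γ h_κμ
  -- The cells force s = t = 2, μ = -2 and ν = 4, but `e8` demands ν = γ₁ = -1.
  grind

theorem Good.not_hasCode_empty₅ (hq : q.Good) : ¬ q.HasCode codeEmpty₅ := by
  intro h
  have e1 := (h.cell 0 0 0).2 rfl
  have e2 := (h.cell 0 1 1).2 rfl
  have e3 := (h.cell 0 2 2).2 rfl
  have e4 := (h.cell 1 1 0).2 rfl
  have e5 := (h.cell 1 2 1).2 rfl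
  have e6 := (h.cell 2 0 1).2 rfl
  have e7 := (h.cell 2 1 2).2 rfl
  have e8 := (h.cell 2 2 0).2 rfl
  obtain ⟨s, t, κ, γ₀, γ₁, μ, ν⟩ := q
  have h_s0 := hq.s0
  have h_s1 := hq.s1
  have h_t0 := hq.t0
  have h_t1 := hq.t1
  have h_κ0 := hq.κ0
  have h_μ0 := hq.μ0
  have h_γ := hq.γ
  have h_κμ := hq.κμ
  simp [a, b, slope, icept] at e1 e2 e3 e4 e5 e6 e7 e8 h_s0 h_s1 h_t0 h_t1 h_κ0 h_μ0 h_γ h_κμ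
  -- The cells force s = t = 2 and μ = ν = 1, so `e8` reads 0 = 3.
  grind

theorem Good.not_hasCode_empty₆ (hq : q.Good) : ¬ q.HasCode codeEmpty₆ := by
  intro h
  have e1 := (h.cell 0 0 0).2 rfl
  have e2 := (h.cell 0 1 1).2 rfl
  have e3 := (h.cell 0 2 2).2 rfl
  have e4 := (h.cell 1 0 1).2 rfl
  have e5 := (h.cell 1 1 2).2 rfl
  have e6 := (h.cell 1 2 0).2 rfl
  have e7 := (h.cell 2 0 2).2 rfl
  have e8 := (h.cell 2 1 0).2 rfl
  have e9 := (h.cell 2 2 1).2 rfl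
  obtain ⟨s, t, κ, γ₀, γ₁, μ, ν⟩ := q
  have h_s0 := hq.s0
  have h_s1 := hq.s1
  have h_t0 := hq.t0
  have h_t1 := hq.t1
  have h_κ0 := hq.κ0
  have h_μ0 := hq.μ0
  have h_γ := hq.γ
  have h_κμ := hq.κμ
  simp [a, b, slope, icept] at e1 e2 e3 e4 e5 e6 e7 e8 e9 h_s0 h_s1 h_t0 h_t1 h_κ0 h_μ0 h_γ h_κμ
  -- The cells force s = t = 2 and γ₁ = 1, so `e6` reads 0 = 3.
  grind

end Param

theorem param₁_good {t : ℂ} (ht : t ∈ par₁) : (param₁ t).Good := by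
  rw [mem_par₁_iff] at ht
  constructor <;> simp [param₁] <;> grind

/-- The conditions are equivalences, so the absence of every unlisted incidence has to be checked as
well, modulo the equation of the parameter. -/
theorem param₁_hasCode {t : ℂ} (ht : t ∈ par₁) : (param₁ t).HasCode code₁ := by
  rw [mem_par₁_iff] at ht
  constructor <;> intro k i
  · intro j
    fin_cases k <;> fin_cases i <;> fin_cases j <;>
      simp [param₁, Param.a, Param.b, Param.slope, Param.icept, code₁, Code.v] <;> grind
  all_goals
    fin_cases k <;> fin_cases i <;>
      simp [param₁, Param.a, Param.b, Param.slope, Param.icept, code₁, Code.o] <;> grind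

theorem param₂_good {t : ℂ × ℂ} (ht : t ∈ par₂) : (param₂ t).Good := by
  obtain ⟨t, u⟩ := t
  rw [mem_par₂_iff] at ht
  obtain ⟨rfl, hu⟩ : t = (u - 1) ^ 2 ∧ (u - 1) ^ 3 - (u - 1) ^ 2 + 1 = 0 := ht
  constructor <;> simp [param₂] <;> grind

theorem param₂_hasCode {t : ℂ × ℂ} (ht : t ∈ par₂) : (param₂ t).HasCode code₂ := by
  obtain ⟨t, u⟩ := t
  rw [mem_par₂_iff] at ht
  obtain ⟨rfl, hu⟩ : t = (u - 1) ^ 2 ∧ (u - 1) ^ 3 - (u - 1) ^ 2 + 1 = 0 := ht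
  constructor <;> intro k i
  · intro j
    fin_cases k <;> fin_cases i <;> fin_cases j <;>
      simp [param₂, Param.a, Param.b, Param.slope, Param.icept, code₂, Code.v] <;> grind
  all_goals
    fin_cases k <;> fin_cases i <;>
      simp [param₂, Param.a, Param.b, Param.slope, Param.icept, code₂, Code.o] <;> grind

theorem param₃_good {t : ℂ} (ht : t ∈ par₃) : (param₃ t).Good := by
  rw [mem_par₃_iff] at ht
  have h0 : t ≠ 0 := by grind
  constructor <;> simp [param₃] <;> grind

theorem param₃_hasCode {t : ℂ} (ht : t ∈ par₃) : (param₃ t).HasCode code₃ := by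
  rw [mem_par₃_iff] at ht
  have h0 : t ≠ 0 := by grind
  constructor <;> intro k i
  · intro j
    fin_cases k <;> fin_cases i <;> fin_cases j <;>
      simp [param₃, Param.a, Param.b, Param.slope, Param.icept, code₃, Code.v] <;> grind
  all_goals
    fin_cases k <;> fin_cases i <;>
      simp [param₃, Param.a, Param.b, Param.slope, Param.icept, code₃, Code.o] <;> grind

theorem param₄_good {t : ℂ} (ht : t ∈ par₄) : (param₄ t).Good := by
  rw [mem_par₄_iff] at ht
  constructor <;> simp [param₄] <;> grind

theorem param₄_hasCode {t : ℂ} (ht : t ∈ par₄) : (param₄ t).HasCode code₄ := by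
  rw [mem_par₄_iff] at ht
  constructor <;> intro k i
  · intro j
    fin_cases k <;> fin_cases i <;> fin_cases j <;>
      simp [param₄, Param.a, Param.b, Param.slope, Param.icept, code₄, Code.v] <;> grind
  all_goals
    fin_cases k <;> fin_cases i <;>
      simp [param₄, Param.a, Param.b, Param.slope, Param.icept, code₄, Code.o] <;> grind

theorem paramCurve_good {s : ℂ} (hs : s ≠ 0 ∧ s ≠ 1 ∧ s ≠ 2 ∧ 2 * s ≠ 1) :
    (paramCurve s).Good := by
  obtain ⟨h0, h1, h2, h3⟩ := hs
  constructor <;> simp [paramCurve] <;> grind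

theorem paramCurve_hasCode {s : ℂ} (hs : s ≠ 0 ∧ s ≠ 1 ∧ s ≠ 2 ∧ 2 * s ≠ 1) :
    (paramCurve s).HasCode codeCurve := by
  obtain ⟨h0, h1, h2, h3⟩ := hs
  constructor <;> intro k i
  · intro j
    fin_cases k <;> fin_cases i <;> fin_cases j <;>
      simp [paramCurve, Param.a, Param.b, Param.slope, Param.icept, codeCurve, Code.v] <;> grind
  all_goals
    fin_cases k <;> fin_cases i <;>
      simp [paramCurve, Param.a, Param.b, Param.slope, Param.icept, codeCurve, Code.o] <;> grind

end LineArrangement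

namespace LineArrangement

open Label

/-! ### Enumeration of the admissible codes -/

namespace Code

/-- The triples of entries of a code which describe one of the lines `obl`. -/
def triples : List (List ℕ) :=
  (List.range 4).flatMap fun a => (List.range 4).flatMap fun b => (List.range 4).map fun c =>
    [a, b, c]

/-- The entries less than `3` at different places are different. -/
def matching : List ℕ → Bool
  | [a, b, c] => (a == 3 || (a != b && a != c)) && (b == 3 || b != c)
  | _ => false

/-- The entries less than `3` at the same place are different. -/
def disjoint : List ℕ → List ℕ → Bool
  | [a, b, c], [a', b', c'] => (a == 3 || a != a') && (b == 3 || b != b') && (c == 3 || c != c')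
  | _, _ => false

/-- The number of grid points on a line `obl`. -/
def points (f : List ℕ) : ℕ := f.countP (· != 3)

/-- Two lines `obl` described by `f` and `g` can meet on the line `o`. -/
def compatible (f g : List ℕ) (o : ℕ) : Bool :=
  o == 6 || if o < 3 then f.getD o 3 == 3 && g.getD o 3 == 3
    else !f.contains (o - 3) && !g.contains (o - 3)

/-- The necessary conditions on the code of an arrangement. -/
def admissible (f g h : List ℕ) (o p : ℕ) : Bool :=
  compatible f h o && compatible g h p && (o == 6 || o != p) &&
  (Nat.ble 2 (points f + (o != 6).toNat)) && (Nat.ble 2 (points g + (p != 6).toNat)) &&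
  (Nat.ble 3 (points h + ((o != 6).toNat + (p != 6).toNat))) &&
  ([0, 1, 2].all fun i => Nat.ble 2 ((f.getD i 3 != 3).toNat + (g.getD i 3 != 3).toNat +
    (h.getD i 3 != 3).toNat + (o == i).toNat + (p == i).toNat)) &&
  ([0, 1, 2].all fun j => Nat.ble 2 ((f.contains j).toNat + (g.contains j).toNat +
    (h.contains j).toNat + (o == 3 + j).toNat + (p == 3 + j).toNat))

/-- The permutations of the columns or of the rows. -/
def perms : List (Fin 3 → Fin 3) :=
  [![0, 1, 2], ![0, 2, 1], ![1, 0, 2], ![1, 2, 0], ![2, 0, 1], ![2, 1, 0]]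

/-- Exchange of `obl 0` and `obl 1`. -/
def exchange (sw : Bool) (k : Fin 3) : Fin 3 :=
  bif sw then ![1, 0, 2] k else k

def exchange₂ (sw : Bool) (b : Fin 2) : Fin 2 :=
  bif sw then ![1, 0] b else b

/-- The code `c` becomes `d` by a relabelling of the lines. -/
def relabels (tr sw : Bool) (s t : Fin 3 → Fin 3) (c d : Code) : Bool :=
  ([0, 1, 2].all fun k : Fin 3 => [0, 1, 2].all fun i : Fin 3 => [0, 1, 2].all fun j : Fin 3 =>
    ((bif tr then c.v (exchange sw k) (t j) == (s i : ℕ) else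
      c.v (exchange sw k) (s i) == (t j : ℕ)) == (d.v k i == (j : ℕ)))) &&
  ([0, 1].all fun b : Fin 2 => [0, 1, 2].all fun i : Fin 3 =>
    ((c.o (exchange₂ sw b) == (bif tr then 3 + (s i : ℕ) else s i)) == (d.o b == (i : ℕ))) &&
    ((c.o (exchange₂ sw b) == (bif tr then (t i : ℕ) else 3 + t i)) == (d.o b == 3 + (i : ℕ))))

/-- The possible codes up to relabelling. -/
def all : List Code :=
  [code₁, code₂, code₃, code₄, codeCurve, codePoint, codePair₁, codePair₂, codeEmpty₁, codeEmpty₂,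
    codeEmpty₃, codeEmpty₄, codeEmpty₅, codeEmpty₆]

/-- Numbers which have to agree for codes which are related by a relabelling. -/
def signature (sw : Bool) (c : Code) : List ℕ :=
  bif sw then [points ((c.drop 3).take 3), points (c.take 3), (c.o 0 == 6).toNat] else
    [points (c.take 3), points ((c.drop 3).take 3), (c.o 1 == 6).toNat]

/-- `c` becomes one of the codes in the list by a relabelling. -/
def standard (c : Code) : Bool :=
  all.any fun d => [false, true].any fun sw => signature sw c == signature false d &&
    [false, true].any fun tr => perms.any fun s => perms.any fun t => relabels tr sw s t c d

/-- The search assumes that `obl 0` passes through the grid points (0, 0) and (1, 1); its third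
entry is then row 2 or none. The conditions are nested so that failing branches are cut early. -/
theorem enum_standard : ([2, 3].all fun x => triples.all fun g =>
    !(matching g && disjoint [0, 1, x] g) ||
    triples.all fun h => !(matching h && disjoint [0, 1, x] h && disjoint g h) ||
    (List.range 7).all fun o => !compatible [0, 1, x] h o ||
    (List.range 7).all fun p => !admissible [0, 1, x] g h o p ||
      standard ([0, 1, x] ++ g ++ h ++ [o, p])) = true := by
  decide +kernel

/-- The reason is a count. Columns and rows together need twelve incidences. A grid point counts
twice and a meeting point of `obl 2` with `obl 0` or `obl 1` once, so if f and g have at most one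
grid point each, h has three. Then `obl 2` meets every column and row in a grid point, which leaves
no room for the meeting point that f requires. -/
theorem enum_points : (triples.all fun f => !(matching f && Nat.ble (points f) 1) ||
    triples.all fun h => !(matching h && disjoint f h) ||
    (List.range 7).all fun o => !(compatible f h o && o != 6) ||
    triples.all fun g => !(matching g && Nat.ble (points g) 1 && disjoint f g && disjoint g h) ||
    (List.range 7).all fun p => !admissible f g h o p) = true := by
  decide +kernel

end Code
end LineArrangement

namespace LineArrangement

open Label

/-! ### The code of an arrangement with two quadruple points -/

/-- The lines `X` form an arrangement whose only quadruple points are `P` and `Q`, with the roles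
given by the labels, and every line contains three multiple points. -/
structure Frame (X : Label → ℙ ℂ V) (P Q : ℙ ℂ V) : Prop where
  inj : Function.Injective X
  onP : ∀ l, OnLine P (X l) ↔ l.kind = 0 ∨ l.kind = 2
  onQ : ∀ l, OnLine Q (X l) ↔ l.kind = 1 ∨ l.kind = 2
  par : Conc (X inf) (X (obl 0)) (X (obl 1))
  three : ∀ R, R ≠ P → R ≠ Q → ∀ w x y z : Label, [w, x, y, z].Nodup →
    OnLine R (X w) → OnLine R (X x) → OnLine R (X y) → OnLine R (X z) → False
  rich : ∀ l R₁ R₂, ∃ R, OnLine R (X l) ∧ R ≠ R₁ ∧ R ≠ R₂ ∧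
    ∃ x y, x ≠ l ∧ y ≠ l ∧ x ≠ y ∧ OnLine R (X x) ∧ OnLine R (X y)

/-- Exchange of rows and columns. -/
def Label.transpose : Label → Label
  | col i => row i
  | row i => col i
  | inf => inf
  | obl k => obl k

theorem Label.transpose_transpose (l : Label) : l.transpose.transpose = l := by
  cases l <;> rfl

theorem Frame.comp {X : Label → ℙ ℂ V} {P Q : ℙ ℂ V} (h : Frame X P Q) {e : Label → Label}
    (he : Function.Bijective e) (hk : ∀ l, (e l).kind = l.kind)
    (hp : Conc (X inf) (X (e (obl 0))) (X (e (obl 1)))) : Frame (X ∘ e) P Q where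
  inj := h.inj.comp he.1
  onP l := by rw [Function.comp, h.onP, hk]
  onQ l := by rw [Function.comp, h.onQ, hk]
  par := by
    have : e inf = inf := by
      have := hk inf
      generalize e inf = l at this
      cases l <;> simp_all [kind]
    simpa [this] using hp
  three R hP hQ w x y z hn := by
    apply h.three R hP hQ
    simpa using hn.map he.1
  rich l R₁ R₂ := by
    obtain ⟨R, h1, h2, h3, x, y, h4, h5, h6, h7, h8⟩ := h.rich (e l) R₁ R₂
    obtain ⟨x, rfl⟩ := he.2 x
    obtain ⟨y, rfl⟩ := he.2 y
    exact ⟨R, h1, h2, h3, x, y, fun h => h4 (by rw [h]), fun h => h5 (by rw [h]),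
      fun h => h6 (by rw [h]), h7, h8⟩

/-- By this symmetry, which also exchanges P and Q, statements on rows follow from those on columns.
-/
theorem Frame.transpose {X : Label → ℙ ℂ V} {P Q : ℙ ℂ V} (h : Frame X P Q) :
    Frame (X ∘ Label.transpose) Q P := by
  have hb : Function.Bijective Label.transpose :=
    Function.Involutive.bijective Label.transpose_transpose
  refine ⟨h.inj.comp hb.1, fun l => ?_, fun l => ?_, h.par, ?_, ?_⟩
  · rw [Function.comp, h.onQ]
    cases l <;> simp [kind, Label.transpose]
  · rw [Function.comp, h.onP]
    cases l <;> simp [kind, Label.transpose]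
  · intro R hQ hP w x y z hn
    apply h.three R hP hQ
    simpa using hn.map hb.1
  · intro l R₁ R₂
    obtain ⟨R, h1, h2, h3, x, y, h4, h5, h6, h7, h8⟩ := h.rich l.transpose R₁ R₂
    obtain ⟨x, rfl⟩ := hb.2 x
    obtain ⟨y, rfl⟩ := hb.2 y
    exact ⟨R, h1, h2, h3, x, y, fun h => h4 (by rw [h]), fun h => h5 (by rw [h]),
      fun h => h6 (by rw [h]), h7, h8⟩

namespace Frame

variable {X : Label → ℙ ℂ V} {P Q R S : ℙ ℂ V} (h : Frame X P Q)

include h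

theorem eq_of_onLine {x y : Label} (hxy : x ≠ y) (h1 : OnLine R (X x)) (h2 : OnLine R (X y))
    (h3 : OnLine S (X x)) (h4 : OnLine S (X y)) : R = S :=
  LineArrangement.eq_of_onLine (h.inj.ne hxy) h1 h2 h3 h4

theorem ne_left_of_onLine {l : Label} (hR : OnLine R (X l)) (hl : l.kind ≠ 0) (hl' : l.kind ≠ 2) :
    R ≠ P := by
  rintro rfl
  rw [h.onP] at hR
  tauto

theorem ne_right_of_onLine {l : Label} (hR : OnLine R (X l)) (hl : l.kind ≠ 1) (hl' : l.kind ≠ 2) :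
    R ≠ Q := by
  rintro rfl
  rw [h.onQ] at hR
  tauto

/-- The point would be quadruple, but P lies on no row and Q on no column. -/
theorem false_of_col_row_obl_obl {i j k l : Fin 3} (hkl : k ≠ l) (h1 : OnLine R (X (col i)))
    (h2 : OnLine R (X (row j))) (h3 : OnLine R (X (obl k))) (h4 : OnLine R (X (obl l))) : False :=
  h.three R (h.ne_left_of_onLine h2 (by simp [kind]) (by simp [kind]))
    (h.ne_right_of_onLine h1 (by simp [kind]) (by simp [kind])) (col i) (row j) (obl k) (obl l)
    (by simp [hkl]) h1 h2 h3 h4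

theorem col_eq {i j k : Fin 3} (h1 : OnLine R (X (col i))) (h2 : OnLine R (X (col j)))
    (h3 : OnLine R (X (row k)) ∨ OnLine R (X (obl k))) : i = j := by
  by_contra hij
  have := h.eq_of_onLine (x := col i) (y := col j) (by simpa using hij) h1 h2
    ((h.onP _).2 (by simp [kind])) ((h.onP _).2 (by simp [kind]))
  subst this
  simp [h.onP, kind] at h3

theorem row_eq {i j k : Fin 3} (h1 : OnLine R (X (row i))) (h2 : OnLine R (X (row j)))
    (h3 : OnLine R (X (col k)) ∨ OnLine R (X (obl k))) : i = j :=
  h.transpose.col_eq h1 h2 h3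

theorem not_onLine_inf_of_col {i : Fin 3} (hP : R ≠ P) (h1 : OnLine R (X (col i))) :
    ¬ OnLine R (X inf) := fun h2 =>
  hP (h.eq_of_onLine (x := col i) (y := inf) (by simp) h1 h2 ((h.onP _).2 (by simp [kind]))
    ((h.onP _).2 (by simp [kind])))

theorem onLine_inf_of_obl (h1 : OnLine R (X (obl 0))) (h2 : OnLine R (X (obl 1))) :
    OnLine R (X inf) := by
  obtain ⟨S, s1, s2, s3⟩ := h.par
  rwa [h.eq_of_onLine (x := obl 0) (y := obl 1) (by simp) h1 h2 s2 s3]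

/-- Otherwise `inf` and all three lines `obl` would pass through one point, a quadruple point other
than P and Q. -/
theorem not_onLine_inf_obl_two {k : Fin 3} (hk : k ≠ 2) (h1 : OnLine R (X inf))
    (h2 : OnLine R (X (obl k))) : ¬ OnLine R (X (obl 2)) := by
  intro h3
  obtain ⟨S, s1, s2, s3⟩ := h.par
  have : R = S := by
    have : k = 0 ∨ k = 1 := by omega
    obtain rfl | rfl := this
    · exact h.eq_of_onLine (x := inf) (y := obl 0) (by simp) h1 h2 s1 s2
    · exact h.eq_of_onLine (x := inf) (y := obl 1) (by simp) h1 h2 s1 s3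
  subst this
  exact h.three R (h.ne_left_of_onLine h3 (by simp [kind]) (by simp [kind]))
    (h.ne_right_of_onLine h3 (by simp [kind]) (by simp [kind])) inf (obl 0) (obl 1) (obl 2)
    (by simp) s1 s2 s3 h3

/-- No line `col` passes through the intersection of `obl 0` and `obl 1`. -/
theorem not_col_obl_obl {i : Fin 3} (h1 : OnLine R (X (col i))) (h2 : OnLine R (X (obl 0))) :
    ¬ OnLine R (X (obl 1)) := fun h3 =>
  h.not_onLine_inf_of_col (h.ne_left_of_onLine h2 (by simp [kind]) (by simp [kind])) h1
    (h.onLine_inf_of_obl h2 h3)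

theorem base : Base X where
  inj := h.inj
  cols i i' := ⟨P, by simp [h.onP, kind]⟩
  rows i i' := ⟨Q, by simp [h.onQ, kind]⟩
  par := h.par
  col_row := fun ⟨R, h1, h2, h3⟩ =>
    h.not_onLine_inf_of_col (h.ne_left_of_onLine h2 (by simp [kind]) (by simp [kind])) h1 h3
  col_obl k := fun ⟨R, h1, h2, h3⟩ =>
    h.not_onLine_inf_of_col (h.ne_left_of_onLine h3 (by simp [kind]) (by simp [kind])) h1 h2
  row_obl k := fun ⟨R, h1, h2, h3⟩ =>
    h.transpose.not_onLine_inf_of_col (h.ne_right_of_onLine h3 (by simp [kind]) (by simp [kind]))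
      h1 h2
  obl_obl := fun ⟨_, h1, h2, h3⟩ => h.not_onLine_inf_obl_two (by simp) h1 h2 h3

/-- Besides `P` and any given point, `col i` contains a point where it meets `row` and `obl` or two
of the lines `obl`. -/
theorem exists_col (i : Fin 3) (S : ℙ ℂ V) : ∃ R, OnLine R (X (col i)) ∧ R ≠ S ∧
    ((∃ j k, OnLine R (X (row j)) ∧ OnLine R (X (obl k))) ∨
      ∃ k : Fin 3, k ≠ 2 ∧ OnLine R (X (obl k)) ∧ OnLine R (X (obl 2))) := by
  obtain ⟨R, h1, hP, hS, x, y, hx, hy, hxy, h2, h3⟩ := h.rich (col i) P S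
  refine ⟨R, h1, hS, ?_⟩
  have hcol : ∀ i', col i' ≠ col i → ¬ OnLine R (X (col i')) := fun i' hi hR =>
    hP (h.eq_of_onLine hi hR h1 ((h.onP _).2 (by simp [kind])) ((h.onP _).2 (by simp [kind])))
  have hinf := h.not_onLine_inf_of_col hP h1
  have hoo : ∀ k l, k ≠ l → OnLine R (X (obl k)) → OnLine R (X (obl l)) →
      ∃ k : Fin 3, k ≠ 2 ∧ OnLine R (X (obl k)) ∧ OnLine R (X (obl 2)) := by
    intro k l hkl hk hl
    by_cases hk2 : k = 2
    · exact ⟨l, by omega, hl, hk2 ▸ hk⟩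
    by_cases hl2 : l = 2
    · exact ⟨k, by omega, hk, hl2 ▸ hl⟩
    have : (k = 0 ∧ l = 1) ∨ (k = 1 ∧ l = 0) := by omega
    obtain ⟨rfl, rfl⟩ | ⟨rfl, rfl⟩ := this
    · exact absurd hl (h.not_col_obl_obl h1 hk)
    · exact absurd hk (h.not_col_obl_obl h1 hl)
  rcases x with x | x | _ | x
  · exact absurd h2 (hcol _ hx)
  · rcases y with y | y | _ | y
    · exact absurd h3 (hcol _ hy)
    · exact absurd (h.row_eq h2 h3 (Or.inl h1)) (by simpa using hxy)
    · exact absurd h3 hinf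
    · exact Or.inl ⟨_, _, h2, h3⟩
  · exact absurd h2 hinf
  · rcases y with y | y | _ | y
    · exact absurd h3 (hcol _ hy)
    · exact Or.inl ⟨_, _, h3, h2⟩
    · exact absurd h3 hinf
    · exact Or.inr (hoo _ _ (by simpa using hxy) h2 h3)

/-- A line `obl k` contains, besides two given points of which the first one lies on `inf` if
`k ≠ 2`, a point where it meets `col` and `row`, or another line `obl` and `col` or `row`. -/
theorem exists_obl (k : Fin 3) (S T : ℙ ℂ V)
    (hS : k = 2 ∨ (OnLine S (X inf) ∧ OnLine S (X (obl k)))) :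
    ∃ R, OnLine R (X (obl k)) ∧ R ≠ S ∧ R ≠ T ∧
      ((∃ i j, OnLine R (X (col i)) ∧ OnLine R (X (row j))) ∨
        ∃ l, l ≠ k ∧ (k = 2 ∨ l = 2) ∧ OnLine R (X (obl l)) ∧
          ((∃ i, OnLine R (X (col i))) ∨ ∃ j, OnLine R (X (row j)))) := by
  obtain ⟨R, h1, hRS, hRT, x, y, hx, hy, hxy, h2, h3⟩ := h.rich (obl k) S T
  refine ⟨R, h1, hRS, hRT, ?_⟩
  have hP : R ≠ P := h.ne_left_of_onLine h1 (by simp [kind]) (by simp [kind])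
  have hQ : R ≠ Q := h.ne_right_of_onLine h1 (by simp [kind]) (by simp [kind])
  have hci : ∀ i, OnLine R (X (col i)) → ¬ OnLine R (X inf) := fun i =>
    h.not_onLine_inf_of_col hP
  have hri : ∀ i, OnLine R (X (row i)) → ¬ OnLine R (X inf) := fun i =>
    h.transpose.not_onLine_inf_of_col hQ
  have hoi : ∀ l, obl l ≠ obl k → OnLine R (X (obl l)) → ¬ OnLine R (X inf) := by
    intro l hl h4 h5
    obtain rfl | ⟨hS1, hS2⟩ := hS
    · exact h.not_onLine_inf_obl_two (by simpa using hl) h5 h4 h1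
    · exact hRS (h.eq_of_onLine (x := inf) (y := obl k) (by simp) h5 h1 hS1 hS2)
  have hkl : ∀ l, obl l ≠ obl k → OnLine R (X (obl l)) → k = 2 ∨ l = 2 := by
    intro l hl h4
    by_contra hne
    push Not at hne
    have hl' : l ≠ k := by simpa using hl
    apply hoi l hl h4
    have : (k = 0 ∧ l = 1) ∨ (k = 1 ∧ l = 0) := by omega
    obtain ⟨rfl, rfl⟩ | ⟨rfl, rfl⟩ := this
    · exact h.onLine_inf_of_obl h1 h4
    · exact h.onLine_inf_of_obl h4 h1
  have hall : ∀ l m, obl l ≠ obl k → obl m ≠ obl k → obl l ≠ obl m → OnLine R (X (obl l)) →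
      ¬ OnLine R (X (obl m)) := by
    intro l m hl hm hlm h4 h5
    apply hoi l hl h4
    have all : ∀ n, OnLine R (X (obl n)) := by
      intro n
      have : n = k ∨ n = l ∨ n = m := by
        simp at hl hm hlm
        omega
      obtain rfl | rfl | rfl := this <;> assumption
    exact h.onLine_inf_of_obl (all 0) (all 1)
  rcases x with x | x | _ | x <;> rcases y with y | y | _ | y
  · exact absurd (h.col_eq h2 h3 (Or.inr h1)) (by simpa using hxy)
  · exact Or.inl ⟨_, _, h2, h3⟩
  · exact absurd h3 (hci _ h2)
  · exact Or.inr ⟨y, by simpa using hy, hkl y hy h3, h3, Or.inl ⟨_, h2⟩⟩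
  · exact Or.inl ⟨_, _, h3, h2⟩
  · exact absurd (h.row_eq h2 h3 (Or.inr h1)) (by simpa using hxy)
  · exact absurd h3 (hri _ h2)
  · exact Or.inr ⟨y, by simpa using hy, hkl y hy h3, h3, Or.inr ⟨_, h2⟩⟩
  · exact absurd h2 (hci _ h3)
  · exact absurd h2 (hri _ h3)
  · exact absurd rfl hxy
  · exact absurd h2 (hoi _ hy h3)
  · exact Or.inr ⟨x, by simpa using hx, hkl x hx h2, h2, Or.inl ⟨_, h3⟩⟩
  · exact Or.inr ⟨x, by simpa using hx, hkl x hx h2, h2, Or.inr ⟨_, h3⟩⟩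
  · exact absurd h3 (hoi _ hx h2)
  · exact absurd h3 (hall _ _ hx hy hxy h2)

end Frame
end LineArrangement

/-! ### Admissibility of the code of an arrangement -/

namespace LineArrangement

open Label

/-- At least two of the flags are set when, whichever index is discarded, a set one remains. This
matches the form in which further multiple points are produced. -/
theorem two_le_toNat_add₄ : ∀ a b c d : Bool, (∀ x, ∃ y ≠ x, ![a, b, c, d] y = true) →
    2 ≤ a.toNat + b.toNat + c.toNat + d.toNat := by
  decide

theorem two_le_toNat_add₅ : ∀ a b c d e : Bool, (∀ x, ∃ y ≠ x, ![a, b, c, d, e] y = true) →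
    2 ≤ a.toNat + b.toNat + c.toNat + d.toNat + e.toNat := by
  decide

theorem three_le_toNat_add₅ : ∀ a b c d e : Bool,
    (∀ x x', ∃ y, y ≠ x ∧ y ≠ x' ∧ ![a, b, c, d, e] y = true) →
    3 ≤ a.toNat + b.toNat + c.toNat + d.toNat + e.toNat := by
  decide

theorem Code.points_eq (a b c : ℕ) :
    points [a, b, c] = (a != 3).toNat + (b != 3).toNat + (c != 3).toNat := by
  simp only [points, List.countP_cons, List.countP_nil]
  cases (a != 3) <;> cases (b != 3) <;> cases (c != 3) <;> rfl

namespace Frame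

variable {X : Label → ℙ ℂ V} {P Q : ℙ ℂ V} (h : Frame X P Q)

include h

/-- The point where `obl k` meets `col i` lies on at most one row; the value 3 stands for none. -/
theorem exists_cell (k i : Fin 3) :
    ∃ n : ℕ, n ≤ 3 ∧ ∀ j : Fin 3, Conc (X (col i)) (X (row j)) (X (obl k)) ↔ n = j := by
  by_cases hn : ∃ j, Conc (X (col i)) (X (row j)) (X (obl k))
  · obtain ⟨j, hj⟩ := hn
    refine ⟨j, by omega, fun j' => ⟨fun hj' => ?_, fun e => ?_⟩⟩
    · obtain ⟨R, h1, h2, h3⟩ := hj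
      obtain ⟨R', h1', h2', h3'⟩ := hj'
      obtain rfl := h.eq_of_onLine (x := col i) (y := obl k) (by simp) h1 h3 h1' h3'
      rw [h.row_eq h2 h2' (Or.inl h1)]
    · rwa [← Fin.ext e]
  · push Not at hn
    refine ⟨3, le_rfl, fun j => ⟨fun hj => absurd hj (hn j), fun e => ?_⟩⟩
    omega

/-- The point where `obl k` meets `obl 2` lies on at most one column or row, never on both, as it
would be quadruple; the value 6 stands for none. -/
theorem exists_meet (k : Fin 3) (hk : k ≠ 2) :
    ∃ n : ℕ, n ≤ 6 ∧ (∀ i : Fin 3, Conc (X (col i)) (X (obl k)) (X (obl 2)) ↔ n = i) ∧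
      ∀ j : Fin 3, Conc (X (row j)) (X (obl k)) (X (obl 2)) ↔ n = 3 + j := by
  obtain ⟨R, h1, h2⟩ := exists_onLine (X (obl k)) (X (obl 2))
  have key : ∀ l, Conc (X l) (X (obl k)) (X (obl 2)) ↔ OnLine R (X l) := by
    refine fun l => ⟨fun ⟨S, s1, s2, s3⟩ => ?_, fun h3 => ⟨R, h3, h1, h2⟩⟩
    rwa [h.eq_of_onLine (x := obl k) (y := obl 2) (by simpa using hk) h1 h2 s2 s3]
  simp only [key]
  by_cases hn : ∃ i, OnLine R (X (col i))
  · obtain ⟨i, hi⟩ := hn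
    refine ⟨i, by omega, fun i' => ⟨fun hi' => ?_, fun e => ?_⟩, fun j => ⟨fun hj => ?_, fun e => ?_⟩⟩
    · rw [h.col_eq hi hi' (Or.inr h1)]
    · rwa [← Fin.ext e]
    · exact (h.false_of_col_row_obl_obl hk hi hj h1 h2).elim
    · omega
  push Not at hn
  by_cases hm : ∃ j, OnLine R (X (row j))
  · obtain ⟨j, hj⟩ := hm
    refine ⟨3 + j, by omega, fun i => ⟨fun hi => absurd hi (hn i), fun e => ?_⟩,
      fun j' => ⟨fun hj' => ?_, fun e => ?_⟩⟩
    · omega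
    · rw [h.row_eq hj hj' (Or.inr h1)]
    · rwa [← Fin.ext (add_left_cancel e)]
  · push Not at hm
    refine ⟨6, le_rfl, fun i => ⟨fun hi => absurd hi (hn i), fun e => ?_⟩,
      fun j => ⟨fun hj => absurd hj (hm j), fun e => ?_⟩⟩ <;> omega

/-- At least two of the five possible triple points on `col i` other than `P` exist. -/
theorem exists_ne_col (i : Fin 3) (x : Fin 5) : ∃ y ≠ x,
    ![∃ j, Conc (X (col i)) (X (row j)) (X (obl 0)), ∃ j, Conc (X (col i)) (X (row j)) (X (obl 1)),
      ∃ j, Conc (X (col i)) (X (row j)) (X (obl 2)), Conc (X (col i)) (X (obl 0)) (X (obl 2)),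
      Conc (X (col i)) (X (obl 1)) (X (obl 2))] y := by
  -- The index x of each alternative is assigned a line `obl` occurring in it. A multiple point of
  -- the column off this line realizes another alternative.
  obtain ⟨S, s1, s2⟩ := exists_onLine (X (col i)) (X (obl (![0, 1, 2, 0, 1] x)))
  obtain ⟨R, h1, hRS, h2⟩ := h.exists_col i S
  have hx : ¬ OnLine R (X (obl (![0, 1, 2, 0, 1] x))) := fun hR =>
    hRS (h.eq_of_onLine (x := col i) (y := obl (![0, 1, 2, 0, 1] x)) (by simp) h1 hR s1 s2)
  obtain ⟨j, k, h3, h4⟩ | ⟨k, hk, h3, h4⟩ := h2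
  · refine ⟨Fin.castLE (by omega) k, ?_, ?_⟩
    · rintro rfl
      fin_cases k <;> exact hx h4
    · fin_cases k <;> exact ⟨j, R, h1, h3, h4⟩
  · fin_cases k
    · refine ⟨3, ?_, R, h1, h3, h4⟩
      rintro rfl
      exact hx h3
    · refine ⟨4, ?_, R, h1, h3, h4⟩
      rintro rfl
      exact hx h3
    · exact absurd rfl hk

theorem exists_ne_row (j : Fin 3) (x : Fin 5) : ∃ y ≠ x,
    ![∃ i, Conc (X (col i)) (X (row j)) (X (obl 0)), ∃ i, Conc (X (col i)) (X (row j)) (X (obl 1)),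
      ∃ i, Conc (X (col i)) (X (row j)) (X (obl 2)), Conc (X (row j)) (X (obl 0)) (X (obl 2)),
      Conc (X (row j)) (X (obl 1)) (X (obl 2))] y := by
  simp only [conc_swap (l := X (col _))]
  exact h.transpose.exists_ne_col j x

/-- At least two of the four possible triple points on `obl k` outside `inf` exist, for `k ≠ 2`. -/
theorem exists_ne_obl (k : Fin 3) (hk : k ≠ 2) (x : Fin 4) : ∃ y ≠ x,
    ![∃ j, Conc (X (col 0)) (X (row j)) (X (obl k)), ∃ j, Conc (X (col 1)) (X (row j)) (X (obl k)),
      ∃ j, Conc (X (col 2)) (X (row j)) (X (obl k)),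
      (∃ i, Conc (X (col i)) (X (obl k)) (X (obl 2))) ∨
        ∃ j, Conc (X (row j)) (X (obl k)) (X (obl 2))] y := by
  -- S is the triple point on `inf`, which is not counted, and T is the point of `obl k` belonging
  -- to the discarded alternative x.
  obtain ⟨S, s1, s2⟩ := exists_onLine (X inf) (X (obl k))
  obtain ⟨T, t1, t2⟩ := exists_onLine (X (![col 0, col 1, col 2, obl 2] x)) (X (obl k))
  obtain ⟨R, h1, -, hRT, h2⟩ := h.exists_obl k S T (Or.inr ⟨s1, s2⟩)
  have hx : ¬ OnLine R (X (![col 0, col 1, col 2, obl 2] x)) := fun hR =>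
    hRT (h.eq_of_onLine (x := ![col 0, col 1, col 2, obl 2] x) (y := obl k)
      (by fin_cases x <;> simp [hk.symm]) hR h1 t1 t2)
  obtain ⟨i, j, h3, h4⟩ | ⟨l, hl, hl2, h3, h4⟩ := h2
  · refine ⟨i.castSucc, ?_, ?_⟩
    · rintro rfl
      fin_cases i <;> exact hx h3
    · fin_cases i <;> exact ⟨j, R, h3, h4, h1⟩
  · obtain rfl := hl2.resolve_left hk
    refine ⟨3, ?_, ?_⟩
    · rintro rfl
      exact hx h3
    · obtain ⟨i, h4⟩ | ⟨j, h4⟩ := h4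
      · exact Or.inl ⟨i, R, h4, h1, h3⟩
      · exact Or.inr ⟨j, R, h4, h1, h3⟩

/-- At least three of the five possible triple points on `obl 2` exist. -/
theorem exists_ne_obl_two (x x' : Fin 5) : ∃ y, y ≠ x ∧ y ≠ x' ∧
    ![∃ j, Conc (X (col 0)) (X (row j)) (X (obl 2)), ∃ j, Conc (X (col 1)) (X (row j)) (X (obl 2)),
      ∃ j, Conc (X (col 2)) (X (row j)) (X (obl 2)),
      (∃ i, Conc (X (col i)) (X (obl 0)) (X (obl 2))) ∨
        ∃ j, Conc (X (row j)) (X (obl 0)) (X (obl 2)),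
      (∃ i, Conc (X (col i)) (X (obl 1)) (X (obl 2))) ∨
        ∃ j, Conc (X (row j)) (X (obl 1)) (X (obl 2))] y := by
  obtain ⟨S, s1, s2⟩ := exists_onLine (X (![col 0, col 1, col 2, obl 0, obl 1] x)) (X (obl 2))
  obtain ⟨T, t1, t2⟩ := exists_onLine (X (![col 0, col 1, col 2, obl 0, obl 1] x')) (X (obl 2))
  obtain ⟨R, h1, hRS, hRT, h2⟩ := h.exists_obl 2 S T (Or.inl rfl)
  have hne : ∀ x : Fin 5, ![col 0, col 1, col 2, obl 0, obl 1] x ≠ obl 2 := by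
    intro x
    fin_cases x <;> simp
  have hx : ¬ OnLine R (X (![col 0, col 1, col 2, obl 0, obl 1] x)) := fun hR =>
    hRS (h.eq_of_onLine (hne x) hR h1 s1 s2)
  have hx' : ¬ OnLine R (X (![col 0, col 1, col 2, obl 0, obl 1] x')) := fun hR =>
    hRT (h.eq_of_onLine (hne x') hR h1 t1 t2)
  have key : ∀ y, OnLine R (X (![col 0, col 1, col 2, obl 0, obl 1] y)) → y ≠ x ∧ y ≠ x' := by
    refine fun y hy => ⟨?_, ?_⟩
    · rintro rfl
      exact hx hy
    · rintro rfl
      exact hx' hy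
  obtain ⟨i, j, h3, h4⟩ | ⟨l, hl, -, h3, h4⟩ := h2
  · fin_cases i
    · exact ⟨0, (key 0 h3).1, (key 0 h3).2, j, R, h3, h4, h1⟩
    · exact ⟨1, (key 1 h3).1, (key 1 h3).2, j, R, h3, h4, h1⟩
    · exact ⟨2, (key 2 h3).1, (key 2 h3).2, j, R, h3, h4, h1⟩
  · have h5 : (∃ i, Conc (X (col i)) (X (obl l)) (X (obl 2))) ∨
        ∃ j, Conc (X (row j)) (X (obl l)) (X (obl 2)) :=
      h4.imp (fun ⟨i, h4⟩ => ⟨i, R, h4, h3, h1⟩) (fun ⟨j, h4⟩ => ⟨j, R, h4, h3, h1⟩)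
    fin_cases l
    · exact ⟨3, (key 3 h3).1, (key 3 h3).2, h5⟩
    · exact ⟨4, (key 4 h3).1, (key 4 h3).2, h5⟩
    · exact absurd rfl hl

/-- The code of an arrangement is admissible. -/
theorem exists_code : ∃ f₀ f₁ f₂ : List ℕ, ∃ o p : ℕ,
    f₀ ∈ Code.triples ∧ f₁ ∈ Code.triples ∧ f₂ ∈ Code.triples ∧ o < 7 ∧ p < 7 ∧
    Code.matching f₀ ∧ Code.matching f₁ ∧ Code.matching f₂ ∧
    Code.disjoint f₀ f₁ ∧ Code.disjoint f₀ f₂ ∧ Code.disjoint f₁ f₂ ∧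
    Code.admissible f₀ f₁ f₂ o p ∧ HasCode X (f₀ ++ f₁ ++ f₂ ++ [o, p]) := by
  choose v hv3 hv using h.exists_cell
  obtain ⟨o, ho6, ho1, ho2⟩ := h.exists_meet 0 (by simp)
  obtain ⟨p, hp6, hp1, hp2⟩ := h.exists_meet 1 (by simp)
  have mem : ∀ k, [v k 0, v k 1, v k 2] ∈ Code.triples := by
    intro k
    have h0 := hv3 k 0
    have h1 := hv3 k 1
    have h2 := hv3 k 2
    simp [Code.triples]
    omega
  have three : ∀ k i, (∃ j, Conc (X (col i)) (X (row j)) (X (obl k))) ↔ v k i ≠ 3 := by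
    intro k i
    simp only [hv]
    refine ⟨fun ⟨j, hj⟩ => by omega, fun hne => ⟨⟨v k i, ?_⟩, rfl⟩⟩
    have := hv3 k i
    omega
  have point : ∀ {k i}, v k i ≠ 3 → ∃ j : Fin 3, v k i = j ∧ ∃ R, OnLine R (X (col i)) ∧
      OnLine R (X (row j)) ∧ OnLine R (X (obl k)) := by
    intro k i hne
    obtain ⟨j, hj⟩ := (three k i).2 hne
    exact ⟨j, (hv k i j).1 hj, hj⟩
  have inj : ∀ k i i', i ≠ i' → v k i ≠ 3 → v k i ≠ v k i' := by
    intro k i i' hii h3 e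
    obtain ⟨j, hj, R, h1, h2, h3⟩ := point h3
    obtain ⟨S, s1, s2, s3⟩ := (hv k i' j).2 (e ▸ hj)
    obtain rfl := h.eq_of_onLine (x := row j) (y := obl k) (by simp) h2 h3 s2 s3
    exact hii (h.col_eq h1 s1 (Or.inl h2))
  have disj : ∀ k k' i, k ≠ k' → v k i ≠ 3 → v k i ≠ v k' i := by
    intro k k' i hkk h3 e
    obtain ⟨j, hj, R, h1, h2, h3⟩ := point h3
    obtain ⟨S, s1, s2, s3⟩ := (hv k' i j).2 (e ▸ hj)
    obtain rfl := h.eq_of_onLine (x := col i) (y := row j) (by simp) h1 h2 s1 s2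
    exact h.false_of_col_row_obl_obl hkk h1 h2 h3 s3
  have matching : ∀ k, Code.matching [v k 0, v k 1, v k 2] := by
    intro k
    have h1 := inj k 0 1 (by simp)
    have h2 := inj k 0 2 (by simp)
    have h3 := inj k 1 2 (by simp)
    simp [Code.matching]
    tauto
  have disjoint : ∀ k k', k ≠ k' →
      Code.disjoint [v k 0, v k 1, v k 2] [v k' 0, v k' 1, v k' 2] := by
    intro k k' hk
    have h1 := disj k k' 0 hk
    have h2 := disj k k' 1 hk
    have h3 := disj k k' 2 hk
    simp [Code.disjoint]
    tauto
  -- Where two lines `obl` meet on a column there is no row, so the corresponding entry takes its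
  -- default value.
  have meet_col : ∀ k l i, l ≠ k → Conc (X (col i)) (X (obl k)) (X (obl l)) → v k i = 3 := by
    rintro k l i hk ⟨R, h1, h2, h3⟩
    by_contra hne
    obtain ⟨j, -, S, s1, s2, s3⟩ := point hne
    obtain rfl := h.eq_of_onLine (x := col i) (y := obl k) (by simp) h1 h2 s1 s3
    exact h.false_of_col_row_obl_obl hk.symm h1 s2 h2 h3
  have meet_row : ∀ k l i j, l ≠ k → Conc (X (row j)) (X (obl k)) (X (obl l)) → v k i ≠ j := by
    rintro k l i j hk ⟨R, h1, h2, h3⟩ e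
    obtain ⟨S, s1, s2, s3⟩ := (hv k i j).2 e
    obtain rfl := h.eq_of_onLine (x := row j) (y := obl k) (by simp) h1 h2 s2 s3
    exact h.false_of_col_row_obl_obl hk.symm s1 h1 h2 h3
  have compat : ∀ (k : Fin 3) (n : ℕ), k ≠ 2 → n ≤ 6 →
      (∀ i : Fin 3, Conc (X (col i)) (X (obl k)) (X (obl 2)) ↔ n = i) →
      (∀ j : Fin 3, Conc (X (row j)) (X (obl k)) (X (obl 2)) ↔ n = 3 + j) →
      Code.compatible [v k 0, v k 1, v k 2] [v 2 0, v 2 1, v 2 2] n := by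
    intro k n hk hn hc hr
    have hsw : ∀ l, Conc (X l) (X (obl k)) (X (obl 2)) → Conc (X l) (X (obl 2)) (X (obl k)) :=
      fun l hl => hl.swap.rotate
    by_cases h6 : n = 6
    · simp [Code.compatible, h6]
    by_cases h3 : n < 3
    · have h1 := (hc ⟨n, h3⟩).2 rfl
      have e1 := meet_col k 2 ⟨n, h3⟩ hk.symm h1
      have e2 := meet_col 2 k ⟨n, h3⟩ hk (hsw _ h1)
      have e : ∀ m (i : Fin 3), [v m 0, v m 1, v m 2].getD i 3 = v m i := by
        intro m i
        fin_cases i <;> rfl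
      simp only [Code.compatible, h3, if_true, Bool.or_eq_true, Bool.and_eq_true, beq_iff_eq]
      exact Or.inr ⟨(e k ⟨n, h3⟩).trans e1, (e 2 ⟨n, h3⟩).trans e2⟩
    · have h1 := (hr ⟨n - 3, by omega⟩).2 (by simp; omega)
      have e1 := fun i => meet_row k 2 i _ hk.symm h1
      have e2 := fun i => meet_row 2 k i _ hk (hsw _ h1)
      simp only [Code.compatible, h3]
      simp [Ne.symm (e1 _), Ne.symm (e2 _)]
  have contains : ∀ k (j : Fin 3), ([v k 0, v k 1, v k 2].contains (j : ℕ)) = true ↔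
      ∃ i, Conc (X (col i)) (X (row j)) (X (obl k)) := by
    intro k j
    simp only [hv]
    simp only [List.contains_iff_mem, List.mem_cons, List.not_mem_nil, or_false]
    refine ⟨?_, ?_⟩
    · rintro (e | e | e)
      exacts [⟨0, e.symm⟩, ⟨1, e.symm⟩, ⟨2, e.symm⟩]
    · rintro ⟨i, e⟩
      rw [← e]
      fin_cases i <;> simp
  have ne6 : ∀ (k : Fin 3) (n : ℕ), n ≤ 6 →
      (∀ i : Fin 3, Conc (X (col i)) (X (obl k)) (X (obl 2)) ↔ n = i) →
      (∀ j : Fin 3, Conc (X (row j)) (X (obl k)) (X (obl 2)) ↔ n = 3 + j) →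
      (((∃ i, Conc (X (col i)) (X (obl k)) (X (obl 2))) ∨
        ∃ j, Conc (X (row j)) (X (obl k)) (X (obl 2))) ↔ n ≠ 6) := by
    intro k n hn hc hr
    simp only [hc, hr]
    refine ⟨?_, fun h6 => ?_⟩
    · rintro (⟨i, hi⟩ | ⟨j, hj⟩) <;> omega
    · by_cases h3 : n < 3
      · exact Or.inl ⟨⟨n, h3⟩, rfl⟩
      · exact Or.inr ⟨⟨n - 3, by omega⟩, by simp; omega⟩
  have ho := ne6 0 o ho6 ho1 ho2
  have hp := ne6 1 p hp6 hp1 hp2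
  refine ⟨_, _, _, o, p, mem 0, mem 1, mem 2, by omega, by omega, matching 0, matching 1, matching 2,
    disjoint 0 1 (by simp), disjoint 0 2 (by simp), disjoint 1 2 (by simp), ?_, ?_⟩
  · simp only [Code.admissible, Bool.and_eq_true, Nat.ble_eq, Code.points_eq]
    refine ⟨⟨⟨⟨⟨⟨⟨compat 0 o (by simp) ho6 ho1 ho2, compat 1 p (by simp) hp6 hp1 hp2⟩, ?_⟩, ?_⟩, ?_⟩,
      ?_⟩, ?_⟩, ?_⟩
    · by_cases h6 : o = 6
      · simp [h6]
      simp only [Bool.or_eq_true, bne_iff_ne]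
      refine Or.inr fun hop => ?_
      -- Equal values o = p other than 6 would make the three lines `obl` concurrent, but `obl 0`
      -- and `obl 1` meet on `inf`, away from `obl 2`.
      have key : ∀ l, Conc (X l) (X (obl 0)) (X (obl 2)) → Conc (X l) (X (obl 1)) (X (obl 2)) →
          l ≠ obl 2 → False := by
        rintro l ⟨R, r1, r2, r3⟩ ⟨S, s1, s2, s3⟩ hl
        obtain rfl := h.eq_of_onLine hl r1 r3 s1 s3
        exact h.not_onLine_inf_obl_two (by simp) (h.onLine_inf_of_obl r2 s2) r2 r3
      by_cases h3 : o < 3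
      · exact key (col ⟨o, h3⟩) ((ho1 _).2 rfl) ((hp1 _).2 hop.symm) (by simp)
      · have : o = 3 + ((⟨o - 3, by omega⟩ : Fin 3) : ℕ) := by simp; omega
        exact key (row ⟨o - 3, by omega⟩) ((ho2 _).2 this) ((hp2 _).2 (hop.symm.trans this)) (by simp)
    · apply two_le_toNat_add₄
      intro x
      obtain ⟨y, hy, hact⟩ := h.exists_ne_obl 0 (by simp) x
      refine ⟨y, hy, ?_⟩
      fin_cases y <;> simpa [three, ho] using hact
    · apply two_le_toNat_add₄
      intro x
      obtain ⟨y, hy, hact⟩ := h.exists_ne_obl 1 (by simp) x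
      refine ⟨y, hy, ?_⟩
      fin_cases y <;> simpa [three, hp] using hact
    · rw [← add_assoc]
      apply three_le_toNat_add₅
      intro x x'
      obtain ⟨y, hy, hy', hact⟩ := h.exists_ne_obl_two x x'
      refine ⟨y, hy, hy', ?_⟩
      fin_cases y <;> simpa [three, ho, hp] using hact
    · have key : ∀ i : Fin 3, 2 ≤ (v 0 i != 3).toNat + (v 1 i != 3).toNat + (v 2 i != 3).toNat +
          (o == (i : ℕ)).toNat + (p == (i : ℕ)).toNat := by
        intro i
        apply two_le_toNat_add₅
        intro x
        obtain ⟨y, hy, hact⟩ := h.exists_ne_col i x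
        refine ⟨y, hy, ?_⟩
        fin_cases y <;> simpa [three, ho1, hp1] using hact
      simp only [List.all_cons, List.all_nil, Bool.and_eq_true, Nat.ble_eq]
      exact ⟨key 0, key 1, key 2, trivial⟩
    · have key : ∀ j : Fin 3, 2 ≤ ([v 0 0, v 0 1, v 0 2].contains (j : ℕ)).toNat +
          ([v 1 0, v 1 1, v 1 2].contains (j : ℕ)).toNat +
          ([v 2 0, v 2 1, v 2 2].contains (j : ℕ)).toNat + (o == 3 + (j : ℕ)).toNat +
          (p == 3 + (j : ℕ)).toNat := by
        intro j
        apply two_le_toNat_add₅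
        intro x
        obtain ⟨y, hy, hact⟩ := h.exists_ne_row j x
        refine ⟨y, hy, ?_⟩
        fin_cases y
        · exact (contains 0 j).2 hact
        · exact (contains 1 j).2 hact
        · exact (contains 2 j).2 hact
        · simpa [ho2] using hact
        · simpa [hp2] using hact
      simp only [List.all_cons, List.all_nil, Bool.and_eq_true, Nat.ble_eq]
      exact ⟨key 0, key 1, key 2, trivial⟩
  · refine ⟨fun k i j => ?_, fun b i => ?_, fun b i => ?_⟩
    · rw [hv]
      fin_cases k <;> fin_cases i <;> rfl
    · fin_cases b
      · exact ho1 i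
      · exact hp1 i
    · fin_cases b
      · exact ho2 i
      · exact hp2 i

end Frame
end LineArrangement

/-! ### Relabelling and reduction to the standard codes -/

namespace LineArrangement

open Label

/-- Permutation of the columns, of the rows, and of `obl 0` and `obl 1`. -/
def Label.relabel (sw : Bool) (s t : Fin 3 → Fin 3) : Label → Label
  | col i => col (s i)
  | row j => row (t j)
  | inf => inf
  | obl k => obl (Code.exchange sw k)

theorem Code.bijective_of_mem_perms : ∀ s ∈ perms, Function.Bijective s := by
  intro s hs
  rw [Function.Bijective, and_iff_left_of_imp Finite.surjective_of_injective]
  revert s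
  decide

theorem Code.exists_mem_perms : ∀ i i' : Fin 3, i ≠ i' → ∃ s ∈ perms, s 0 = i ∧ s 1 = i' := by
  decide

theorem Code.exchange_exchange : ∀ sw k, exchange sw (exchange sw k) = k := by
  decide

theorem Label.relabel_bijective (sw : Bool) {s t : Fin 3 → Fin 3} (hs : Function.Bijective s)
    (ht : Function.Bijective t) : Function.Bijective (relabel sw s t) := by
  have he : Function.Bijective (Code.exchange sw) :=
    Function.Involutive.bijective (Code.exchange_exchange sw)
  constructor
  · intro x y hxy
    cases x <;> cases y <;>
      simp [relabel, hs.1.eq_iff, ht.1.eq_iff, he.1.eq_iff] at hxy ⊢ <;> exact hxy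
  · rintro (i | i | _ | i)
    · obtain ⟨j, rfl⟩ := hs.2 i
      exact ⟨col j, rfl⟩
    · obtain ⟨j, rfl⟩ := ht.2 i
      exact ⟨row j, rfl⟩
    · exact ⟨inf, rfl⟩
    · obtain ⟨j, rfl⟩ := he.2 i
      exact ⟨obl j, rfl⟩

namespace Frame

variable {X : Label → ℙ ℂ V} {P Q : ℙ ℂ V}

theorem relabel (h : Frame X P Q) (sw : Bool) {s t : Fin 3 → Fin 3} (hs : s ∈ Code.perms)
    (ht : t ∈ Code.perms) : Frame (X ∘ Label.relabel sw s t) P Q := by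
  refine h.comp (Label.relabel_bijective sw (Code.bijective_of_mem_perms s hs)
    (Code.bijective_of_mem_perms t ht)) ?_ ?_
  · intro l
    cases l <;> rfl
  · cases sw
    · exact h.par
    · exact h.par.rotate.swap.rotate.rotate

/-- One of the lines `obl 0` and `obl 1` contains two grid points. -/
theorem exists_two_points (h : Frame X P Q) : ∃ k ≠ (2 : Fin 3), ∃ i i' j j' : Fin 3, i ≠ i' ∧
    Conc (X (col i)) (X (row j)) (X (obl k)) ∧ Conc (X (col i')) (X (row j')) (X (obl k)) := by
  obtain ⟨f₀, f₁, f₂, o, p, t0, t1, t2, ho, hp, m0, m1, m2, d01, d02, d12, ha, hc⟩ := h.exists_code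
  have key : ∀ f ∈ Code.triples, ¬ Code.points f ≤ 1 →
      (f.length = 3 ∧ ∃ i i' j j' : Fin 3, i ≠ i' ∧ f.getD i 3 = j ∧ f.getD i' 3 = j') := by
    decide +kernel
  have len : ∀ f ∈ Code.triples, f.length = 3 := by
    decide +kernel
  have hd : ¬ Code.points f₀ ≤ 1 ∨ ¬ Code.points f₁ ≤ 1 := by
    by_contra! hcon
    have hen := Code.enum_points
    simp only [List.all_eq_true, Bool.or_eq_true, Bool.not_eq_true', Bool.and_eq_false_iff] at hen
    have e1 := (hen f₀ t0).resolve_left (by simp [m0, hcon.1])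
    have hcompat : Code.compatible f₀ f₂ o = true := by
      simp only [Code.admissible, Bool.and_eq_true] at ha
      exact ha.1.1.1.1.1.1.1
    -- With at most one grid point, `obl 0` needs its meeting point with `obl 2` as second triple
    -- point off `inf`.
    have ho6 : o ≠ 6 := by
      rintro rfl
      have hble : Nat.ble 2 (Code.points f₀ + (6 != 6).toNat) = true := by
        simp only [Code.admissible, Bool.and_eq_true] at ha
        exact ha.1.1.1.1.2
      simp at hble
      omega
    have e2 := (e1 f₂ t2).resolve_left (by simp [m2, d02])
    have e3 := (e2 o (by simpa using ho)).resolve_left (by simp [hcompat, ho6])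
    have e4 := (e3 f₁ t1).resolve_left (by simp [m1, hcon.2, d01, d12])
    have e5 := e4 p (by simpa using hp)
    simp [ha] at e5
  have l0 := len f₀ t0
  have l1 := len f₁ t1
  obtain hd | hd := hd
  · obtain ⟨-, i, i', j, j', hii, e, e'⟩ := key f₀ t0 hd
    have hv : ∀ i : Fin 3, Code.v (f₀ ++ f₁ ++ f₂ ++ [o, p]) 0 i = f₀.getD i 3 := by
      intro i
      simp [Code.v, List.getElem?_append, l0]
    exact ⟨0, by simp, i, i', j, j', hii, (hc.cell 0 i j).2 ((hv i).trans e),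
      (hc.cell 0 i' j').2 ((hv i').trans e')⟩
  · obtain ⟨-, i, i', j, j', hii, e, e'⟩ := key f₁ t1 hd
    have hv : ∀ i : Fin 3, Code.v (f₀ ++ f₁ ++ f₂ ++ [o, p]) 1 i = f₁.getD i 3 := by
      intro i
      simp [Code.v, List.getElem?_append, l0, l1]
    exact ⟨1, by simp, i, i', j, j', hii, (hc.cell 1 i j).2 ((hv i).trans e),
      (hc.cell 1 i' j').2 ((hv i').trans e')⟩

/-- One may assume that `obl 0` passes through two given grid points. -/
theorem exists_relabel (h : Frame X P Q) : ∃ e : Label → Label, Function.Bijective e ∧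
    Frame (X ∘ e) P Q ∧ Conc (X (e (col 0))) (X (e (row 0))) (X (e (obl 0))) ∧
      Conc (X (e (col 1))) (X (e (row 1))) (X (e (obl 0))) := by
  obtain ⟨k, hk, i, i', j, j', hii, h1, h2⟩ := h.exists_two_points
  have hjj : j ≠ j' := by
    rintro rfl
    obtain ⟨R, r1, r2, r3⟩ := h1
    obtain ⟨S, s1, s2, s3⟩ := h2
    obtain rfl := h.eq_of_onLine (x := row j) (y := obl k) (by simp) r2 r3 s2 s3
    exact hii (h.col_eq r1 s1 (Or.inl r2))
  obtain ⟨s, hs, s0, s1⟩ := Code.exists_mem_perms i i' hii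
  obtain ⟨t, ht, t0, t1⟩ := Code.exists_mem_perms j j' hjj
  obtain ⟨sw, hsw⟩ : ∃ sw, Code.exchange sw 0 = k := by
    have : ∀ k ≠ (2 : Fin 3), ∃ sw, Code.exchange sw 0 = k := by decide
    exact this k hk
  refine ⟨Label.relabel sw s t, Label.relabel_bijective sw (Code.bijective_of_mem_perms s hs)
    (Code.bijective_of_mem_perms t ht), h.relabel sw hs ht, ?_, ?_⟩
  · simpa [Label.relabel, s0, t0, hsw] using h1
  · simpa [Label.relabel, s1, t1, hsw] using h2

end Frame

/-- `Code.relabels` is the Boolean form of this transfer. With `tr`, the new column i is the old row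
s i, so the roles of the grid coordinates and of the ranges 0–2 and 3–5 of the last two entries are
exchanged. -/
theorem HasCode.relabel {X : Label → ℙ ℂ V} {c d : Code} (hc : HasCode X c) {tr sw : Bool}
    {s t : Fin 3 → Fin 3} (hr : Code.relabels tr sw s t c d = true) :
    HasCode ((bif tr then X ∘ Label.transpose else X) ∘ Label.relabel sw s t) d := by
  have all3 : ∀ (p : Fin 3 → Bool), [0, 1, 2].all p = true ↔ ∀ i, p i = true := by
    intro p
    simp [Fin.forall_fin_succ]
  have all2 : ∀ (p : Fin 2 → Bool), [0, 1].all p = true ↔ ∀ i, p i = true := by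
    intro p
    simp
  simp only [Code.relabels, Bool.and_eq_true, all3, all2] at hr
  obtain ⟨h1, h2⟩ := hr
  have hex : ∀ b : Fin 2, Code.exchange sw b.castSucc = (Code.exchange₂ sw b).castSucc := by
    cases sw <;> decide
  have hex2 : Code.exchange sw 2 = 2 := by
    cases sw <;> decide
  cases tr
  · refine ⟨fun k i j => ?_, fun b i => ?_, fun b i => ?_⟩
    · have := h1 k i j
      simp only [cond_false, Bool.beq_eq_decide_eq, decide_eq_decide, decide_eq_true_eq] at this
      exact (hc.cell _ _ _).trans this
    · have := (h2 b i).1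
      simp only [cond_false, Bool.beq_eq_decide_eq, decide_eq_decide, decide_eq_true_eq] at this
      simp only [cond_false, Function.comp, Label.relabel, hex, hex2]
      exact (hc.ocol _ _).trans this
    · have := (h2 b i).2
      simp only [cond_false, Bool.beq_eq_decide_eq, decide_eq_decide, decide_eq_true_eq] at this
      simp only [cond_false, Function.comp, Label.relabel, hex, hex2]
      exact (hc.orow _ _).trans this
  · refine ⟨fun k i j => ?_, fun b i => ?_, fun b i => ?_⟩
    · have := h1 k i j
      simp only [cond_true, Bool.beq_eq_decide_eq, decide_eq_decide, decide_eq_true_eq] at this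
      exact (conc_swap.trans (hc.cell _ _ _)).trans this
    · have := (h2 b i).1
      simp only [cond_true, Bool.beq_eq_decide_eq, decide_eq_decide, decide_eq_true_eq] at this
      simp only [cond_true, Function.comp, Label.relabel, Label.transpose, hex, hex2]
      exact (hc.orow _ _).trans this
    · have := (h2 b i).2
      simp only [cond_true, Bool.beq_eq_decide_eq, decide_eq_decide, decide_eq_true_eq] at this
      simp only [cond_true, Function.comp, Label.relabel, Label.transpose, hex, hex2]
      exact (hc.ocol _ _).trans this

/-- After a relabelling the code is one of the codes in the list. -/
theorem Frame.exists_standard {X : Label → ℙ ℂ V} {P Q : ℙ ℂ V} (h : Frame X P Q) :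
    ∃ e : Label → Label, Function.Bijective e ∧ Base (X ∘ e) ∧
      ∃ d ∈ Code.all, HasCode (X ∘ e) d := by
  obtain ⟨e, he, hF, p0, p1⟩ := h.exists_relabel
  obtain ⟨f₀, f₁, f₂, o, p, t0, t1, t2, ho, hp, m0, m1, m2, d01, d02, d12, ha, hc⟩ := hF.exists_code
  -- The entries of a line are distinct unless they are 3, so after 0 and 1 only 2 or the default
  -- remains.
  have hf : ∃ x ∈ [2, 3], f₀ = [0, 1, x] := by
    have len : ∀ f ∈ Code.triples, f.length = 3 := by decide +kernel
    have hv : ∀ i : Fin 3, Code.v (f₀ ++ f₁ ++ f₂ ++ [o, p]) 0 i = f₀.getD i 3 := by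
      intro i
      simp [Code.v, List.getElem?_append, len f₀ t0]
    have e0 := (hv 0).symm.trans ((hc.cell 0 0 0).1 p0)
    have e1 := (hv 1).symm.trans ((hc.cell 0 1 1).1 p1)
    have key : ∀ f ∈ Code.triples, Code.matching f = true → f.getD 0 3 = 0 → f.getD 1 3 = 1 →
        ∃ x ∈ [2, 3], f = [0, 1, x] := by
      decide +kernel
    exact key f₀ t0 m0 e0 e1
  obtain ⟨x, hx, rfl⟩ := hf
  have hst : Code.standard ([0, 1, x] ++ f₁ ++ f₂ ++ [o, p]) = true := by
    have hen := Code.enum_standard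
    simp only [List.all_eq_true, Bool.or_eq_true, Bool.not_eq_true', Bool.and_eq_false_iff] at hen
    have hcompat : Code.compatible [0, 1, x] f₂ o = true := by
      simp only [Code.admissible, Bool.and_eq_true] at ha
      exact ha.1.1.1.1.1.1.1
    have e1 := (hen x hx f₁ t1).resolve_left (by simp [m1, d01])
    have e2 := (e1 f₂ t2).resolve_left (by simp [m2, d02, d12])
    have e3 := (e2 o (by simpa using ho)).resolve_left (by simp [hcompat])
    exact (e3 p (by simpa using hp)).resolve_left (by simp [ha])
  simp only [Code.standard, List.any_eq_true, Bool.and_eq_true] at hst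
  obtain ⟨d, hd, sw, -, -, tr, -, s, hs, t, ht, hr⟩ := hst
  have hb := Label.relabel_bijective sw (Code.bijective_of_mem_perms s hs)
    (Code.bijective_of_mem_perms t ht)
  have hcd := hc.relabel hr
  cases tr
  · exact ⟨e ∘ Label.relabel sw s t, he.comp hb, (hF.relabel sw hs ht).base, d, hd, hcd⟩
  · exact ⟨e ∘ Label.transpose ∘ Label.relabel sw s t, he.comp
      ((Function.Involutive.bijective Label.transpose_transpose).comp hb),
      (hF.transpose.relabel sw hs ht).base, d, hd, hcd⟩

end LineArrangement

namespace LineArrangement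

open Label

/-! ### Labelling the lines of an arrangement -/

theorem exists_ne_of_three_le_encard {α : Type*} {S : Set α} (h : 3 ≤ S.encard) (a b : α) :
    ∃ x ∈ S, x ≠ a ∧ x ≠ b := by
  by_contra! hcon
  have hsub : S ⊆ {a, b} := by
    intro x hx
    by_cases hxa : x = a
    · exact Or.inl hxa
    · exact Or.inr (hcon x hx hxa)
  have h2 : S.encard ≤ 2 := (Set.encard_le_encard hsub).trans
    ((Set.encard_insert_le _ _).trans_eq (by rw [Set.encard_singleton]; rfl))
  exact absurd (h.trans h2) (by decide)

theorem NonReductive.exists_point {n : ℕ} {A : Lines n} (h : NonReductive A) (i : Fin n)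
    (R₁ R₂ : ℙ ℂ V) : ∃ R, OnLine R (A i) ∧ R ≠ R₁ ∧ R ≠ R₂ ∧
      ∃ x y, x ≠ i ∧ y ≠ i ∧ x ≠ y ∧ OnLine R (A x) ∧ OnLine R (A y) := by
  obtain ⟨R, ⟨h1, h2⟩, h3, h4⟩ := exists_ne_of_three_le_encard (h i) R₁ R₂
  obtain ⟨x, hx, hxi, -⟩ := exists_ne_of_three_le_encard h2 i i
  obtain ⟨y, hy, hyi, hyx⟩ := exists_ne_of_three_le_encard h2 i x
  exact ⟨R, h1, h3, h4, x, y, hxi, hyi, hyx.symm, hx, hy⟩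

theorem mult_eq_four {n : ℕ} {A : Lines n} (h5 : ∀ r : ℕ, 5 ≤ r → numPoints A r = 0) {R : ℙ ℂ V}
    {w x y z : Fin n} (hn : [w, x, y, z].Nodup) (hw : OnLine R (A w)) (hx : OnLine R (A x))
    (hy : OnLine R (A y)) (hz : OnLine R (A z)) : mult A R = 4 := by
  -- The multiplicity is a natural number, so `h5` can be applied with r equal to it.
  have hfin : mult A R = (({i | OnLine R (A i)} : Set (Fin n)).ncard : ℕ∞) :=
    (Set.toFinite _).cast_ncard_eq.symm
  have hle : ({i | OnLine R (A i)} : Set (Fin n)).ncard < 5 := by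
    by_contra! hge
    have h0 := h5 _ hge
    rw [numPoints, Set.encard_eq_zero] at h0
    exact Set.eq_empty_iff_forall_notMem.1 h0 R hfin
  have hge : 4 ≤ ({i | OnLine R (A i)} : Set (Fin n)).ncard := by
    have hsub : (([w, x, y, z].toFinset : Finset (Fin n)) : Set (Fin n)) ⊆ {i | OnLine R (A i)} := by
      intro i hi
      simp at hi
      obtain rfl | rfl | rfl | rfl := hi <;> assumption
    have := Set.ncard_le_ncard hsub (Set.toFinite _)
    rwa [Set.ncard_coe_finset, List.toFinset_card_of_nodup hn] at this
  rw [hfin]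
  have : ({i | OnLine R (A i)} : Set (Fin n)).ncard = 4 := by omega
  rw [this]
  rfl

theorem exists_enum_of_card_eq_three {n : ℕ} (S : Finset (Fin n)) (h : S.card = 3) :
    ∃ c : Fin 3 → Fin n, Function.Injective c ∧ ∀ x, x ∈ S ↔ ∃ i, c i = x := by
  refine ⟨S.orderEmbOfFin h, (S.orderEmbOfFin h).injective, fun x => ?_⟩
  rw [← Finset.mem_coe, ← Finset.range_orderEmbOfFin S h]
  rfl

/-- The lines of an arrangement with two quadruple points on a common line can be labelled. -/
theorem exists_frame {A : Lines 10} (hA : Function.Injective A) (hNR : NonReductive A)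
    (h4 : numPoints A 4 = 2) (h5 : ∀ r : ℕ, 5 ≤ r → numPoints A r = 0)
    (hc : ∃ i, ∀ P, mult A P = 4 → OnLine P (A i)) :
    ∃ e : Label → Fin 10, Function.Bijective e ∧ ∃ P Q, Frame (A ∘ e) P Q := by
  classical
  obtain ⟨i₀, hi₀⟩ := hc
  obtain ⟨P, Q, hPQ, hset⟩ := Set.encard_eq_two.1 h4
  have hquad : ∀ R, mult A R = 4 ↔ R = P ∨ R = Q := by
    intro R
    have : R ∈ {P | mult A P = (4 : ℕ)} ↔ R ∈ ({P, Q} : Set _) := by rw [hset]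
    simpa using this
  have hP : mult A P = 4 := (hquad P).2 (Or.inl rfl)
  have hQ : mult A Q = 4 := (hquad Q).2 (Or.inr rfl)
  have hP0 := hi₀ P hP
  have hQ0 := hi₀ Q hQ
  have huniq : ∀ {i j : Fin 10} {R S : ℙ ℂ V}, i ≠ j → OnLine R (A i) → OnLine R (A j) →
      OnLine S (A i) → OnLine S (A j) → R = S := fun hij => eq_of_onLine (hA.ne hij)
  have hcard : ∀ R, mult A R = 4 → (Finset.univ.filter fun i => OnLine R (A i)).card = 4 := by
    intro R hR
    rw [mult, ← Set.coe_toFinset {i | OnLine R (A i)}, Set.encard_coe_eq_coe_finsetCard] at hR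
    rw [← Set.toFinset_ofPred]
    exact_mod_cast hR
  set SP := Finset.univ.filter fun i => OnLine P (A i) with hSP
  set SQ := Finset.univ.filter fun i => OnLine Q (A i) with hSQ
  have cP : SP.card = 4 := hcard P hP
  have cQ : SQ.card = 4 := hcard Q hQ
  have mP : ∀ i, i ∈ SP ↔ OnLine P (A i) := by simp [hSP]
  have mQ : ∀ i, i ∈ SQ ↔ OnLine Q (A i) := by simp [hSQ]
  -- Only one line joins P and Q; hence seven lines pass through P or Q and three are left.
  have hinter : SP ∩ SQ = {i₀} := by
    ext i
    rw [Finset.mem_inter, mP, mQ, Finset.mem_singleton]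
    constructor
    · rintro ⟨h1, h2⟩
      by_contra hne
      exact hPQ (huniq hne h1 hP0 h2 hQ0)
    · rintro rfl
      exact ⟨hP0, hQ0⟩
  obtain ⟨c, hcinj, hcm⟩ := exists_enum_of_card_eq_three (SP.erase i₀) (by
    rw [Finset.card_erase_of_mem ((mP _).2 hP0), cP])
  obtain ⟨r, hrinj, hrm⟩ := exists_enum_of_card_eq_three (SQ.erase i₀) (by
    rw [Finset.card_erase_of_mem ((mQ _).2 hQ0), cQ])
  obtain ⟨m, hminj, hmm⟩ := exists_enum_of_card_eq_three (SP ∪ SQ)ᶜ (by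
    have h1 := Finset.card_union_add_card_inter SP SQ
    rw [hinter, cP, cQ, Finset.card_singleton] at h1
    rw [Finset.card_compl, Fintype.card_fin]
    omega)
  have hcP : ∀ i, OnLine P (A (c i)) ∧ c i ≠ i₀ ∧ ¬ OnLine Q (A (c i)) := by
    intro i
    have h1 := (hcm (c i)).2 ⟨i, rfl⟩
    rw [Finset.mem_erase, mP] at h1
    exact ⟨h1.2, h1.1, fun h2 => hPQ (huniq h1.1 h1.2 hP0 h2 hQ0)⟩
  have hrQ : ∀ i, OnLine Q (A (r i)) ∧ r i ≠ i₀ ∧ ¬ OnLine P (A (r i)) := by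
    intro i
    have h1 := (hrm (r i)).2 ⟨i, rfl⟩
    rw [Finset.mem_erase, mQ] at h1
    exact ⟨h1.2, h1.1, fun h2 => hPQ (huniq h1.1 h2 hP0 h1.2 hQ0)⟩
  have hm' : ∀ x, (¬ OnLine P (A x) ∧ ¬ OnLine Q (A x)) ↔ ∃ i, m i = x := by
    intro x
    rw [← hmm, Finset.mem_compl, Finset.mem_union, mP, mQ, not_or]
  have hmPQ : ∀ i, ¬ OnLine P (A (m i)) ∧ ¬ OnLine Q (A (m i)) := fun i => (hm' _).2 ⟨i, rfl⟩
  -- The third multiple point of the common line lies on two other lines, which avoid P and Q since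
  -- they meet the common line only once. The permutation π makes them `obl 0` and `obl 1`.
  obtain ⟨R, hR0, hRP, hRQ, x, y, hx, hy, hxy, hRx, hRy⟩ := hNR.exists_point i₀ P Q
  have hobl : ∀ x, x ≠ i₀ → OnLine R (A x) → ∃ i, m i = x := fun x hx hRx => (hm' x).1
    ⟨fun hPx => hRP (huniq hx hRx hR0 hPx hP0), fun hQx => hRQ (huniq hx hRx hR0 hQx hQ0)⟩
  obtain ⟨k, rfl⟩ := hobl x hx hRx
  obtain ⟨l, rfl⟩ := hobl y hy hRy
  obtain ⟨π, hπ, π0, π1⟩ := Code.exists_mem_perms k l (fun h => hxy (by rw [h]))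
  have hπb := Code.bijective_of_mem_perms π hπ
  let e : Label → Fin 10
    | col i => c i
    | row j => r j
    | inf => i₀
    | obl k => m (π k)
  have heP : ∀ l, OnLine P (A (e l)) ↔ l.kind = 0 ∨ l.kind = 2 := by
    rintro (i | i | _ | i)
    · simpa [kind] using (hcP i).1
    · simpa [kind] using (hrQ i).2.2
    · simpa [kind] using hP0
    · simpa [kind] using (hmPQ (π i)).1
  have heQ : ∀ l, OnLine Q (A (e l)) ↔ l.kind = 1 ∨ l.kind = 2 := by
    rintro (i | i | _ | i)
    · simpa [kind] using (hcP i).2.2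
    · simpa [kind] using (hrQ i).1
    · simpa [kind] using hQ0
    · simpa [kind] using (hmPQ (π i)).2
  have hbij : Function.Bijective e := by
    constructor
    · intro a b hab
      have h1 := (heP a).symm.trans ((by rw [hab]) : _ ↔ _) |>.trans (heP b)
      have h2 := (heQ a).symm.trans ((by rw [hab]) : _ ↔ _) |>.trans (heQ b)
      rcases a with i | i | _ | i <;> rcases b with j | j | _ | j <;> simp [kind] at h1 h2
      · rw [hcinj hab]
      · rw [hrinj hab]
      · rfl
      · rw [hπb.1 (hminj hab)]
    · intro x
      by_cases hx0 : x = i₀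
      · exact ⟨inf, hx0.symm⟩
      by_cases hxP : OnLine P (A x)
      · obtain ⟨i, hi⟩ := (hcm x).1 (Finset.mem_erase.2 ⟨hx0, (mP x).2 hxP⟩)
        exact ⟨col i, hi⟩
      by_cases hxQ : OnLine Q (A x)
      · obtain ⟨i, hi⟩ := (hrm x).1 (Finset.mem_erase.2 ⟨hx0, (mQ x).2 hxQ⟩)
        exact ⟨row i, hi⟩
      obtain ⟨i, hi⟩ := (hm' x).1 ⟨hxP, hxQ⟩
      obtain ⟨i, rfl⟩ := hπb.2 i
      exact ⟨obl i, hi⟩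
  refine ⟨e, hbij, P, Q, hA.comp hbij.1, heP, heQ, ?_, ?_, ?_⟩
  · refine ⟨R, hR0, ?_, ?_⟩
    · change OnLine R (A (m (π 0)))
      rwa [π0]
    · change OnLine R (A (m (π 1)))
      rwa [π1]
  · intro R hRP hRQ w x y z hn hw hx hy hz
    have := mult_eq_four h5 (R := R) (w := e w) (x := e x) (y := e y) (z := e z)
      (by simpa using hn.map hbij.1) hw hx hy hz
    rw [hquad] at this
    tauto
  · intro l R₁ R₂
    obtain ⟨R, h1, h2, h3, x, y, hx, hy, hxy, hRx, hRy⟩ := hNR.exists_point (e l) R₁ R₂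
    obtain ⟨x, rfl⟩ := hbij.2 x
    obtain ⟨y, rfl⟩ := hbij.2 y
    exact ⟨R, h1, h2, h3, x, y, fun h => hx (by rw [h]), fun h => hy (by rw [h]),
      fun h => hxy (by rw [h]), hRx, hRy⟩

end LineArrangement

namespace LineArrangement

open Projectivization Label

/-! ### Realizations of a lattice with a given code -/

/-- Every realization of the lattice of an arrangement with the code `c` has a normal form with the
code `c`. -/
theorem SameLattice.exists_param {A B : Lines 10} (hAB : SameLattice A B)
    (hA : Function.Injective A) (e : Label ≃ Fin 10) {c : Code} (hb : Base (A ∘ e))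
    (hc : HasCode (A ∘ e) c) :
    ∃ q : Param, q.Good ∧ q.HasCode c ∧ projSetoid 10 (q.lines ∘ e.symm) B := by
  have hconc : ∀ x y z, Conc ((A ∘ e) x) ((A ∘ e) y) ((A ∘ e) z) ↔
      Conc ((B ∘ e) x) ((B ∘ e) y) ((B ∘ e) z) := fun x y z => hAB.conc_iff _ _ _
  obtain ⟨g, q, hq, h⟩ := (hb.congr ((hAB.injective hA).comp e.injective) hconc).exists_param
  refine ⟨q, hq, Param.hasCode_iff.1 ((hc.congr hconc).congr fun x y z => ?_), ?_⟩
  · rw [← h, ← h, ← h, conc_smul_iff]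
  · rw [projSetoid_iff]
    refine ⟨g, fun i => ?_⟩
    simpa using h (e.symm i)

/-- Projectively equivalent arrangements in normal form are equal. -/
theorem Param.eq_of_smul {q q' : Param} (g : V ≃ₗ[ℂ] V) (h : ∀ l, g • q'.lines l = q.lines l) :
    q = q' := by
  have key : ∀ l, ∃ c : ℂ, c • q.coef l = g (q'.coef l) := by
    intro l
    have := h l
    rw [lines, lines, smul_mk, mk_eq_mk_iff'] at this
    exact this
  have lin : ∀ v : V, g v = v 0 • g ![1, 0, 0] + v 1 • g ![0, 1, 0] + v 2 • g ![0, 0, 1] := by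
    intro v
    rw [← map_smul, ← map_smul, ← map_smul, ← map_add, ← map_add]
    congr 1
    ext i
    fin_cases i <;> simp
  -- The lines `col 0`, `row 0` and `inf` make g diagonal, and `col 1` and `row 1` force its three
  -- entries to be equal.
  obtain ⟨c0, h0⟩ := key (col 0)
  obtain ⟨c1, h1⟩ := key (row 0)
  obtain ⟨c2, h2⟩ := key inf
  obtain ⟨c3, h3⟩ := key (col 1)
  obtain ⟨c4, h4⟩ := key (row 1)
  simp only [coef, a, b, Matrix.cons_val_zero, Matrix.cons_val_one, neg_zero] at h0 h1 h2 h3 h4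
  have e3 := fun i => congrFun h3 i
  have e4 := fun i => congrFun h4 i
  simp only [lin ![1, 0, -1], lin ![0, 1, -1], ← h0, ← h1, ← h2] at e3 e4
  have e30 := e3 0
  have e32 := e3 2
  have e41 := e4 1
  have e42 := e4 2
  simp at e30 e32 e41 e42
  have hg : ∀ v, g v = c2 • v := by
    intro v
    rw [lin, ← h0, ← h1, ← h2]
    ext i
    fin_cases i <;> simp <;> grind
  have hc2 : c2 ≠ 0 := by
    rintro rfl
    have := (hg ![1, 0, 0]).trans (zero_smul _ _)
    rw [LinearEquiv.map_eq_zero_iff] at this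
    simpa using congrFun this 0
  have hcoef : ∀ l, ∃ c : ℂ, c • q.coef l = q'.coef l := by
    intro l
    obtain ⟨c, hc⟩ := key l
    refine ⟨c2⁻¹ * c, ?_⟩
    rw [mul_smul, hc, hg, smul_smul, inv_mul_cancel₀ hc2, one_smul]
  have hobl : ∀ k, q.slope k = q'.slope k ∧ q.icept k = q'.icept k := by
    intro k
    obtain ⟨c, hc⟩ := hcoef (obl k)
    have a0 := congrFun hc 0
    have a1 := congrFun hc 1
    have a2 := congrFun hc 2
    simp [coef] at a0 a1 a2
    simpa [a1] using And.intro a0 a2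
  have hs : q.s = q'.s := by
    obtain ⟨c, hc⟩ := hcoef (col 2)
    have a0 := congrFun hc 0
    have a2 := congrFun hc 2
    simp [coef, a] at a0 a2
    simpa [a0] using a2
  have ht : q.t = q'.t := by
    obtain ⟨c, hc⟩ := hcoef (row 2)
    have a0 := congrFun hc 1
    have a2 := congrFun hc 2
    simp [coef, b] at a0 a2
    simpa [a0] using a2
  obtain ⟨o1, o2⟩ := hobl 0
  obtain ⟨-, o3⟩ := hobl 1
  obtain ⟨o4, o5⟩ := hobl 2
  cases q
  cases q'
  simp only [slope, icept, Matrix.cons_val] at o1 o2 o3 o4 o5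
  rw [mk.injEq]
  exact ⟨hs, ht, o1, o2, o3, o4, o5⟩

/-! ### Moduli spaces of the four families -/

theorem Moduli.mk_eq_mk_iff {n : ℕ} {A : Lines n} {B C : Realization A} :
    Moduli.mk B = Moduli.mk C ↔ projSetoid n B.val C.val :=
  Quotient.eq

/-- A family of arrangements which are the solutions of the equations given by a code. -/
structure IsSolution {ι : Type} [Star ι] (co : ι → Fin 10 → V) (par : Set ι) (e : Label ≃ Fin 10)
    (c : Code) (p : ι → Param) : Prop where
  coef : ∀ t l, co t (e l) = (p t).coef l
  star_coef : ∀ t i, star (co t i) = co (star t) i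
  star_mem : ∀ t ∈ par, star t ∈ par
  inj : Function.Injective p
  good : ∀ t ∈ par, (p t).Good
  hasCode : ∀ t ∈ par, (p t).HasCode c
  solve : ∀ q : Param, q.Good → q.HasCode c → ∃ t ∈ par, q = p t

namespace IsSolution

variable {ι : Type} [InvolutiveStar ι] {co : ι → Fin 10 → V} {par : Set ι} {e : Label ≃ Fin 10}
  {c : Code} {p : ι → Param}

theorem fam_eq (h : IsSolution co par e c p) (hco : ∀ t i, co t i ≠ 0) (t : ι) :
    ofCoeffs (co t) (hco t) = (p t).lines ∘ e.symm := by
  funext i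
  refine mk_ext ?_
  rw [← h.coef, e.apply_symm_apply]

theorem fam_injective (h : IsSolution co par e c p) (hco : ∀ t i, co t i ≠ 0) {t : ι}
    (ht : t ∈ par) : Function.Injective (ofCoeffs (co t) (hco t)) := by
  rw [h.fam_eq hco]
  exact (Param.lines_injective (h.good t ht)).comp e.symm.injective

/-- A realization has a normal form with the same code, and these are exactly the members of the
family. Conversely, equal codes have equal concurrent triples. -/
theorem sameLattice_iff (h : IsSolution co par e c p) (hco : ∀ t i, co t i ≠ 0) {t : ι}
    (ht : t ∈ par) (B : Lines 10) : SameLattice (ofCoeffs (co t) (hco t)) B ↔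
      ∃ s ∈ par, projSetoid 10 (ofCoeffs (co s) (hco s)) B := by
  constructor
  · intro hB
    have hX : ofCoeffs (co t) (hco t) ∘ e = (p t).lines := by
      rw [h.fam_eq hco, Function.comp_assoc, e.symm_comp_self, Function.comp_id]
    obtain ⟨q, hq, hqc, hp⟩ := hB.exists_param (h.fam_injective hco ht) e (c := c)
      (hX ▸ Param.base (h.good t ht)) (hX ▸ Param.hasCode_iff.2 (h.hasCode t ht))
    obtain ⟨s, hs, rfl⟩ := h.solve q hq hqc
    exact ⟨s, hs, by rwa [h.fam_eq hco]⟩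
  · rintro ⟨s, hs, hB⟩
    refine SameLattice.trans ?_ (sameLattice_of_proj (h.fam_injective hco hs) hB)
    refine sameLattice_of_conc_iff (h.fam_injective hco ht) (h.fam_injective hco hs) fun i j k => ?_
    rw [h.fam_eq hco, h.fam_eq hco]
    exact Param.conc_congr (h.good t ht) (h.good s hs) (Param.hasCode_iff.2 (h.hasCode t ht))
      (Param.hasCode_iff.2 (h.hasCode s hs)) _ _ _

/-- Normal forms are unique, and the parameter can be recovered from them. -/
theorem eq_of_proj (h : IsSolution co par e c p) (hco : ∀ t i, co t i ≠ 0) {s t : ι}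
    (hst : projSetoid 10 (ofCoeffs (co s) (hco s)) (ofCoeffs (co t) (hco t))) : s = t := by
  rw [projSetoid_iff] at hst
  obtain ⟨g, hg⟩ := hst
  refine h.inj (Param.eq_of_smul g fun l => ?_)
  have := hg (e l)
  rw [h.fam_eq hco, h.fam_eq hco] at this
  simpa using this

theorem conj_fam (h : IsSolution co par e c p) (hco : ∀ t i, co t i ≠ 0) (t : ι) :
    conj (ofCoeffs (co t) (hco t)) = ofCoeffs (co (star t)) (hco (star t)) := by
  funext i
  simp only [conj, ofCoeffs, map_mk]
  exact mk_ext (h.star_coef t i)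

/-- The realization of the lattice of one member of the family which is given by another member. -/
noncomputable def realization (h : IsSolution co par e c p) (hco : ∀ t i, co t i ≠ 0) {t : ι}
    (ht : t ∈ par) (s : par) : Realization (ofCoeffs (co t) (hco t)) :=
  ⟨ofCoeffs (co s) (hco s), (h.sameLattice_iff hco ht _).2 ⟨s, s.2, (projSetoid 10).refl _⟩⟩

theorem mk_realization_bijective (h : IsSolution co par e c p) (hco : ∀ t i, co t i ≠ 0) {t : ι}
    (ht : t ∈ par) : Function.Bijective fun s => Moduli.mk (h.realization hco ht s) := by
  constructor
  · intro s s' hs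
    exact Subtype.ext (h.eq_of_proj hco (Moduli.mk_eq_mk_iff.1 hs))
  · rintro ⟨B⟩
    obtain ⟨s, hs, hB⟩ := (h.sameLattice_iff hco ht B.val).1 B.2
    exact ⟨⟨s, hs⟩, Moduli.mk_eq_mk_iff.2 hB⟩

/-- A real representative equals its conjugate, so the classes of s and `star s` agree and
`eq_of_proj` applies. Conversely, a self-conjugate parameter has self-conjugate, hence real,
coefficients. -/
theorem isRealPoint_iff (h : IsSolution co par e c p) (hco : ∀ t i, co t i ≠ 0) {t : ι}
    (ht : t ∈ par) (s : par) :
    IsRealPoint (Moduli.mk (h.realization hco ht s)) ↔ star s.1 = s.1 := by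
  constructor
  · rintro ⟨B, hB, hreal⟩
    have hconj : conj B.val = B.val := by
      funext i
      obtain ⟨v, hv, hi⟩ := hreal i
      simp only [conj, hi, map_mk]
      refine mk_ext ?_
      ext j
      simp [conjV]
    have h1 := Moduli.mk_eq_mk_iff.1 hB
    have h2 := projSetoid_conj h1
    rw [hconj] at h2
    have h3 := (projSetoid 10).trans ((projSetoid 10).symm h2) h1
    change projSetoid 10 (conj (ofCoeffs (co s.1) (hco s.1))) (ofCoeffs (co s.1) (hco s.1)) at h3
    rw [h.conj_fam] at h3
    exact h.eq_of_proj hco h3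
  · intro hs
    refine ⟨_, rfl, fun i => ?_⟩
    have hv : (fun j => ((co s.1 i j).re : ℂ)) = co s.1 i := by
      funext j
      have := congrFun (h.star_coef s.1 i) j
      rw [hs] at this
      exact Complex.conj_eq_iff_re.1 this
    exact ⟨fun j => (co s.1 i j).re, hv ▸ hco s.1 i, mk_ext hv.symm⟩

/-- The parameters of the members of the family which are projectively equivalent to a
point of the moduli space or its conjugate. -/
def parameters (hco : ∀ t i, co t i ≠ 0) (par : Set ι) (A : Lines 10) : ModuliConj A → Set ι :=
  Quot.lift (Quotient.lift (fun B : Realization A =>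
      {s | s ∈ par ∧ (projSetoid 10 (ofCoeffs (co s) (hco s)) B.val ∨
        projSetoid 10 (ofCoeffs (co s) (hco s)) (conj B.val))}) (by
      intro B C hBC
      have h1 : projSetoid 10 B.val C.val := hBC
      have h2 := projSetoid_conj h1
      ext s
      refine and_congr_right fun _ => or_congr ?_ ?_
      · exact ⟨fun h => (projSetoid 10).trans h h1,
          fun h => (projSetoid 10).trans h ((projSetoid 10).symm h1)⟩
      · exact ⟨fun h => (projSetoid 10).trans h h2,
          fun h => (projSetoid 10).trans h ((projSetoid 10).symm h2)⟩)) (by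
    rintro _ _ ⟨B, B', rfl, rfl, h⟩
    change {s | s ∈ par ∧ _} = {s | s ∈ par ∧ _}
    ext s
    simp only [h, conj_conj]
    exact and_congr_right fun _ => or_comm)

theorem parameters_mk (h : IsSolution co par e c p) (hco : ∀ t i, co t i ≠ 0) {t : ι}
    (ht : t ∈ par) (s : par) :
    parameters hco par _ (Quot.mk _ (Moduli.mk (h.realization hco ht s))) = {s.1, star s.1} := by
  change {r | r ∈ par ∧ (projSetoid 10 (ofCoeffs (co r) (hco r)) (ofCoeffs (co s.1) (hco s.1)) ∨
        projSetoid 10 (ofCoeffs (co r) (hco r)) (conj (ofCoeffs (co s.1) (hco s.1))))} = _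
  ext r
  rw [h.conj_fam]
  constructor
  · rintro ⟨-, h1 | h1⟩
    · exact Or.inl (h.eq_of_proj hco h1)
    · exact Or.inr (h.eq_of_proj hco h1)
  · rintro (rfl | rfl)
    · exact ⟨s.2, Or.inl ((projSetoid 10).refl _)⟩
    · exact ⟨h.star_mem _ s.2, Or.inr ((projSetoid 10).refl _)⟩

theorem mk_realization_surjective (h : IsSolution co par e c p) (hco : ∀ t i, co t i ≠ 0) {t : ι}
    (ht : t ∈ par) (m : ModuliConj (ofCoeffs (co t) (hco t))) :
    ∃ s, Quot.mk _ (Moduli.mk (h.realization hco ht s)) = m := by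
  obtain ⟨m, rfl⟩ := Quot.mk_surjective m
  obtain ⟨s, rfl⟩ := (h.mk_realization_bijective hco ht).2 m
  exact ⟨s, rfl⟩

/-- The set {s, star s} is a complete invariant of a point of the quotient by conjugation, which
reduces the count to pairs of conjugate parameters. -/
theorem parameters_injective (h : IsSolution co par e c p) (hco : ∀ t i, co t i ≠ 0) {t : ι}
    (ht : t ∈ par) :
    Function.Injective (parameters hco par (ofCoeffs (co t) (hco t))) := by
  intro m m' hm
  obtain ⟨s, rfl⟩ := h.mk_realization_surjective hco ht m
  obtain ⟨s', rfl⟩ := h.mk_realization_surjective hco ht m'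
  rw [h.parameters_mk, h.parameters_mk] at hm
  obtain hs | hs : s'.1 = s.1 ∨ s'.1 = star s.1 := by
    have : s'.1 ∈ ({s.1, star s.1} : Set ι) := hm ▸ Or.inl rfl
    exact this
  · rw [Subtype.ext hs]
  · refine Quot.sound ⟨_, _, rfl, rfl, ?_⟩
    change ofCoeffs (co s'.1) (hco s'.1) = conj (ofCoeffs (co s.1) (hco s.1))
    rw [h.conj_fam, hs]

theorem hasModuli (h : IsSolution co par e c p) (hco : ∀ t i, co t i ≠ 0) {k r m : ℕ}
    (hk : par.ncard = k) (hr : {s | s ∈ par ∧ star s = s}.ncard = r)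
    (hm : ((fun s => ({s, star s} : Set ι)) '' par).ncard = m) :
    HasModuli (fun t => ofCoeffs (co t) (hco t)) par k r m := by
  intro t ht
  refine ⟨h.sameLattice_iff hco ht, ?_, ?_, ?_⟩
  · rw [← hk, ← Nat.card_coe_set_eq]
    exact (Nat.card_eq_of_bijective _ (h.mk_realization_bijective hco ht)).symm
  · have hb := h.mk_realization_bijective hco ht
    let φ : {s : par // star s.1 = s.1} ≃ {m : Moduli (ofCoeffs (co t) (hco t)) // IsRealPoint m} :=
      (Equiv.ofBijective _ hb).subtypeEquiv fun s => (h.isRealPoint_iff hco ht s).symm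
    rw [← hr, ← Nat.card_coe_set_eq, ← Nat.card_congr φ]
    exact Nat.card_congr (Equiv.subtypeSubtypeEquivSubtypeInter (· ∈ par) fun s => star s = s)
  · rw [← hm, ← Nat.card_coe_set_eq, ← Nat.card_range_of_injective (h.parameters_injective hco ht)]
    congr 2
    ext S
    constructor
    · rintro ⟨m, rfl⟩
      obtain ⟨s, rfl⟩ := h.mk_realization_surjective hco ht m
      exact ⟨s, s.2, (h.parameters_mk hco ht s).symm⟩
    · rintro ⟨s, hs, rfl⟩
      exact ⟨_, h.parameters_mk hco ht ⟨s, hs⟩⟩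

theorem hasModuli_two (h : IsSolution co par e c p) (hco : ∀ t i, co t i ≠ 0) {a b : ι}
    (hpar : par = {a, b}) (hab : a ≠ b) (ha : star a = a) (hb : star b = b) :
    HasModuli (fun t => ofCoeffs (co t) (hco t)) par 2 2 2 := by
  have hk : par.ncard = 2 := hpar ▸ Set.ncard_pair hab
  refine h.hasModuli hco hk ?_ ?_
  · convert hk using 2
    ext s
    refine and_iff_left_of_imp fun hs => ?_
    rw [hpar] at hs
    obtain rfl | rfl := hs
    exacts [ha, hb]
  · rw [hpar, Set.image_pair, ha, hb, Set.pair_eq_singleton, Set.pair_eq_singleton,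
      Set.ncard_pair (by simpa using hab)]

theorem hasModuli_three (h : IsSolution co par e c p) (hco : ∀ t i, co t i ≠ 0) {a b : ι}
    (hpar : par = {a, b, star b}) (ha : star a = a) (hb : star b ≠ b) :
    HasModuli (fun t => ofCoeffs (co t) (hco t)) par 3 1 2 := by
  have hab : a ≠ b := by
    rintro rfl
    exact hb ha
  have hab' : a ≠ star b := by
    rintro rfl
    exact hb ((star_star b).symm.trans ha).symm
  refine h.hasModuli hco ?_ ?_ ?_
  · rw [hpar, Set.ncard_eq_three]
    exact ⟨a, b, star b, hab, hab', hb.symm, rfl⟩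
  · rw [Set.ncard_eq_one]
    refine ⟨a, Set.ext fun s => ⟨?_, ?_⟩⟩
    · rintro ⟨hs, hs'⟩
      rw [hpar] at hs
      obtain rfl | rfl | rfl := hs
      · rfl
      · exact absurd hs' hb
      · rw [star_star] at hs'
        exact absurd hs'.symm hb
    · rintro rfl
      exact ⟨hpar ▸ Or.inl rfl, ha⟩
  · rw [hpar, Set.image_insert_eq, Set.image_pair, star_star, Set.pair_comm (star b) b,
      Set.pair_eq_singleton {b, star b}, ha, Set.pair_eq_singleton, Set.ncard_pair]
    intro h
    have hmem : b ∈ ({a} : Set ι) := h ▸ Or.inl rfl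
    exact hab hmem.symm

end IsSolution

end LineArrangement

/-! ### The four families as solution sets of their codes -/

namespace LineArrangement

open Label

/-- The labels of the lines of the first family. -/
def index₁ : Label ≃ Fin 10 where
  toFun
    | col i => ![0, 3, 5] i
    | row j => ![1, 4, 6] j
    | inf => 2
    | obl k => ![7, 8, 9] k
  invFun := ![col 0, row 0, inf, col 1, row 1, col 2, row 2, obl 0, obl 1, obl 2]
  left_inv := by
    rintro (i | i | _ | i)
    · fin_cases i <;> rfl
    · fin_cases i <;> rfl
    · rfl
    · fin_cases i <;> rfl
  right_inv := by
    intro i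
    fin_cases i <;> rfl

/-- The labels of the lines of the other three families. -/
def index₂ : Label ≃ Fin 10 where
  toFun
    | col i => ![0, 3, 5] i
    | row j => ![1, 4, 6] j
    | inf => 2
    | obl k => ![8, 9, 7] k
  invFun := ![col 0, row 0, inf, col 1, row 1, col 2, row 2, obl 2, obl 0, obl 1]
  left_inv := by
    rintro (i | i | _ | i)
    · fin_cases i <;> rfl
    · fin_cases i <;> rfl
    · rfl
    · fin_cases i <;> rfl
  right_inv := by
    intro i
    fin_cases i <;> rfl

theorem isSolution₁ : IsSolution coeffs₁ par₁ index₁ code₁ param₁ where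
  coef t l := by
    rcases l with i | i | _ | i <;> try fin_cases i
    all_goals ext j; fin_cases j <;>
      simp [index₁, coeffs₁, Param.coef, Param.a, Param.b, Param.slope, Param.icept, param₁]
  star_coef t i := by
    fin_cases i <;> ext j <;> fin_cases j <;> simp [coeffs₁]
  star_mem t ht := by
    rw [mem_par₁_iff] at *
    rw [← star_pow, ht]
    simp
  inj s t h := by simpa [param₁] using congrArg Param.s h
  good _ := param₁_good
  hasCode _ := param₁_hasCode
  solve _ hq h := h.eq_param₁ hq

theorem isSolution₂ : IsSolution coeffs₂ par₂ index₂ code₂ param₂ where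
  coef t l := by
    rcases l with i | i | _ | i <;> try fin_cases i
    all_goals ext j; fin_cases j <;>
      simp [index₂, coeffs₂, Param.coef, Param.a, Param.b, Param.slope, Param.icept, param₂]
  star_coef t i := by
    fin_cases i <;> ext j <;> fin_cases j <;> simp [coeffs₂]
  star_mem t ht := by
    rw [mem_par₂_iff] at *
    have h1 := congrArg star ht.1
    have h2 := congrArg star ht.2
    simpa using And.intro h1 h2
  inj s t h := Prod.ext (congrArg Param.s h) (congrArg Param.t h)
  good _ := param₂_good
  hasCode _ := param₂_hasCode
  solve _ hq h := h.eq_param₂ hq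

theorem isSolution₃ : IsSolution coeffs₃ par₃ index₂ code₃ param₃ where
  coef t l := by
    rcases l with i | i | _ | i <;> try fin_cases i
    all_goals ext j; fin_cases j <;>
      simp [index₂, coeffs₃, Param.coef, Param.a, Param.b, Param.slope, Param.icept, param₃]
  star_coef t i := by
    fin_cases i <;> ext j <;> fin_cases j <;> simp [coeffs₃]
  star_mem t ht := by
    rw [mem_par₃_iff] at *
    rw [← star_pow, ← star_add, ht, star_one]
  inj s t h := congrArg Param.t h
  good _ := param₃_good
  hasCode _ := param₃_hasCode
  solve _ hq h := h.eq_param₃ hq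

theorem isSolution₄ : IsSolution coeffs₄ par₄ index₂ code₄ param₄ where
  coef t l := by
    rcases l with i | i | _ | i <;> try fin_cases i
    all_goals ext j; fin_cases j <;>
      simp [index₂, coeffs₄, Param.coef, Param.a, Param.b, Param.slope, Param.icept, param₄]
  star_coef t i := by
    fin_cases i <;> ext j <;> fin_cases j <;> simp [coeffs₄]
  star_mem t ht := by
    rw [mem_par₄_iff] at *
    rw [← star_pow, ht]
    simp
  inj s t h := congrArg Param.κ h
  good _ := param₄_good
  hasCode _ := param₄_hasCode
  solve _ hq h := h.eq_param₄ hq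

theorem hasModuli₁ : HasModuli fam₁ par₁ 2 2 2 := by
  refine isSolution₁.hasModuli_two coeffs₁_ne_zero (a := (1 + (√5 : ℝ)) / 2)
    (b := (1 - (√5 : ℝ)) / 2) rfl ?_ (by simp) (by simp)
  intro h
  have h5 : ((√5 : ℝ) : ℂ) = 0 := by linear_combination h
  simp at h5

theorem hasModuli₃ : HasModuli fam₃ par₃ 2 2 2 := by
  refine isSolution₃.hasModuli_two coeffs₃_ne_zero (a := (-1 + (√5 : ℝ)) / 2)
    (b := (-1 - (√5 : ℝ)) / 2) rfl ?_ (by simp) (by simp)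
  intro h
  have h5 : ((√5 : ℝ) : ℂ) = 0 := by linear_combination h
  simp at h5

theorem hasModuli₄ : HasModuli fam₄ par₄ 2 2 2 := by
  refine isSolution₄.hasModuli_two coeffs₄_ne_zero (a := (√2 : ℝ)) (b := -(√2 : ℝ)) rfl ?_
    (by simp) (by simp)
  intro h
  have h5 : ((√2 : ℝ) : ℂ) = 0 := by linear_combination h / 2
  simp at h5

/-- The cubic of the second family has exactly one real root and a pair of conjugate roots. -/
theorem exists_roots_cubic : ∃ (r : ℝ) (z : ℂ), star z ≠ z ∧
    ∀ u : ℂ, u ^ 3 - u ^ 2 + 1 = 0 ↔ u = r ∨ u = z ∨ u = star z := by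
  -- The cubic changes sign on [-1, -1/3]. The cofactor of u - r has discriminant (1 - r)(1 + 3r),
  -- so a root below -1/3 makes the other two roots non-real; d is the square root of minus this
  -- discriminant.
  obtain ⟨r, ⟨hr1, hr2⟩, hr⟩ := intermediate_value_Icc (a := (-1 : ℝ)) (b := -1 / 3)
    (f := fun u => u ^ 3 - u ^ 2 + 1) (by norm_num) (by fun_prop)
    (show (0 : ℝ) ∈ _ by constructor <;> norm_num)
  have hr3 : r < -1 / 3 := by
    refine lt_of_le_of_ne hr2 ?_
    rintro rfl
    norm_num at hr
  simp only at hr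
  have hpos : 0 < (1 - r) * (-1 - 3 * r) := by
    apply mul_pos <;> linarith
  set d := √((1 - r) * (-1 - 3 * r)) with hd
  have hd0 : 0 < d := Real.sqrt_pos.2 hpos
  have hd2 : (d : ℂ) ^ 2 = (1 - r) * (-1 - 3 * r) := by
    have := Real.sq_sqrt hpos.le
    rw [← hd] at this
    exact_mod_cast this
  have hrc : (r : ℂ) ^ 3 - r ^ 2 + 1 = 0 := by exact_mod_cast hr
  have hstar : star ((1 - r + d * Complex.I) / 2) = (1 - r - d * Complex.I) / 2 := by
    simp [sub_eq_add_neg]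
  refine ⟨r, (1 - r + d * Complex.I) / 2, ?_, fun u => ?_⟩
  · rw [hstar]
    intro h
    have h0 : (d : ℂ) * Complex.I = 0 := by linear_combination -h
    simp [hd0.ne'] at h0
  · rw [hstar]
    have hI := Complex.I_sq
    have : u ^ 3 - u ^ 2 + 1 = (u - r) * ((u - (1 - r + d * Complex.I) / 2) *
        (u - (1 - r - d * Complex.I) / 2)) := by
      linear_combination hrc + (u - r) * d ^ 2 * hI / 4 - (u - r) * hd2 / 4
    rw [this, mul_eq_zero, mul_eq_zero, sub_eq_zero, sub_eq_zero, sub_eq_zero]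

theorem hasModuli₂ : HasModuli fam₂ par₂ 3 1 2 := by
  obtain ⟨r, z, hz, hroot⟩ := exists_roots_cubic
  refine isSolution₂.hasModuli_three coeffs₂_ne_zero (a := ((r : ℂ) ^ 2, (r : ℂ) + 1))
    (b := (z ^ 2, z + 1)) ?_ ?_ ?_
  · ext ⟨t₁, t₂⟩
    rw [mem_par₂_iff, hroot]
    simp only [Set.mem_insert_iff, Set.mem_singleton_iff, Prod.mk.injEq, Prod.star_def, star_pow,
      star_add, star_one, sub_eq_iff_eq_add]
    constructor
    · rintro ⟨rfl, rfl | rfl | rfl⟩ <;> simp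
    · rintro (⟨rfl, rfl⟩ | ⟨rfl, rfl⟩ | ⟨rfl, rfl⟩) <;> simp
  · simp [Prod.star_def]
  · intro h
    apply hz
    have := congrArg Prod.snd h
    simpa using this

end LineArrangement

namespace LineArrangement

open Projectivization Label

/-! ### Irreducible moduli spaces -/

/-- The parameters of the complex conjugate arrangement. -/
noncomputable def Param.conj (q : Param) : Param :=
  ⟨star q.s, star q.t, star q.κ, star q.γ₀, star q.γ₁, star q.μ, star q.ν⟩

theorem Param.conj_lines (q : Param) (e : Label ≃ Fin 10) :
    LineArrangement.conj (q.lines ∘ e.symm) = q.conj.lines ∘ e.symm := by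
  funext i
  simp only [LineArrangement.conj, Function.comp, Param.lines, map_mk]
  refine mk_ext ?_
  ext j
  rcases e.symm i with k | k | _ | k
  · fin_cases k <;> fin_cases j <;> simp [conjV, Param.coef, Param.a, Param.conj]
  · fin_cases k <;> fin_cases j <;> simp [conjV, Param.coef, Param.b, Param.conj]
  · fin_cases j <;> simp [conjV, Param.coef]
  · fin_cases k <;> fin_cases j <;>
      simp [conjV, Param.coef, Param.slope, Param.icept, Param.conj]

theorem nonempty_moduliConj {n : ℕ} (A : Lines n) : Nonempty (ModuliConj A) :=
  ⟨Quot.mk _ (Moduli.mk ⟨A, fun _ _ => rfl⟩)⟩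

/-- If the code determines the normal form up to complex conjugation, then `ModuliConj A` is a
point. -/
theorem irreducibleSpace_of_eq_or_conj {A : Lines 10} (hA : Function.Injective A)
    (e : Label ≃ Fin 10) {c : Code} (hb : Base (A ∘ e)) (hc : HasCode (A ∘ e) c)
    (h : ∀ q q' : Param, q.Good → q'.Good → q.HasCode c → q'.HasCode c → q' = q ∨ q' = q.conj) :
    IrreducibleSpace (ModuliConj A) := by
  have := nonempty_moduliConj A
  have key : ∀ B B' : Realization A, (Quot.mk _ (Moduli.mk B) : ModuliConj A) =
      Quot.mk _ (Moduli.mk B') := by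
    intro B B'
    obtain ⟨q, hq, hqc, hB⟩ := B.2.exists_param hA e hb hc
    obtain ⟨q', hq', hqc', hB'⟩ := B'.2.exists_param hA e hb hc
    have real : ∀ (q : Param) (B : Realization A), projSetoid 10 (q.lines ∘ e.symm) B.val →
        SameLattice A (q.lines ∘ e.symm) := fun q B hB =>
      B.2.trans (sameLattice_of_proj (B.2.injective hA) ((projSetoid 10).symm hB))
    have h1 : Moduli.mk ⟨_, real q B hB⟩ = Moduli.mk B := Moduli.mk_eq_mk_iff.2 hB
    have h2 : Moduli.mk ⟨_, real q' B' hB'⟩ = Moduli.mk B' := Moduli.mk_eq_mk_iff.2 hB'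
    obtain rfl | rfl := h q q' hq hq' hqc hqc'
    · rw [← h1, ← h2]
    · exact Quot.sound ⟨_, _, h1, h2, (q.conj_lines e).symm⟩
  have hs : Subsingleton (ModuliConj A) := ⟨by
    rintro ⟨⟨B⟩⟩ ⟨⟨B'⟩⟩
    exact key B B'⟩
  have : PreirreducibleSpace (ModuliConj A) :=
    ⟨(Set.subsingleton_univ_iff.2 hs).isPreirreducible⟩
  exact ⟨inferInstance⟩

theorem star_eq_neg_of_sq_eq_neg_one {s : ℂ} (h : s ^ 2 = -1) : star s = -s := by
  have : (s - Complex.I) * (s + Complex.I) = 0 := by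
    linear_combination h - Complex.I_sq
  rcases mul_eq_zero.1 this with h | h
  · rw [sub_eq_zero.1 h]
    simp
  · rw [eq_neg_of_add_eq_zero_left h]
    simp

theorem eq_or_eq_star_of_sq_eq_neg_one {s s' : ℂ} (h : s ^ 2 = -1) (h' : s' ^ 2 = -1) :
    s' = s ∨ s' = star s := by
  rw [star_eq_neg_of_sq_eq_neg_one h]
  exact sq_eq_sq_iff_eq_or_eq_neg.1 (h'.trans h.symm)

/-- Multihomogeneity of polynomial functions in the coordinates of several vectors. -/
theorem eval_smul_of_isWeightedHomogeneous {n : ℕ} {F : MvPolynomial (Fin n × Fin 3) ℂ}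
    {d : Fin n → ℕ}
    (hF : F.IsWeightedHomogeneous (fun p : Fin n × Fin 3 => (Pi.single p.1 1 : Fin n → ℕ)) d)
    (c : Fin n → ℂ) (x : Fin n × Fin 3 → ℂ) :
    MvPolynomial.eval (fun p => c p.1 * x p) F = (∏ i, c i ^ d i) * MvPolynomial.eval x F := by
  rw [MvPolynomial.eval_eq', MvPolynomial.eval_eq', Finset.mul_sum]
  refine Finset.sum_congr rfl fun m hm => ?_
  have hd := hF (MvPolynomial.mem_support_iff.1 hm)
  have hdi : ∀ i, ∑ j, m (i, j) = d i := by
    intro i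
    rw [← hd, Finsupp.weight_apply, Finsupp.sum_fintype _ _ (by simp), Finset.sum_apply,
      Fintype.sum_prod_type]
    simp [Pi.single_apply]
  have : ∏ p, c (Prod.fst p) ^ m p = ∏ i, c i ^ d i := by
    rw [Fintype.prod_prod_type]
    refine Finset.prod_congr rfl fun i _ => ?_
    rw [← hdi, ← Finset.prod_pow_eq_pow_sum]
  simp only [mul_pow, Finset.prod_mul_distrib, this]
  ring

/-- The basic Zariski open sets in terms of arbitrary coefficient vectors. -/
theorem eval_rep_ne_zero_iff {n : ℕ} {F : MvPolynomial (Fin n × Fin 3) ℂ} {d : Fin n → ℕ}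
    (hF : F.IsWeightedHomogeneous (fun p : Fin n × Fin 3 => (Pi.single p.1 1 : Fin n → ℕ)) d)
    (c : Fin n → V) (hc : ∀ i, c i ≠ 0) :
    MvPolynomial.eval (fun p => (ofCoeffs c hc p.1).rep p.2) F ≠ 0 ↔
      MvPolynomial.eval (fun p => c p.1 p.2) F ≠ 0 := by
  choose a ha using fun i => exists_smul_eq_mk_rep ℂ (c i) (hc i)
  have : (fun p : Fin n × Fin 3 => (ofCoeffs c hc p.1).rep p.2) =
      fun p => (a p.1 : ℂ) * c p.1 p.2 := by
    funext p
    exact (congrFun (ha p.1) p.2).symm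
  rw [this, eval_smul_of_isWeightedHomogeneous hF (fun i => (a i : ℂ)), mul_ne_zero_iff]
  exact and_iff_right (Finset.prod_ne_zero_iff.2 fun i _ => pow_ne_zero _ (a i).ne_zero)

/-- A family of arrangements whose coefficients are polynomials in one variable is continuous for
the Zariski topology. -/
theorem continuous_ofCoeffs_eval {n : ℕ} (p : Fin n → Fin 3 → Polynomial ℂ)
    (hp : ∀ s i, (fun j => (p i j).eval s) ≠ 0) :
    @Continuous (CofiniteTopology ℂ) (Lines n) _ (zariski n)
      fun s => ofCoeffs (fun i j => (p i j).eval (CofiniteTopology.of.symm s))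
        (hp (CofiniteTopology.of.symm s)) := by
  refine continuous_generateFrom_iff.2 ?_
  rintro _ ⟨F, d, hF, rfl⟩
  -- Along the family, F becomes a polynomial in one variable; if it is nonzero somewhere, it
  -- vanishes at finitely many points only.
  have hev : ∀ s, MvPolynomial.eval (fun q : Fin n × Fin 3 => (p q.1 q.2).eval s) F =
      (MvPolynomial.aeval (fun q : Fin n × Fin 3 => p q.1 q.2) F).eval s := by
    intro s
    rw [← Polynomial.coe_aeval_eq_eval, ← AlgHom.comp_apply, MvPolynomial.comp_aeval,
      MvPolynomial.aeval_eq_eval]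
  rw [CofiniteTopology.isOpen_iff]
  rintro ⟨s, hs⟩
  have hs' := (eval_rep_ne_zero_iff hF _ _).1 hs
  rw [hev] at hs'
  have hne : MvPolynomial.aeval (fun q : Fin n × Fin 3 => p q.1 q.2) F ≠ 0 := by
    intro h
    rw [h] at hs'
    simp at hs'
  refine ((Polynomial.finite_setOfPred_isRoot hne).image CofiniteTopology.of).subset ?_
  intro u hu
  refine ⟨CofiniteTopology.of.symm u, ?_, by simp⟩
  by_contra hroot
  refine hu ((eval_rep_ne_zero_iff hF _ _).2 ?_)
  rw [hev]
  exact hroot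

theorem continuous_paramCurve (e : Label ≃ Fin 10) :
    @Continuous (CofiniteTopology ℂ) (Lines 10) _ (zariski 10)
      fun s => (paramCurve (CofiniteTopology.of.symm s)).lines ∘ e.symm := by
  -- All coefficients are affine in s, so they are interpolated from s = 0 and s = 1.
  let p : Label → Fin 3 → Polynomial ℂ := fun l j =>
    Polynomial.C ((paramCurve 0).coef l j) +
      Polynomial.C ((paramCurve 1).coef l j - (paramCurve 0).coef l j) * Polynomial.X
  have hp : ∀ s l, (fun j => (p l j).eval s) = (paramCurve s).coef l := by
    intro s l
    ext j
    rcases l with k | k | _ | k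
    · fin_cases k <;> fin_cases j <;> simp [p, paramCurve, Param.coef, Param.a]
    · fin_cases k <;> fin_cases j <;> simp [p, paramCurve, Param.coef, Param.b] <;> ring
    · fin_cases j <;> simp [p, Param.coef]
    · fin_cases k <;> fin_cases j <;>
        simp [p, paramCurve, Param.coef, Param.slope, Param.icept] <;> ring
  have hne : ∀ s i, (fun j => (p (e.symm i) j).eval s) ≠ 0 := by
    intro s i
    rw [hp]
    exact Param.coef_ne_zero _ _
  convert continuous_ofCoeffs_eval (fun i => p (e.symm i)) hne using 2 with s
  funext i
  exact mk_ext (hp _ _).symm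

/-- The space is the image of ℂ minus four points under a map continuous for the cofinite topology.
Nonempty open sets have cofinite preimages, and two cofinite subsets of an infinite set meet. -/
theorem irreducibleSpace_of_codeCurve {A : Lines 10} (hA : Function.Injective A)
    (e : Label ≃ Fin 10) (hb : Base (A ∘ e)) (hc : HasCode (A ∘ e) codeCurve) :
    IrreducibleSpace (ModuliConj A) := by
  have := nonempty_moduliConj A
  let U : Set ℂ := {s | s ≠ 0 ∧ s ≠ 1 ∧ s ≠ 2 ∧ 2 * s ≠ 1}
  have hUfin : (CofiniteTopology.of '' Uᶜ).Finite := by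
    refine Set.Finite.image _ (Set.Finite.subset (s := {0, 1, 2, 1 / 2}) (by simp) ?_)
    intro s hs
    simp only [Set.mem_insert_iff, Set.mem_singleton_iff]
    by_contra hcon
    push Not at hcon
    refine hs ⟨hcon.1, hcon.2.1, hcon.2.2.1, fun h => hcon.2.2.2 ?_⟩
    linear_combination h / 2
  have hreal : ∀ s ∈ U, SameLattice A ((paramCurve s).lines ∘ e.symm) := by
    intro s hs
    obtain ⟨q, hq, hqc, hp⟩ := SameLattice.exists_param (fun _ _ => rfl) hA e hb hc
    refine (sameLattice_of_proj hA ((projSetoid 10).symm hp)).trans ?_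
    refine sameLattice_of_conc_iff ((Param.lines_injective hq).comp e.symm.injective)
      ((Param.lines_injective (paramCurve_good hs)).comp e.symm.injective) fun i j k => ?_
    exact Param.conc_congr hq (paramCurve_good hs) (Param.hasCode_iff.2 hqc)
      (Param.hasCode_iff.2 (paramCurve_hasCode hs)) _ _ _
  let π : Realization A → ModuliConj A := fun B => Quot.mk _ (Moduli.mk B)
  have hπ : Continuous π := continuous_quot_mk.comp continuous_quot_mk
  have hsurj : ∀ m : ModuliConj A, ∃ s, ∃ hs : s ∈ U, π ⟨_, hreal s hs⟩ = m := by
    rintro ⟨⟨B⟩⟩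
    obtain ⟨q, hq, hqc, hp⟩ := B.2.exists_param hA e hb hc
    obtain ⟨s, hs, rfl⟩ := hqc.eq_paramCurve hq
    exact ⟨s, hs, congrArg (Quot.mk _) (Moduli.mk_eq_mk_iff.2 hp)⟩
  have key : ∀ W : Set (ModuliConj A), IsOpen W → W.Nonempty →
      ∃ O : Set (CofiniteTopology ℂ), Oᶜ.Finite ∧
        ∀ s (hs : s ∈ U), CofiniteTopology.of s ∈ O → π ⟨_, hreal s hs⟩ ∈ W := by
    rintro W hW ⟨m, hm⟩
    obtain ⟨s, hs, rfl⟩ := hsurj m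
    obtain ⟨O, hO, hOW⟩ := (@isOpen_induced_iff _ _ (zariski 10) _ _).1 (hπ.isOpen_preimage W hW)
    have hmem : ∀ B : Realization A, B.val ∈ O ↔ π B ∈ W := fun B => Set.ext_iff.1 hOW B
    refine ⟨_, CofiniteTopology.isOpen_iff.1
      (@IsOpen.preimage _ _ _ (zariski 10) _ (continuous_paramCurve e) O hO)
      ⟨CofiniteTopology.of s, (hmem ⟨_, hreal s hs⟩).2 hm⟩, fun u hu huO => ?_⟩
    exact (hmem ⟨_, hreal u hu⟩).1 huO
  have : PreirreducibleSpace (ModuliConj A) := by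
    refine ⟨fun W W' hW hW' hne hne' => ?_⟩
    rw [Set.univ_inter] at hne hne' ⊢
    obtain ⟨O, hO, h⟩ := key W hW hne
    obtain ⟨O', hO', h'⟩ := key W' hW' hne'
    obtain ⟨x, hx⟩ := ((hO.union hO').union hUfin).infinite_compl (α := CofiniteTopology ℂ).nonempty
    obtain ⟨s, rfl⟩ := CofiniteTopology.of.surjective x
    simp only [Set.mem_compl_iff, Set.mem_union, not_or, not_not] at hx
    have hs : s ∈ U := by
      by_contra hs
      exact hx.2 ⟨s, hs, rfl⟩
    exact ⟨_, h s hs hx.1.1, h' s hs hx.1.2⟩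
  exact ⟨inferInstance⟩

/-! ### The classification -/

theorem IsSolution.exists_latticeIso {ι : Type} [InvolutiveStar ι] {co : ι → Fin 10 → V}
    {par : Set ι} {e : Label ≃ Fin 10} {c : Code} {p : ι → Param} (h : IsSolution co par e c p)
    (hco : ∀ t i, co t i ≠ 0) {A : Lines 10} (hA : Function.Injective A) (f : Label ≃ Fin 10)
    (hb : Base (A ∘ f)) (hc : HasCode (A ∘ f) c) :
    ∃ t ∈ par, LatticeIso A (ofCoeffs (co t) (hco t)) := by
  obtain ⟨q, hq, hqc, hp⟩ := SameLattice.exists_param (fun _ _ => rfl) hA f hb hc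
  obtain ⟨t, ht, rfl⟩ := h.solve q hq hqc
  -- The permutation compares the two labellings: a line of A goes to the member's line with the
  -- same role.
  refine ⟨t, ht, f.symm.trans e, fun S hS => ?_⟩
  rw [← interDim_comp, h.fam_eq hco]
  have : ((p t).lines ∘ e.symm) ∘ (f.symm.trans e) = (p t).lines ∘ f.symm := by
    funext i
    simp
  rw [this]
  exact sameLattice_of_proj hA ((projSetoid 10).symm hp) S hS

theorem irreducible_or_latticeIso {A : Lines 10} (hA : Function.Injective A)
    (f : Label ≃ Fin 10) (hb : Base (A ∘ f)) {c : Code} (hmem : c ∈ Code.all)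
    (hc : HasCode (A ∘ f) c) :
    IrreducibleSpace (ModuliConj A) ∨
      (∃ t ∈ par₁, LatticeIso A (fam₁ t)) ∨ (∃ t ∈ par₂, LatticeIso A (fam₂ t)) ∨
      (∃ t ∈ par₃, LatticeIso A (fam₃ t)) ∨ (∃ s ∈ par₄, LatticeIso A (fam₄ s)) := by
  obtain ⟨q, hq, hqc, -⟩ := SameLattice.exists_param (fun _ _ => rfl) hA f hb hc
  simp only [Code.all, List.mem_cons, List.not_mem_nil, or_false] at hmem
  rcases hmem with rfl | rfl | rfl | rfl | rfl | rfl | rfl | rfl | rfl | rfl | rfl | rfl | rfl | rfl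
  · exact Or.inr (Or.inl (isSolution₁.exists_latticeIso coeffs₁_ne_zero hA f hb hc))
  · exact Or.inr (Or.inr (Or.inl (isSolution₂.exists_latticeIso coeffs₂_ne_zero hA f hb hc)))
  · exact Or.inr (Or.inr (Or.inr (Or.inl
      (isSolution₃.exists_latticeIso coeffs₃_ne_zero hA f hb hc))))
  · exact Or.inr (Or.inr (Or.inr (Or.inr
      (isSolution₄.exists_latticeIso coeffs₄_ne_zero hA f hb hc))))
  · exact Or.inl (irreducibleSpace_of_codeCurve hA f hb hc)
  · refine Or.inl (irreducibleSpace_of_eq_or_conj hA f hb hc fun q q' hq hq' h h' => Or.inl ?_)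
    rw [h.eq_paramPoint hq, h'.eq_paramPoint hq']
  · refine Or.inl (irreducibleSpace_of_eq_or_conj hA f hb hc fun q q' hq hq' h h' => ?_)
    obtain ⟨s, hs, rfl⟩ := h.eq_paramPair₁ hq
    obtain ⟨s', hs', rfl⟩ := h'.eq_paramPair₁ hq'
    refine (eq_or_eq_star_of_sq_eq_neg_one hs hs').imp (congrArg _) ?_
    rintro rfl
    simp [paramPair₁, Param.conj]
  · refine Or.inl (irreducibleSpace_of_eq_or_conj hA f hb hc fun q q' hq hq' h h' => ?_)
    obtain ⟨s, hs, rfl⟩ := h.eq_paramPair₂ hq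
    obtain ⟨s', hs', rfl⟩ := h'.eq_paramPair₂ hq'
    refine (eq_or_eq_star_of_sq_eq_neg_one hs hs').imp (congrArg _) ?_
    rintro rfl
    simp [paramPair₂, Param.conj]
  · exact absurd hqc hq.not_hasCode_empty₁
  · exact absurd hqc hq.not_hasCode_empty₂
  · exact absurd hqc hq.not_hasCode_empty₃
  · exact absurd hqc hq.not_hasCode_empty₄
  · exact absurd hqc hq.not_hasCode_empty₅
  · exact absurd hqc hq.not_hasCode_empty₆

end LineArrangement

theorem mainTheorem1 :
    (∀ A : Lines 10, Function.Injective A → NonReductive A →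
      numPoints A 4 = 2 → (∀ r : ℕ, 5 ≤ r → numPoints A r = 0) →
      (∃ i, ∀ P, mult A P = 4 → OnLine P (A i)) →
      IrreducibleSpace (ModuliConj A) ∨
        (∃ t ∈ par₁, LatticeIso A (fam₁ t)) ∨
        (∃ t ∈ par₂, LatticeIso A (fam₂ t)) ∨
        (∃ t ∈ par₃, LatticeIso A (fam₃ t)) ∨
        (∃ s ∈ par₄, LatticeIso A (fam₄ s))) ∧
    HasModuli fam₁ par₁ 2 2 2 ∧
    HasModuli fam₂ par₂ 3 1 2 ∧
    HasModuli fam₃ par₃ 2 2 2 ∧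
    HasModuli fam₄ par₄ 2 2 2 := by
  refine ⟨fun A hA hNR h4 h5 hline => ?_, hasModuli₁, hasModuli₂, hasModuli₃, hasModuli₄⟩
  obtain ⟨e, he, P, Q, hF⟩ := exists_frame hA hNR h4 h5 hline
  obtain ⟨e', he', hb, c, hmem, hc⟩ := hF.exists_standard
  exact irreducible_or_latticeIso hA (Equiv.ofBijective _ (he.comp he')) hb hmem hc
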